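/- **Setting.** Let $f=f_1+f_2$ and $g=g_1+g_2$ on $\mathbb R^n$, where $f_1,g_1:\mathbb R^n\to\mathbb R$ are convex and continuously differentiable with $L_{f_1}$-, $L_{g_1}$-Lipschitz gradients, $f_2,g_2:\mathbb R^n\to\mathbb R\cup\{\infty\}$ are proper, lower semicontinuous and convex, and $f_2$ is $l_{f_2}$-Lipschitz on its domain. Put $X=\operatorname{dom}f\cap\operatorname{dom}g$, $f^*=\inf_X f>-\infty$, $g^*=\inf_X g>-\infty$, $p^*=\inf\{f(x):x\in\arg\min g\}$. Assume $p^*-f^*\ge\Delta$ for some $\Delta>0$, and that $\arg\min g$ is non-empty and not a singleton. For $c\in\mathbb R$ let $f_c=f-c$ and $\bar g(c)=\min\{g(x): f_c(x)\le 0\}$. A point $x$ is an $\epsilon$-optimal solution of $\min\{g: f\le c\}$ if $g(x)-\bar g(c)\le\epsilon$ and $[f_c(x)]_+\le\epsilon$. Given $\epsilon>0$, let $x^0$ satisfy $f(x^0)\le f^*+\epsilon$ and $f_c(x^0)<-\Delta_1$, where $\Delta_1>0$ does not depend on $\epsilon$; let $\tilde x_g$ satisfy $g(\tilde x_g)\le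 g^*+\epsilon$ with $u_0=f(\tilde x_g)<\infty$ and $c\le u_0$. Let $\gamma_1>1$, $\gamma_2\ge1$, $L_{\min}>0$ and put $$D_z=\frac{g(x^0)-g(\tilde x_g)+1}{\Delta_1},\quad L=L_{g_1}+2D_zL_{f_1}+1,\quad D_0=g(x^0)+\max\{0,-2D_zf^*\}+2D_z|u_0|.$$ Let $R_1$ be the diameter of $\{g\le D_0\}$, $D_{\mathcal L}=D_0+\gamma_1LR_1^2$, $D_g$ the diameter of $\{g\le D_{\mathcal L}\}$ (both level sets are assumed bounded), $B_f=\max_{g(x)\le D_{\mathcal L}}\|\nabla f_1(x)\|+l_{f_2}$, and $$D=(1+D_g(1+D_g))\max\{B_f,\;2D_zB_f+2D_zB_f^2\}.$$ Use the tolerances $\epsilon_1=\epsilon_4=\epsilon^2/D$, $\epsilon_2=B_f\epsilon/D$, $\epsilon_3=(2D_zB_f+2D_zB_f^2)\epsilon/D$. **Algorithms.** For $z\ge 0$, $\mathrm{APG}(z,y)$ is the following accelerated proximal gradient method, applied to $\varphi=\varphi_1+\varphi_2$ with $\varphi_1=g_1+\frac\epsilon2\|\cdot-x^0\|^2+zf_1$,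 $\varphi_2=g_2+zf_2$ ($\varphi_2=g_2$ if $z=0$), and $\mu=\epsilon$. A *backtracking step* from a base point $y$ with initial constant $\ell$ tries $\ell,\gamma_1\ell,\gamma_1^2\ell,\dots$ as the constant $\ell'$, and takes the first one for which $x=\mathrm{prox}_{\varphi_2/\ell'}(y-\frac1{\ell'}\nabla\varphi_1(y))$ satisfies $\varphi_1(x)\le\varphi_1(y)+\langle\nabla\varphi_1(y),x-y\rangle+\frac{\ell'}2\|x-y\|^2$. A backtracking step from the starting point $y$ with initial constant $L_{\min}$ gives $x_0$ and a constant $\tilde L$; put $x_{-1}=x_0$, $L_0=\max\{L_{\min},\tilde L/\gamma_2\}$, $\alpha_{-1}=1$. For $k=0,1,\dots$: backtrack with initial constant $L_k$, where the base point for the trial constant $\ell'$ is $x_k+\frac{\alpha_k(1-\alpha_{k-1})}{\alpha_{k-1}(1+\alpha_k)}(x_k-x_{k-1})$ with $\alpha_k=\sqrt{\mu/\ell'}$, to get $x_{k+1}$ and the accepted constant $\tilde L$ (which fixes $\alpha_k$); backtrack from $x_{k+1}$ with initial constant $\tilde L$ to get $\hat x$; return $\hat x$ if $\mathrm{dist}(0,\partial\varphi(\hat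 x))\le\epsilon_1$, and otherwise continue with $L_{k+1}=\max\{L_{\min},\tilde L/\gamma_2\}$. *Interval search* (Algorithm 3) with $\sigma\in(0,2D_z]$: compute $\hat x$ by $\mathrm{APG}$ with $z=0$; if $[f_c(\hat x)]_+\le\epsilon_2$, return $Z=\{0\}$. Otherwise set $a=0$, $b=\sigma$ and compute $\hat x$ with $z=b$; while $[f_c(\hat x)]_+>\epsilon_2$ and $b\le D_z$, replace $(a,b)$ by $(b,2b)$ and compute $\hat x$ with $z=b$. Return $Z=\{b\}$ if $|bf_c(\hat x)|\le\epsilon_3$, and $Z=[a,b]$ otherwise. Every call of APG after the first starts from the last $\hat x$. *Bisection* (Algorithm 4), started with the interval $[a,b]=Z$ and the point $\hat x_b$ that the interval search computed for $b$: while $b-a>\epsilon_4$, let $e=\frac{a+b}2$ and compute $\hat x$ by $\mathrm{APG}$ with $z=e$, started from the last $\hat x$; if $[f_c(\hat x)]_+>\epsilon_2$ set $a=e$; else if $|ef_c(\hat x)|\le\epsilon_3$ return $(\hat x,e)$; else set $b=e$, $\hat x_b=\hat x$. At the end of the loop return $(\hat x_b,b)$. One evaluation of $\varphi_1$, $\varphi_2$,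 $\nabla\varphi_1$ or of a proximal mapping of $\varphi_2$ is one oracle query. **Statement.** For all $\gamma_1>1,\gamma_2\ge1$ and $\rho$ there is a constant $C$ such that for every problem as above, every $L_{\min}>0$, $c$, $\Delta_1>0$ and $\Gamma\in\mathbb R$ there is $\bar\epsilon>0$ with the following property. Let $0<\epsilon\le\bar\epsilon$, let $x^0,\tilde x_g$ be as above with $g(x^0)\le\Gamma$, and suppose that $L\le\rho L_{\min}$ and $L_{\min}\le\rho L$. Let the interval search and the bisection have arbitrary starting points in $\{g\le D_{\mathcal L}\}$. Then the interval search terminates, and Algorithm 4, applied to its output, terminates and returns an $\epsilon$-optimal solution of $\min\{g:f\le c\}$ after at most $$C\sqrt{\frac{L_{g_1}+2D_zL_{f_1}+1}{\epsilon}}\;|\log\epsilon|^2$$ oracle queries. -/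

import Mathlib

open scoped NNReal ENNReal

noncomputable section

namespace SimpleBilevel

/-- The space `ℝⁿ` with the Euclidean norm. -/
abbrev Sp (n : ℕ) : Type := EuclideanSpace ℝ (Fin n)

variable {n : ℕ}

/-! ### Extended-real-valued convex functions -/

/-- Effective domain of an extended-real-valued function. -/
def edom (ψ : Sp n → EReal) : Set (Sp n) := {x | ψ x ≠ ⊤}

/-- Level set `Lev_ψ(r) = {x : ψ x ≤ r}`. -/
def lev (ψ : Sp n → EReal) (r : ℝ) : Set (Sp n) := {x | ψ x ≤ (r : EReal)}

/-- `ψ : ℝⁿ → ℝ ∪ {∞}` is proper, convex (convex epigraph) and lower semicontinuous. -/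
structure ProperConvexLsc (ψ : Sp n → EReal) : Prop where
  ne_bot : ∀ x, ψ x ≠ ⊥
  nonempty_dom : (edom ψ).Nonempty
  convex : Convex ℝ {p : Sp n × ℝ | ψ p.1 ≤ (p.2 : EReal)}
  lsc : LowerSemicontinuous ψ

/-- The convex subdifferential of `ψ` at `x`. -/
def subdiff (ψ : Sp n → EReal) (x : Sp n) : Set (Sp n) :=
  {v | ∀ y, ψ x + ((inner ℝ v (y - x) : ℝ) : EReal) ≤ ψ y}

/-- `p = prox_{tψ}(y)`, i.e. `p` minimizes `ψ + ‖· - y‖² / (2t)`. -/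
def IsProx (ψ : Sp n → EReal) (t : ℝ) (y p : Sp n) : Prop :=
  ∀ u, ψ p + ((‖p - y‖ ^ 2 / (2 * t) : ℝ) : EReal) ≤ ψ u + ((‖u - y‖ ^ 2 / (2 * t) : ℝ) : EReal)

/-! ### The accelerated proximal gradient method -/

/-- Acceptance test of a backtracking step from `y` to `x` with constant `L`. -/
def Descent (φ₁ : Sp n → ℝ) (y x : Sp n) (L : ℝ) : Prop :=
  φ₁ x ≤ φ₁ y + inner ℝ (gradient φ₁ y) (x - y) + L / 2 * ‖x - y‖ ^ 2

/-- Backtracking. The trial constants are `L, γL, γ²L, …`; the trial with constant `L` makes a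
proximal gradient step from the base point `y L` (which may depend on the trial constant).
`Backtrack φ₁ φ₂ γ y L L' x m`: starting with the constant `L`, the first accepted trial is the
`m`-th one; its constant is `L'` and its point is `x`. -/
inductive Backtrack (φ₁ : Sp n → ℝ) (φ₂ : Sp n → EReal) (γ : ℝ) (y : ℝ → Sp n) :
    ℝ → ℝ → Sp n → ℕ → Prop
  | accept {L : ℝ} {x : Sp n}
      (hx : IsProx φ₂ (1 / L) (y L - (1 / L) • gradient φ₁ (y L)) x)
      (hd : Descent φ₁ (y L) x L) :
      Backtrack φ₁ φ₂ γ y L L x 1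
  | reject {L L' : ℝ} {x x' : Sp n} {m : ℕ}
      (hx : IsProx φ₂ (1 / L) (y L - (1 / L) • gradient φ₁ (y L)) x)
      (hd : ¬ Descent φ₁ (y L) x L)
      (hrec : Backtrack φ₁ φ₂ γ y (γ * L) L' x' m) :
      Backtrack φ₁ φ₂ γ y L L' x' (m + 1)

/-- The extrapolated point for the trial constant `L`, with `α = √(μ / L)`, from the current
iterate `x`, the previous iterate `xp` and the previous momentum parameter `αp`. -/
def extrapolate (μ : ℝ) (x xp : Sp n) (αp L : ℝ) : Sp n :=
  x + ((√(μ / L) * (1 - αp)) / (αp * (1 + √(μ / L)))) • (x - xp)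

/-- Stopping test `dist(0, ∂(φ₁ + φ₂)(x)) ≤ tol`. The distance to the empty set is `∞`. -/
def NearStationary (φ₁ : Sp n → ℝ) (φ₂ : Sp n → EReal) (tol : ℝ) (x : Sp n) : Prop :=
  Metric.infEDist 0 (subdiff (fun u => (φ₁ u : EReal) + φ₂ u) x) ≤ ENNReal.ofReal tol

/-- The main loop of the method. The state `(x, xp, L, αp)` consists of the current and the
previous iterate, the first trial constant `L_k` and the previous momentum parameter.
`APGLoop φ₁ φ₂ γ₁ γ₂ Lmin μ tol x xp L αp out N`: the loop started in this state halts and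
returns `out` after `N` oracle queries.

Each single evaluation of `φ₁`, `φ₂`, `∇φ₁`, `prox φ₂` is one query: a backtracking trial from `y`
to `x` costs four (`∇φ₁ y`, the proximal point `x`, `φ₁ y`, `φ₁ x`), and a stopping test one more
(`∇φ₁` at the tested point). -/
inductive APGLoop (φ₁ : Sp n → ℝ) (φ₂ : Sp n → EReal) (γ₁ γ₂ Lmin μ tol : ℝ) :
    Sp n → Sp n → ℝ → ℝ → Sp n → ℕ → Prop
  | halt {x xp xt xh : Sp n} {L αp Lt Lh : ℝ} {m m' : ℕ}
      (h₁ : Backtrack φ₁ φ₂ γ₁ (extrapolate μ x xp αp) L Lt xt m)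
      (h₂ : Backtrack φ₁ φ₂ γ₁ (fun _ => xt) Lt Lh xh m')
      (ht : NearStationary φ₁ φ₂ tol xh) :
      APGLoop φ₁ φ₂ γ₁ γ₂ Lmin μ tol x xp L αp xh (4 * m + 4 * m' + 1)
  | next {x xp xt xh out : Sp n} {L αp Lt Lh : ℝ} {m m' N : ℕ}
      (h₁ : Backtrack φ₁ φ₂ γ₁ (extrapolate μ x xp αp) L Lt xt m)
      (h₂ : Backtrack φ₁ φ₂ γ₁ (fun _ => xt) Lt Lh xh m')
      (ht : ¬ NearStationary φ₁ φ₂ tol xh)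
      (hrec : APGLoop φ₁ φ₂ γ₁ γ₂ Lmin μ tol xt x (max Lmin (Lt / γ₂)) (√(μ / Lt)) out N) :
      APGLoop φ₁ φ₂ γ₁ γ₂ Lmin μ tol x xp L αp out (4 * m + 4 * m' + 1 + N)

/-- `out = APG_μ(φ₁, φ₂, Lmin, μ, γ₁, γ₂, y₀, tol)`, computed with `N` oracle queries. -/
def APG (φ₁ : Sp n → ℝ) (φ₂ : Sp n → EReal) (Lmin μ γ₁ γ₂ : ℝ) (y₀ : Sp n) (tol : ℝ)
    (out : Sp n) (N : ℕ) : Prop :=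
  ∃ (L : ℝ) (x₀ : Sp n) (m M : ℕ),
    Backtrack φ₁ φ₂ γ₁ (fun _ => y₀) Lmin L x₀ m ∧
    APGLoop φ₁ φ₂ γ₁ γ₂ Lmin μ tol x₀ x₀ (max Lmin (L / γ₂)) 1 out M ∧
    N = 4 * m + M

/-! ### The simple bilevel problem `min f₁ + f₂` over `argmin (g₁ + g₂)` -/

/-- The functions and Lipschitz constants of the problem. -/
structure Problem (n : ℕ) where
  f₁ : Sp n → ℝ
  f₂ : Sp n → EReal
  g₁ : Sp n → ℝ
  g₂ : Sp n → EReal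
  Lf₁ : ℝ≥0
  Lg₁ : ℝ≥0
  lf₂ : ℝ≥0

namespace Problem

variable (P : Problem n)

/-- The upper-level objective. -/
def f (x : Sp n) : EReal := (P.f₁ x : EReal) + P.f₂ x

/-- The lower-level objective. -/
def g (x : Sp n) : EReal := (P.g₁ x : EReal) + P.g₂ x

/-- `X = dom f ∩ dom g`. -/
def X : Set (Sp n) := edom P.f ∩ edom P.g

/-- `f^* = inf_X f`. -/
def fStar : EReal := ⨅ x ∈ P.X, P.f x

/-- `g^* = inf_X g`. -/
def gStar : EReal := ⨅ x ∈ P.X, P.g x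

/-- The solution set of the lower-level problem. -/
def solG : Set (Sp n) := {x | ∀ y, P.g x ≤ P.g y}

/-- The optimal value `p^*` of the bilevel problem. -/
def pStar : EReal := ⨅ x ∈ P.solG, P.f x

/-- `f_c = f - c`. -/
def fc (c : ℝ) (x : Sp n) : EReal := P.f x - (c : EReal)

/-- The value function `ḡ(c) = inf {g x : f_c x ≤ 0}`. -/
def gBar (c : ℝ) : EReal := ⨅ x ∈ {x | P.fc c x ≤ 0}, P.g x

/-- `x` is an `ε`-optimal solution of `min g` subject to `f_c ≤ 0`. -/
def IsEpsOptimal (c ε : ℝ) (x : Sp n) : Prop :=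
  P.g x - P.gBar c ≤ (ε : EReal) ∧ max (P.fc c x) 0 ≤ (ε : EReal)

/-- The basic assumptions on the functions. That the proximal mappings of `g₂ + z f₂` can be
computed is part of the oracle model and not a hypothesis. -/
structure Basic : Prop where
  f₁_convex : ConvexOn ℝ Set.univ P.f₁
  f₁_contDiff : ContDiff ℝ 1 P.f₁
  f₁_lip : LipschitzWith P.Lf₁ (gradient P.f₁)
  g₁_convex : ConvexOn ℝ Set.univ P.g₁
  g₁_contDiff : ContDiff ℝ 1 P.g₁
  g₁_lip : LipschitzWith P.Lg₁ (gradient P.g₁)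
  f₂_pcl : ProperConvexLsc P.f₂
  g₂_pcl : ProperConvexLsc P.g₂
  f₂_lip : LipschitzOnWith P.lf₂ (fun x => (P.f₂ x).toReal) (edom P.f₂)
  fStar_ne_bot : P.fStar ≠ ⊥
  gStar_ne_bot : P.gStar ≠ ⊥
  gap : ∃ Δ : ℝ, 0 < Δ ∧ P.fStar + (Δ : EReal) ≤ P.pStar
  solG_nontrivial : P.solG.Nontrivial

end Problem

/-- All data on which the algorithms run: the problem, the parameters `γ₁, γ₂, Lmin` of the
accelerated proximal gradient method, the level `c` and the constant `Δ₁` of the regularity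
condition, the accuracy `ε`, the prox-center `x⁰` (an approximate minimizer of `f`) and an
approximate minimizer `x̃_g` of `g`. -/
structure Setup (n : ℕ) where
  P : Problem n
  γ₁ : ℝ
  γ₂ : ℝ
  Lmin : ℝ
  c : ℝ
  Δ₁ : ℝ
  ε : ℝ
  x0 : Sp n
  xg : Sp n

namespace Setup

variable (S : Setup n)

/-- `D_z = (g(x⁰) - g(x̃_g) + 1) / Δ₁`. -/
def Dz : ℝ := ((S.P.g S.x0).toReal - (S.P.g S.xg).toReal + 1) / S.Δ₁

/-- `L_{φ₁} = L_{g₁} + 2 D_z L_{f₁} + 1`. -/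
def Lphi : ℝ := S.P.Lg₁ + 2 * S.Dz * S.P.Lf₁ + 1

/-- `u₀ = f(x̃_g)`. -/
def u₀ : ℝ := (S.P.f S.xg).toReal

/-- `D₀ = g(x⁰) + max {0, -2 D_z f^*} + 2 D_z |u₀|`. -/
def D₀ : ℝ := (S.P.g S.x0).toReal + max 0 (-2 * S.Dz * S.P.fStar.toReal) + 2 * S.Dz * |S.u₀|

/-- `R₁`, the diameter of `Lev_g(D₀)`. -/
def R₁ : ℝ := Metric.diam (lev S.P.g S.D₀)

/-- `D_{L_z} = D₀ + γ₁ L_{φ₁} R₁²`. -/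
def DL : ℝ := S.D₀ + S.γ₁ * S.Lphi * S.R₁ ^ 2

/-- `D_g`, the diameter of `Lev_g(D_{L_z})`. -/
def Dg : ℝ := Metric.diam (lev S.P.g S.DL)

/-- `B_f = max {‖∇f₁ x‖ : x ∈ Lev_g(D_{L_z})} + l_{f₂}`. -/
def Bf : ℝ := sSup ((fun x => ‖gradient S.P.f₁ x‖) '' lev S.P.g S.DL) + S.P.lf₂

/-- `D = (1 + D_g (1 + D_g)) max {B_f, 2 D_z B_f + 2 D_z B_f²}`. -/
def D : ℝ := (1 + S.Dg * (1 + S.Dg)) * max S.Bf (2 * S.Dz * S.Bf + 2 * S.Dz * S.Bf ^ 2)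

/-- The tolerance `ε₁ = ε² / D`. -/
def ε₁ : ℝ := S.ε ^ 2 / S.D

/-- The tolerance `ε₂ = B_f ε / D`. -/
def ε₂ : ℝ := S.Bf * S.ε / S.D

/-- The tolerance `ε₃ = (2 D_z B_f + 2 D_z B_f²) ε / D`. -/
def ε₃ : ℝ := (2 * S.Dz * S.Bf + 2 * S.Dz * S.Bf ^ 2) * S.ε / S.D

/-- The tolerance `ε₄ = ε² / D`. -/
def ε₄ : ℝ := S.ε ^ 2 / S.D

/-- The standing conditions on `x⁰, x̃_g, c, Δ₁`: `x⁰` lies in the level set `{g ≤ Γ}` and is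
`ε`-optimal for `f`; `x̃_g` is `ε`-optimal for `g`, and `f(x̃_g)` is finite; the regularity
condition `f_c(x⁰) < -Δ₁`; `c ≤ u₀`; and the two level sets of `g` are bounded. -/
structure Admissible (Γ : ℝ) : Prop where
  x0_lev : S.P.g S.x0 ≤ (Γ : EReal)
  x0_opt : S.P.f S.x0 ≤ S.P.fStar + (S.ε : EReal)
  xg_dom : S.P.f S.xg ≠ ⊤
  xg_opt : S.P.g S.xg ≤ S.P.gStar + (S.ε : EReal)
  regular : S.P.fc S.c S.x0 < ((-S.Δ₁ : ℝ) : EReal)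
  c_le : S.c ≤ S.u₀
  bdd₀ : Bornology.IsBounded (lev S.P.g S.D₀)
  bdd : Bornology.IsBounded (lev S.P.g S.DL)

/-- `out` is the result of the accelerated proximal gradient method, with accuracy `ε₁`, for
`φ₁ = g_ε + z f₁` and `φ₂ = g₂ + z f₂` started at `y₀`, where
`g_ε = g₁ + (ε / 2) ‖· - x⁰‖²` and `μ = ε`; it takes `N` oracle queries. (`0 * ⊤ = 0`, so
`φ₂ = g₂` for `z = 0`.) -/
def Call (z : ℝ) (y₀ out : Sp n) (N : ℕ) : Prop :=
  APG (fun x => S.P.g₁ x + S.ε / 2 * ‖x - S.x0‖ ^ 2 + z * S.P.f₁ x)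
    (fun x => S.P.g₂ x + (z : EReal) * S.P.f₂ x)
    S.Lmin S.ε S.γ₁ S.γ₂ y₀ S.ε₁ out N

/-- The test `[f_c(x)]₊ ≤ ε₂`. -/
def NearFeasible (x : Sp n) : Prop := max (S.P.fc S.c x) 0 ≤ (S.ε₂ : EReal)

/-- The test `|z f_c(x)| ≤ ε₃`. -/
def NearCompl (z : ℝ) (x : Sp n) : Prop :=
  ((-S.ε₃ : ℝ) : EReal) ≤ (z : EReal) * S.P.fc S.c x ∧
    (z : EReal) * S.P.fc S.c x ≤ (S.ε₃ : EReal)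

/-- The doubling loop of the interval search. `IntVLoop a b x a' b' x'`: from the interval
`[a, b]` and the point `x` computed for the multiplier `b`, the loop ends with `[a', b']`, `x'`. -/
inductive IntVLoop : ℝ → ℝ → Sp n → ℝ → ℝ → Sp n → Prop
  | exit {a b : ℝ} {x : Sp n} (h : ¬ (¬ S.NearFeasible x ∧ b ≤ S.Dz)) : IntVLoop a b x a b x
  | double {a b a' b' : ℝ} {x y x' : Sp n} {N : ℕ}
      (h : ¬ S.NearFeasible x ∧ b ≤ S.Dz)
      (hy : S.Call (2 * b) x y N)
      (hrec : IntVLoop b (2 * b) y a' b' x') : IntVLoop a b x a' b' x'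

/-- Interval search `IntV([0, σ], ε₁, ε₂, ε₃, y₀)`. `IntV σ y₀ a b xb`: it returns `Z = [a, b]`
(`Z = {b}` if `a = b`), and `xb` is the point that it has computed for the multiplier `b`. -/
inductive IntV (σ : ℝ) (y₀ : Sp n) : ℝ → ℝ → Sp n → Prop
  | zero {x : Sp n} {N : ℕ} (hx : S.Call 0 y₀ x N) (h : S.NearFeasible x) :
      IntV σ y₀ 0 0 x
  | point {x y xb : Sp n} {N M : ℕ} {a b : ℝ} (hx : S.Call 0 y₀ x N) (h : ¬ S.NearFeasible x)
      (hy : S.Call σ x y M) (hl : S.IntVLoop 0 σ y a b xb) (hc : S.NearCompl b xb) :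
      IntV σ y₀ b b xb
  | interval {x y xb : Sp n} {N M : ℕ} {a b : ℝ} (hx : S.Call 0 y₀ x N) (h : ¬ S.NearFeasible x)
      (hy : S.Call σ x y M) (hl : S.IntVLoop 0 σ y a b xb) (hc : ¬ S.NearCompl b xb) :
      IntV σ y₀ a b xb

/-- The bisection method for the dual problem. The state consists of the interval `[a, b]`, the
point `xb` computed for the multiplier `b`, and the latest point `x` (the next starting point).
`Bisec a b xb x out z N`: the loop started in this state returns `(out, z)` after `N` oracle
queries. Besides the queries of the inner method, every pass is charged two queries for the
evaluation of `f₁` and `f₂` in `f_c`. -/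
inductive Bisec : ℝ → ℝ → Sp n → Sp n → Sp n → ℝ → ℕ → Prop
  | done {a b : ℝ} {xb x : Sp n} (h : ¬ S.ε₄ < b - a) : Bisec a b xb x xb b 0
  | raise {a b z : ℝ} {xb x y out : Sp n} {M N : ℕ} (h : S.ε₄ < b - a)
      (hy : S.Call ((a + b) / 2) x y M) (hf : ¬ S.NearFeasible y)
      (hrec : Bisec ((a + b) / 2) b xb y out z N) :
      Bisec a b xb x out z (M + 2 + N)
  | hit {a b : ℝ} {xb x y : Sp n} {M : ℕ} (h : S.ε₄ < b - a)
      (hy : S.Call ((a + b) / 2) x y M) (hf : S.NearFeasible y)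
      (hc : S.NearCompl ((a + b) / 2) y) :
      Bisec a b xb x y ((a + b) / 2) (M + 2)
  | lower {a b z : ℝ} {xb x y out : Sp n} {M N : ℕ} (h : S.ε₄ < b - a)
      (hy : S.Call ((a + b) / 2) x y M) (hf : S.NearFeasible y)
      (hc : ¬ S.NearCompl ((a + b) / 2) y)
      (hrec : Bisec a ((a + b) / 2) y y out z N) :
      Bisec a b xb x out z (M + 2 + N)

end Setup

end SimpleBilevel

end

open SimpleBilevel

/-!
Consider a near minimizer `x` of the strongly convex regularized Lagrangian
`g + (ε / 2) ‖· - x⁰‖² + z f` that is nearly feasible and has complementarity error `τ`. A first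
comparison gives `g x ≤ ḡ(c) + O(ε)`. By compactness `x` therefore lies close to a solution of
`min {g : f ≤ c}`, and comparison with that solution, for which the prox terms nearly cancel, gives
`g x ≤ ḡ(c) + τ + o(ε)`. The tolerances keep `τ` below `ε` by a fixed factor.

For `z > D_z` near minimizers are nearly feasible, because `x⁰` is strictly feasible; hence the
interval search halts. Throughout the bisection the point of the right end is nearly feasible and
that of the left end is not. Once the interval is shorter than `ε₄`, strong convexity makes the two
points so close that the complementarity error of the right one is at most `ε₃`.

Each pass of the accelerated method contracts the gap to an estimate function by `1 - √(ε / L)`, so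
`O(√(L / ε) |log ε|)` passes make the subgradient small enough. The bisection halves its interval
and thus makes `O(|log ε|)` calls of the method.
-/

noncomputable section

namespace SimpleBilevel

open scoped Topology

variable {n : ℕ}

/-! ### Proper convex lower semicontinuous functions -/

lemma nonneg_of_forall_add_mul_nonneg {s B : ℝ} (h : ∀ t : ℝ, 0 < t → t ≤ 1 → 0 ≤ s + t * B) :
    0 ≤ s := by
  have hlim : Filter.Tendsto (fun t : ℝ => s + t * B) (𝓝[>] 0) (𝓝 s) := by
    have hcont : Continuous fun t : ℝ => s + t * B := by fun_prop
    simpa using (hcont.tendsto 0).mono_left nhdsWithin_le_nhds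
  refine ge_of_tendsto hlim ?_
  filter_upwards [Ioc_mem_nhdsGT one_pos] with t ht
  exact h t ht.1 ht.2

section Minimum

variable {E : Type*} [NormedAddCommGroup E]

lemma exists_forall_le_of_le_off_closedBall [ProperSpace E] {F : E → EReal}
    (hF : LowerSemicontinuous F) {w : E} {R : ℝ} (hR : 0 ≤ R)
    (hout : ∀ u, R < ‖u - w‖ → F w ≤ F u) : ∃ p, ∀ u, F p ≤ F u := by
  have hw : w ∈ Metric.closedBall w R := Metric.mem_closedBall_self hR
  obtain ⟨p, -, hp⟩ := LowerSemicontinuousOn.exists_isMinOn ⟨w, hw⟩ (isCompact_closedBall w R)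
    (hF.lowerSemicontinuousOn _)
  refine ⟨p, fun u => ?_⟩
  by_cases hu : u ∈ Metric.closedBall w R
  · exact hp hu
  · rw [mem_closedBall_iff_norm, not_le] at hu
    exact (hp hw).trans (hout u hu)

variable [InnerProductSpace ℝ E]

/-- First order condition for the minimum of a convex function plus a function with a quadratic
upper bound: only the linear term of the bound survives on short segments. -/
lemma sub_inner_le_of_isMinOn_add {s : Set E} {F q : E → ℝ} (hF : ConvexOn ℝ s F) {x a : E} {K : ℝ}
    (hx : x ∈ s) (hmin : IsMinOn (fun u => F u + q u) s x)
    (hq : ∀ u, q u ≤ q x + inner ℝ a (u - x) + K * ‖u - x‖ ^ 2) {u : E} (hu : u ∈ s) :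
    F x - inner ℝ a (u - x) ≤ F u := by
  suffices 0 ≤ F u - F x + inner ℝ a (u - x) by linarith
  refine nonneg_of_forall_add_mul_nonneg (B := K * ‖u - x‖ ^ 2) fun t ht ht1 => ?_
  have hseg : (1 - t) • x + t • u = x + t • (u - x) := by module
  have hmem := hF.1 hx hu (sub_nonneg.2 ht1) ht.le (sub_add_cancel 1 t)
  have hconv := hF.2 hx hu (sub_nonneg.2 ht1) ht.le (sub_add_cancel 1 t)
  rw [hseg] at hmem hconv
  have hle : F x + q x ≤ F (x + t • (u - x)) + q (x + t • (u - x)) := hmin hmem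
  have hquad := hq (x + t • (u - x))
  rw [add_sub_cancel_left, real_inner_smul_right, norm_smul, mul_pow, Real.norm_eq_abs,
    sq_abs] at hquad
  simp only [smul_eq_mul] at hconv
  refine nonneg_of_mul_nonneg_right (?_ : 0 ≤ t * _) ht
  linarith

end Minimum

lemma mem_edom_of_le {ψ : Sp n → EReal} {x : Sp n} {r : ℝ} (h : ψ x ≤ (r : EReal)) : x ∈ edom ψ :=
  ne_top_of_le_ne_top (EReal.coe_ne_top r) h

lemma lev_mono (ψ : Sp n → EReal) {r r' : ℝ} (h : r ≤ r') : lev ψ r ⊆ lev ψ r' :=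
  fun _ hx => le_trans (show ψ _ ≤ (r : EReal) from hx) (by exact_mod_cast h)

namespace ProperConvexLsc

variable {ψ ψ' : Sp n → EReal}

lemma coe_toReal (hψ : ProperConvexLsc ψ) {x : Sp n} (hx : x ∈ edom ψ) :
    (((ψ x).toReal : ℝ) : EReal) = ψ x :=
  EReal.coe_toReal hx (hψ.ne_bot x)

lemma toReal_le (hψ : ProperConvexLsc ψ) {x : Sp n} {r : ℝ} (h : ψ x ≤ (r : EReal)) :
    (ψ x).toReal ≤ r := by
  rw [← hψ.coe_toReal (mem_edom_of_le h)] at h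
  exact_mod_cast h

lemma le_of_toReal_le (hψ : ProperConvexLsc ψ) {x : Sp n} {r : ℝ} (hx : x ∈ edom ψ)
    (h : (ψ x).toReal ≤ r) : ψ x ≤ (r : EReal) := by
  rw [← hψ.coe_toReal hx]
  exact_mod_cast h

lemma toReal_le_toReal (hψ : ProperConvexLsc ψ) {x y : Sp n} (hy : y ∈ edom ψ) (h : ψ x ≤ ψ y) :
    (ψ x).toReal ≤ (ψ y).toReal :=
  EReal.toReal_le_toReal h (hψ.ne_bot x) hy

lemma convexOn_toReal (hψ : ProperConvexLsc ψ) : ConvexOn ℝ (edom ψ) fun x => (ψ x).toReal := by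
  have hepi : ∀ ⦃x⦄, x ∈ edom ψ → ∀ ⦃y⦄, y ∈ edom ψ → ∀ ⦃a b : ℝ⦄, 0 ≤ a → 0 ≤ b → a + b = 1 →
      ψ (a • x + b • y) ≤ ((a * (ψ x).toReal + b * (ψ y).toReal : ℝ) : EReal) :=
    fun x hx y hy a b ha hb hab => hψ.convex (x := (x, (ψ x).toReal)) (y := (y, (ψ y).toReal))
      (hψ.coe_toReal hx).ge (hψ.coe_toReal hy).ge ha hb hab
  exact ⟨fun x hx y hy a b ha hb hab => mem_edom_of_le (hepi hx hy ha hb hab),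
    fun x hx y hy a b ha hb hab => hψ.toReal_le (hepi hx hy ha hb hab)⟩

lemma of_convexOn_toReal (hbot : ∀ x, ψ x ≠ ⊥) (hne : (edom ψ).Nonempty)
    (hconv : ConvexOn ℝ (edom ψ) fun x => (ψ x).toReal) (hlsc : LowerSemicontinuous ψ) :
    ProperConvexLsc ψ := by
  refine ⟨hbot, hne, ?_, hlsc⟩
  have hepi : {p : Sp n × ℝ | ψ p.1 ≤ (p.2 : EReal)} =
      {p : Sp n × ℝ | p.1 ∈ edom ψ ∧ (ψ p.1).toReal ≤ p.2} := by
    ext ⟨x, r⟩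
    refine ⟨fun h => ⟨mem_edom_of_le h, ?_⟩, fun h => ?_⟩
    · exact EReal.toReal_le_toReal h (hbot x) (EReal.coe_ne_top r)
    · exact (EReal.le_coe_toReal h.1).trans (EReal.coe_le_coe_iff.2 h.2)
  rw [hepi]
  exact hconv.convex_epigraph

lemma coe_real {φ : Sp n → ℝ} (hconv : ConvexOn ℝ Set.univ φ) (hcont : Continuous φ) :
    ProperConvexLsc fun x => (φ x : EReal) := by
  have hdom : edom (fun x => (φ x : EReal)) = Set.univ :=
    Set.eq_univ_of_forall fun x => EReal.coe_ne_top _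
  exact of_convexOn_toReal (fun x => EReal.coe_ne_bot _) (hdom ▸ Set.univ_nonempty)
    (by simpa only [hdom, EReal.toReal_coe] using hconv)
    (continuous_coe_real_ereal.comp hcont).lowerSemicontinuous

lemma edom_add (hψ : ProperConvexLsc ψ) (hψ' : ProperConvexLsc ψ') :
    edom (fun x => ψ x + ψ' x) = edom ψ ∩ edom ψ' := by
  ext x
  exact EReal.add_ne_top_iff_ne_top₂ (hψ.ne_bot x) (hψ'.ne_bot x)

lemma add (hψ : ProperConvexLsc ψ) (hψ' : ProperConvexLsc ψ')
    (hne : (edom ψ ∩ edom ψ').Nonempty) : ProperConvexLsc fun x => ψ x + ψ' x := by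
  have hdom := hψ.edom_add hψ'
  have hconv : ConvexOn ℝ (edom ψ ∩ edom ψ') fun x => (ψ x).toReal + (ψ' x).toReal := by
    have hcvx : Convex ℝ (edom ψ ∩ edom ψ') := hψ.convexOn_toReal.1.inter hψ'.convexOn_toReal.1
    exact (hψ.convexOn_toReal.subset Set.inter_subset_left hcvx).add
      (hψ'.convexOn_toReal.subset Set.inter_subset_right hcvx)
  refine of_convexOn_toReal (fun x => EReal.add_ne_bot_iff.2 ⟨hψ.ne_bot x, hψ'.ne_bot x⟩)
    (hdom ▸ hne) ?_ ?_
  · rw [hdom]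
    exact hconv.congr fun x hx =>
      (EReal.toReal_add hx.1 (hψ.ne_bot x) hx.2 (hψ'.ne_bot x)).symm
  · exact hψ.lsc.add' hψ'.lsc fun x =>
      EReal.continuousAt_add (.inr (hψ'.ne_bot x)) (.inl (hψ.ne_bot x))

lemma edom_coe_mul (hψ : ProperConvexLsc ψ) {z : ℝ} (hz : 0 < z) :
    edom (fun x => (z : EReal) * ψ x) = edom ψ := by
  ext x
  refine not_congr ⟨fun h => ?_, fun h => by simp only [h, EReal.coe_mul_top_of_pos hz]⟩
  by_contra hx
  simp only at h
  rw [← EReal.coe_toReal hx (hψ.ne_bot x), ← EReal.coe_mul] at h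
  exact EReal.coe_ne_top _ h

lemma coe_mul (hψ : ProperConvexLsc ψ) {z : ℝ} (hz : 0 < z) :
    ProperConvexLsc fun x => (z : EReal) * ψ x := by
  have hdom := hψ.edom_coe_mul hz
  refine of_convexOn_toReal (fun x => ?_) (hdom ▸ hψ.nonempty_dom) ?_ ?_
  · have := hψ.ne_bot x
    rw [EReal.mul_ne_bot]
    simp [this, hz.le]
  · simpa only [hdom, EReal.toReal_mul, EReal.toReal_coe, smul_eq_mul] using
      hψ.convexOn_toReal.smul hz.le
  · have hcont : Continuous fun r : EReal => (z : EReal) * r :=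
      continuous_iff_continuousAt.2 fun r => EReal.Tendsto.const_mul Filter.tendsto_id
        (.inl (EReal.coe_ne_bot z)) (.inl (EReal.coe_ne_top z))
    exact hcont.comp_lowerSemicontinuous hψ.lsc fun a b hab =>
      mul_le_mul_of_nonneg_left hab (by exact_mod_cast hz.le)

lemma exists_minorant (hψ : ProperConvexLsc ψ) :
    ∃ w ∈ edom ψ, ∃ b : ℝ, 0 ≤ b ∧
      ∀ u ∈ edom ψ, (ψ w).toReal - b - b * ‖u - w‖ ≤ (ψ u).toReal := by
  obtain ⟨w, hw⟩ := hψ.nonempty_dom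
  have hwB : w ∈ Metric.closedBall w 1 := Metric.mem_closedBall_self zero_le_one
  obtain ⟨p, -, hp⟩ := LowerSemicontinuousOn.exists_isMinOn ⟨w, hwB⟩ (isCompact_closedBall w 1)
    (hψ.lsc.lowerSemicontinuousOn _)
  have hball : ∀ u ∈ edom ψ, ‖u - w‖ ≤ 1 → (ψ p).toReal ≤ (ψ u).toReal := fun u hu hr =>
    hψ.toReal_le_toReal hu (hp (mem_closedBall_iff_norm.2 hr))
  have hpw := hball w hw (by simp)
  refine ⟨w, hw, (ψ w).toReal - (ψ p).toReal, by linarith, fun u hu => ?_⟩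
  rcases le_or_gt ‖u - w‖ 1 with hr | hr
  · nlinarith [hball u hu hr, norm_nonneg (u - w)]
  -- a far point is compared with the point of the segment `[w, u]` at distance `1` from `w`
  set r := ‖u - w‖
  have hr0 : 0 < r := by linarith
  have hinv : r⁻¹ ≤ 1 := inv_le_one_of_one_le₀ hr.le
  have hmem := hψ.convexOn_toReal.1 hw hu (sub_nonneg.2 hinv) (by positivity) (sub_add_cancel 1 r⁻¹)
  have hconv := hψ.convexOn_toReal.2 hw hu (sub_nonneg.2 hinv) (by positivity)
    (sub_add_cancel 1 r⁻¹)
  have hdist : ‖(1 - r⁻¹) • w + r⁻¹ • u - w‖ ≤ 1 := by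
    have hseg : (1 - r⁻¹) • w + r⁻¹ • u - w = r⁻¹ • (u - w) := by module
    rw [hseg, norm_smul, Real.norm_of_nonneg (by positivity), inv_mul_cancel₀ hr0.ne']
  have hscaled := mul_le_mul_of_nonneg_left ((hball _ hmem hdist).trans hconv) hr0.le
  have hexpand : r * ((1 - r⁻¹) • (ψ w).toReal + r⁻¹ • (ψ u).toReal) =
      (r - 1) * (ψ w).toReal + (ψ u).toReal := by
    simp only [smul_eq_mul]
    field_simp
  nlinarith

lemma exists_isProx (hψ : ProperConvexLsc ψ) {t : ℝ} (ht : 0 < t) (y : Sp n) :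
    ∃ p, IsProx ψ t y p := by
  obtain ⟨w, hw, b, hb, hlow⟩ := hψ.exists_minorant
  have hlsc : LowerSemicontinuous fun u => ψ u + ((‖u - y‖ ^ 2 / (2 * t) : ℝ) : EReal) := by
    have hcont : Continuous fun u : Sp n => ((‖u - y‖ ^ 2 / (2 * t) : ℝ) : EReal) :=
      continuous_coe_real_ereal.comp (by fun_prop)
    exact hψ.lsc.add' hcont.lowerSemicontinuous fun x =>
      EReal.continuousAt_add (.inr (EReal.coe_ne_bot _)) (.inl (hψ.ne_bot x))
  set s := ‖w - y‖
  have hs : 0 ≤ s := norm_nonneg _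
  have htb : 0 ≤ t * b := mul_nonneg ht.le hb
  refine exists_forall_le_of_le_off_closedBall hlsc (w := w) (R := 2 * s + 4 * (t * b) + 1)
    (by positivity) fun u hu => ?_
  by_cases hud : u ∈ edom ψ
  · rw [← hψ.coe_toReal hw, ← hψ.coe_toReal hud, ← EReal.coe_add, ← EReal.coe_add,
      EReal.coe_le_coe_iff]
    set r := ‖u - w‖
    have htri : r - s ≤ ‖u - y‖ := by
      have := norm_sub_le (u - y) (w - y)
      rw [sub_sub_sub_cancel_right] at this
      linarith
    have hsq : (r - s) ^ 2 ≤ ‖u - y‖ ^ 2 := by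
      have : 0 ≤ r - s := by linarith
      gcongr
    have hgrowth : b + b * r ≤ ‖u - y‖ ^ 2 / (2 * t) - s ^ 2 / (2 * t) := by
      rw [← sub_div, le_div_iff₀ (by positivity)]
      nlinarith
    linarith [hlow u hud]
  · rw [not_not.1 hud, EReal.top_add_coe]
    exact le_top

end ProperConvexLsc

namespace IsProx

variable {ψ : Sp n → EReal} {L : ℝ} {y p u v : Sp n}

lemma mem_edom (hψ : ProperConvexLsc ψ) {t : ℝ} (h : IsProx ψ t y p) : p ∈ edom ψ := by
  intro hp
  obtain ⟨w, hw⟩ := hψ.nonempty_dom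
  have hpw := h w
  rw [hp, EReal.top_add_coe, ← hψ.coe_toReal hw, ← EReal.coe_add, top_le_iff] at hpw
  exact EReal.coe_ne_top _ hpw

lemma toReal_add_inner_le (hψ : ProperConvexLsc ψ) (hL : 0 < L) (h : IsProx ψ (1 / L) y p)
    (hu : u ∈ edom ψ) : (ψ p).toReal + L * inner ℝ (y - p) (u - p) ≤ (ψ u).toReal := by
  have hp := h.mem_edom hψ
  have hmin : IsMinOn (fun u => (ψ u).toReal + L / 2 * ‖u - y‖ ^ 2) (edom ψ) p := fun u hu => by
    have hpu := h u
    rw [← hψ.coe_toReal hp, ← hψ.coe_toReal hu, ← EReal.coe_add, ← EReal.coe_add,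
      EReal.coe_le_coe_iff] at hpu
    have hweight : ∀ s : ℝ, s / (2 * (1 / L)) = L / 2 * s := fun s => by field_simp
    rwa [hweight, hweight] at hpu
  have hquad : ∀ u, L / 2 * ‖u - y‖ ^ 2 ≤
      L / 2 * ‖p - y‖ ^ 2 + inner ℝ (L • (p - y)) (u - p) + L / 2 * ‖u - p‖ ^ 2 := fun u => by
    rw [← sub_add_sub_cancel' p y u, norm_add_sq_real, real_inner_smul_left]
    linarith
  have hfirst := sub_inner_le_of_isMinOn_add hψ.convexOn_toReal hp hmin hquad hu
  rwa [← neg_sub y p, smul_neg, inner_neg_left, real_inner_smul_left, sub_neg_eq_add] at hfirst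

lemma toReal_add_inner_sub_inner_le (hψ : ProperConvexLsc ψ) (hL : 0 < L)
    (h : IsProx ψ (1 / L) (y - (1 / L) • v) p) (hu : u ∈ edom ψ) :
    (ψ p).toReal + L * inner ℝ (y - p) (u - p) - inner ℝ v (u - p) ≤ (ψ u).toReal := by
  have hsub := h.toReal_add_inner_le hψ hL hu
  rw [sub_right_comm, inner_sub_left, real_inner_smul_left, mul_sub, ← mul_assoc,
    mul_one_div_cancel hL.ne', one_mul] at hsub
  linarith

end IsProx

/-! ### Smooth convex functions -/

section Smooth

variable {E : Type*} [NormedAddCommGroup E] [InnerProductSpace ℝ E] [CompleteSpace E]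
variable {φ φ' : E → ℝ} {μ μ' Λ Λ' : ℝ}

lemma hasDerivAt_line (hφ : Differentiable ℝ φ) (x d : E) (t : ℝ) :
    HasDerivAt (fun s : ℝ => φ (x + s • d)) (inner ℝ (gradient φ (x + t • d)) d) t := by
  have hline : HasDerivAt (fun s : ℝ => x + s • d) d t := by
    simpa using ((hasDerivAt_id t).smul_const d).const_add x
  rw [inner_gradient_left]
  exact (hφ _).hasFDerivAt.comp_hasDerivAt t hline

lemma le_of_norm_gradient_sub_le (hφ : Differentiable ℝ φ)
    (hlip : ∀ x y, ‖gradient φ x - gradient φ y‖ ≤ Λ * ‖x - y‖) (x y : E) :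
    φ y ≤ φ x + inner ℝ (gradient φ x) (y - x) + Λ / 2 * ‖y - x‖ ^ 2 := by
  obtain ⟨d, rfl⟩ : ∃ d, y = x + d := ⟨y - x, by abel⟩
  rw [add_sub_cancel_left]
  set k : ℝ → ℝ := fun t =>
    φ (x + t • d) - (t * inner ℝ (gradient φ x) d + Λ / 2 * ‖d‖ ^ 2 * t ^ 2) with hk
  have hderiv : ∀ t, HasDerivAt k (inner ℝ (gradient φ (x + t • d)) d -
      (1 * inner ℝ (gradient φ x) d + Λ / 2 * ‖d‖ ^ 2 * (2 * t))) t := fun t => by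
    refine (hasDerivAt_line hφ x d t).sub (((hasDerivAt_id t).mul_const _).add ?_)
    simpa using (hasDerivAt_pow 2 t).const_mul (Λ / 2 * ‖d‖ ^ 2)
  have hanti : AntitoneOn k (Set.Icc 0 1) := by
    refine antitoneOn_of_deriv_nonpos (convex_Icc 0 1)
      (fun t _ => (hderiv t).continuousAt.continuousWithinAt)
      (fun t _ => (hderiv t).differentiableAt.differentiableWithinAt) fun t ht => ?_
    rw [interior_Icc] at ht
    have hgrad : inner ℝ (gradient φ (x + t • d) - gradient φ x) d ≤ Λ * (t * ‖d‖) * ‖d‖ := by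
      refine (real_inner_le_norm _ _).trans (mul_le_mul_of_nonneg_right ?_ (norm_nonneg _))
      have := hlip (x + t • d) x
      rwa [add_sub_cancel_left, norm_smul, Real.norm_of_nonneg ht.1.le] at this
    rw [(hderiv t).deriv]
    rw [inner_sub_left] at hgrad
    linarith
  have hends := hanti (by simp) (by simp) zero_le_one
  simp only [hk, one_smul, zero_smul, add_zero] at hends
  linarith

lemma add_inner_gradient_le_of_convexOn (hconv : ConvexOn ℝ Set.univ φ)
    (hφ : Differentiable ℝ φ) (x y : E) : φ x + inner ℝ (gradient φ x) (y - x) ≤ φ y := by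
  have hline : ConvexOn ℝ Set.univ fun s : ℝ => φ (x + s • (y - x)) := by
    refine ⟨convex_univ, fun a _ b _ s t hs ht hst => ?_⟩
    have hseg : x + (s • a + t • b) • (y - x) = s • (x + a • (y - x)) + t • (x + b • (y - x)) := by
      rw [← eq_sub_iff_add_eq'] at hst
      rw [hst]
      module
    simp only [hseg]
    exact hconv.2 (Set.mem_univ _) (Set.mem_univ _) hs ht hst
  have hslope := hline.le_slope_of_hasDerivAt (Set.mem_univ 0) (Set.mem_univ 1) zero_lt_one
    (hasDerivAt_line hφ x (y - x) 0)
  rw [slope_def_field] at hslope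
  simp only [zero_smul, add_zero, one_smul, add_sub_cancel, sub_zero, div_one] at hslope
  linarith

/-- `φ` is differentiable and `μ`-strongly convex, and its gradient is `Λ`-Lipschitz. The strong
convexity is expressed by the quadratic lower bounds at the linearizations of `φ`. -/
structure StronglyConvexSmooth (φ : E → ℝ) (μ Λ : ℝ) : Prop where
  differentiable : Differentiable ℝ φ
  lower : ∀ x y, φ x + inner ℝ (gradient φ x) (y - x) + μ / 2 * ‖y - x‖ ^ 2 ≤ φ y
  lip : ∀ x y, ‖gradient φ x - gradient φ y‖ ≤ Λ * ‖x - y‖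

namespace StronglyConvexSmooth

lemma upper (h : StronglyConvexSmooth φ μ Λ) (x y : E) :
    φ y ≤ φ x + inner ℝ (gradient φ x) (y - x) + Λ / 2 * ‖y - x‖ ^ 2 :=
  le_of_norm_gradient_sub_le h.differentiable h.lip x y

lemma hasGradientAt (h : StronglyConvexSmooth φ μ Λ) (x : E) :
    HasGradientAt φ (gradient φ x) x :=
  (h.differentiable x).hasGradientAt

lemma of_convexOn (hconv : ConvexOn ℝ Set.univ φ) (hφ : Differentiable ℝ φ) {K : ℝ≥0}
    (hlip : LipschitzWith K (gradient φ)) : StronglyConvexSmooth φ 0 K := by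
  refine ⟨hφ, fun x y => ?_, fun x y => ?_⟩
  · simpa using add_inner_gradient_le_of_convexOn hconv hφ x y
  · simpa only [dist_eq_norm] using hlip.dist_le_mul x y

lemma of_hasGradientAt {G : E → E} (hG : ∀ x, HasGradientAt φ (G x) x)
    (lower : ∀ x y, φ x + inner ℝ (G x) (y - x) + μ / 2 * ‖y - x‖ ^ 2 ≤ φ y)
    (lip : ∀ x y, ‖G x - G y‖ ≤ Λ * ‖x - y‖) : StronglyConvexSmooth φ μ Λ := by
  obtain rfl := gradient_eq hG
  exact ⟨fun x => (hG x).differentiableAt, lower, lip⟩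

lemma add (h : StronglyConvexSmooth φ μ Λ) (h' : StronglyConvexSmooth φ' μ' Λ') :
    StronglyConvexSmooth (fun x => φ x + φ' x) (μ + μ') (Λ + Λ') := by
  refine of_hasGradientAt (G := fun x => gradient φ x + gradient φ' x) (fun x => ?_)
    (fun x y => ?_) fun x y => ?_
  · rw [hasGradientAt_iff_hasFDerivAt, map_add]
    exact (h.hasGradientAt x).hasFDerivAt.add (h'.hasGradientAt x).hasFDerivAt
  · rw [inner_add_left]
    linarith [h.lower x y, h'.lower x y]
  · rw [add_sub_add_comm, add_mul]
    exact norm_add_le_of_le (h.lip x y) (h'.lip x y)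

lemma mono (h : StronglyConvexSmooth φ μ Λ) (hΛ : Λ ≤ Λ') : StronglyConvexSmooth φ μ Λ' :=
  ⟨h.differentiable, h.lower, fun x y => (h.lip x y).trans (by gcongr)⟩

lemma const_mul (h : StronglyConvexSmooth φ μ Λ) {z : ℝ} (hz : 0 ≤ z) :
    StronglyConvexSmooth (fun x => z * φ x) (z * μ) (z * Λ) := by
  refine of_hasGradientAt (G := fun x => z • gradient φ x) (fun x => ?_)
    (fun x y => ?_) fun x y => ?_
  · rw [hasGradientAt_iff_hasFDerivAt, map_smul]
    exact (h.hasGradientAt x).hasFDerivAt.const_mul z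
  · rw [real_inner_smul_left]
    linarith [mul_le_mul_of_nonneg_left (h.lower x y) hz]
  · rw [← smul_sub, norm_smul, Real.norm_of_nonneg hz, mul_assoc]
    exact mul_le_mul_of_nonneg_left (h.lip x y) hz

lemma half_sq_dist (w : E) (hμ : 0 ≤ μ) :
    StronglyConvexSmooth (fun x => μ / 2 * ‖x - w‖ ^ 2) μ μ := by
  refine of_hasGradientAt (G := fun x => μ • (x - w)) (fun x => ?_) (fun x y => ?_) fun x y => ?_
  · rw [hasGradientAt_iff_hasFDerivAt]
    refine (((hasFDerivAt_id x).sub_const w).norm_sq.const_mul (μ / 2)).congr_fderiv ?_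
    ext v
    simp
    ring
  · rw [← sub_add_sub_cancel' x w y, norm_add_sq_real, real_inner_smul_left]
    exact le_of_eq (by ring)
  · rw [← smul_sub, norm_smul, Real.norm_of_nonneg hμ, sub_sub_sub_cancel_right]

end StronglyConvexSmooth

end Smooth

/-! ### Proximal gradient steps -/

section ProxStep

lemma norm_sq_momentum_le {E : Type*} [NormedAddCommGroup E] [InnerProductSpace ℝ E] {α : ℝ}
    (hα₀ : 0 ≤ α) (hα₁ : α ≤ 1) (a b c : E) :
    ‖a - (α * (1 - α)) • b - α • c‖ ^ 2 ≤
      (1 - α) * (α ^ 2 * ‖b + c‖ ^ 2 + ‖α • b - a‖ ^ 2 - (1 - α ^ 2) * ‖α • b‖ ^ 2) +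
        α * (‖c - a‖ ^ 2 - (1 - α ^ 2) * ‖c‖ ^ 2) := by
  have hdefect : 0 ≤ α ^ 2 * (1 - α) * (α + α ^ 2) * ‖b‖ ^ 2 := by
    have := sub_nonneg.2 hα₁
    positivity
  simp only [norm_sub_sq_real, norm_add_sq_real, inner_sub_left, real_inner_smul_left,
    real_inner_smul_right, norm_smul, mul_pow, Real.norm_eq_abs, sq_abs, real_inner_comm a b,
    real_inner_comm a c]
  linarith

variable {φ₁ : Sp n → ℝ} {φ₂ : Sp n → EReal} {μ Λ L α : ℝ} {u x y xp x' : Sp n}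

/-- The value of `φ₁ + φ₂`, as a real number (meaningful on the effective domain of `φ₂` only). -/
def objective (φ₁ : Sp n → ℝ) (φ₂ : Sp n → EReal) (x : Sp n) : ℝ := φ₁ x + (φ₂ x).toReal

/-- The auxiliary sequence of the accelerated method: the point that the step from `xp` to `x`,
prolonged by the factor `1 / α`, reaches. -/
def momentumPoint (x xp : Sp n) (α : ℝ) : Sp n := xp + (1 / α) • (x - xp)

/-- The Lyapunov function of the accelerated method with respect to the reference point `u`, for
the iterate `x` and the auxiliary point `v`. -/
def energy (φ₁ : Sp n → ℝ) (φ₂ : Sp n → EReal) (μ : ℝ) (u x v : Sp n) : ℝ :=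
  objective φ₁ φ₂ x - objective φ₁ φ₂ u + μ / 2 * ‖v - u‖ ^ 2

lemma prox_step_le (hφ : StronglyConvexSmooth φ₁ μ Λ) (hφ₂ : ProperConvexLsc φ₂) (hL : 0 < L)
    (hx : IsProx φ₂ (1 / L) (y - (1 / L) • gradient φ₁ y) x) (hd : Descent φ₁ y x L)
    (hu : u ∈ edom φ₂) :
    objective φ₁ φ₂ x + L / 2 * ‖u - x‖ ^ 2 + μ / 2 * ‖u - y‖ ^ 2 ≤
      objective φ₁ φ₂ u + L / 2 * ‖u - y‖ ^ 2 := by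
  have hsub := hx.toReal_add_inner_sub_inner_le hφ₂ hL hu
  have hlower := hφ.lower y u
  have hgrad : inner ℝ (gradient φ₁ y) (u - y) =
      inner ℝ (gradient φ₁ y) (u - x) + inner ℝ (gradient φ₁ y) (x - y) := by
    rw [← inner_add_right, sub_add_sub_cancel]
  have hthree : ‖u - y‖ ^ 2 = ‖u - x‖ ^ 2 + ‖x - y‖ ^ 2 - 2 * inner ℝ (y - x) (u - x) := by
    rw [← sub_sub_sub_cancel_right u y x, norm_sub_sq_real, norm_sub_rev y x, real_inner_comm]
    ring
  have hquad : L / 2 * ‖u - y‖ ^ 2 =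
      L / 2 * ‖u - x‖ ^ 2 + L / 2 * ‖x - y‖ ^ 2 - L * inner ℝ (y - x) (u - x) := by
    rw [hthree]
    ring
  unfold Descent at hd
  unfold objective
  linarith

lemma sub_extrapolate (hμ : 0 < μ) (hL : 0 < L) (hα : 0 < α) :
    x - extrapolate μ x xp α L =
      √(μ / L) • (extrapolate μ x xp α L - momentumPoint x xp α) := by
  have : 0 < √(μ / L) := Real.sqrt_pos.2 (div_pos hμ hL)
  unfold extrapolate momentumPoint
  match_scalars <;> field_simp <;> ring

/-- The Lyapunov function contracts because the energy inequality is the convex combination, with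
weights `1 - α` and `α`, of the proximal gradient inequalities at `x` and at `u`. -/
lemma energy_accelerated_step_le (hφ : StronglyConvexSmooth φ₁ μ Λ) (hφ₂ : ProperConvexLsc φ₂)
    (hμ : 0 < μ) (hL : μ ≤ L) (hα : 0 < α) (hx : x ∈ edom φ₂)
    (hx' : IsProx φ₂ (1 / L)
      (extrapolate μ x xp α L - (1 / L) • gradient φ₁ (extrapolate μ x xp α L)) x')
    (hd : Descent φ₁ (extrapolate μ x xp α L) x' L) (hu : u ∈ edom φ₂) :
    energy φ₁ φ₂ μ u x' (momentumPoint x' x √(μ / L)) ≤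
      (1 - √(μ / L)) * energy φ₁ φ₂ μ u x (momentumPoint x xp α) := by
  have hL₀ : 0 < L := hμ.trans_le hL
  have hxy : x - extrapolate μ x xp α L = _ := sub_extrapolate hμ hL₀ hα
  have hstep_x := prox_step_le hφ hφ₂ hL₀ hx' hd hx
  have hstep_u := prox_step_le hφ hφ₂ hL₀ hx' hd hu
  have hβ₀ : 0 < √(μ / L) := Real.sqrt_pos.2 (div_pos hμ hL₀)
  have hβ₁ : √(μ / L) ≤ 1 := Real.sqrt_le_one.2 ((div_le_one hL₀).2 hL)
  have hβsq : μ = L * √(μ / L) ^ 2 := by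
    rw [Real.sq_sqrt (by positivity), mul_div_cancel₀ _ hL₀.ne']
  unfold energy
  generalize extrapolate μ x xp α L = y at *
  generalize momentumPoint x xp α = v at *
  generalize √(μ / L) = β at *
  subst hβsq
  have hmom : momentumPoint x' x β - u =
      (1 / β) • ((x' - y) - (β * (1 - β)) • (y - v) - β • (u - y)) := by
    rw [eq_add_of_sub_eq hxy, momentumPoint]
    match_scalars <;> field_simp <;> ring
  have hscale : L * β ^ 2 / 2 * ‖momentumPoint x' x β - u‖ ^ 2 =
      L / 2 * ‖(x' - y) - (β * (1 - β)) • (y - v) - β • (u - y)‖ ^ 2 := by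
    rw [hmom, norm_smul, mul_pow, Real.norm_eq_abs, sq_abs]
    field_simp
  have hkey := mul_le_mul_of_nonneg_left
    (norm_sq_momentum_le hβ₀.le hβ₁ (x' - y) (y - v) (u - y)) (half_pos hL₀).le
  rw [← hxy, sub_sub_sub_cancel_right, sub_sub_sub_cancel_right, sub_add_sub_cancel',
    norm_sub_rev u v] at hkey
  rw [hscale]
  linarith [mul_le_mul_of_nonneg_left hstep_x (sub_nonneg.2 hβ₁),
    mul_le_mul_of_nonneg_left hstep_u hβ₀.le]

end ProxStep

/-! ### Backtracking -/

lemma Descent.of_le {φ₁ : Sp n → ℝ} {μ Λ L : ℝ} (hφ : StronglyConvexSmooth φ₁ μ Λ) (hL : Λ ≤ L)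
    (y x : Sp n) : Descent φ₁ y x L :=
  (hφ.upper y x).trans (by gcongr)

namespace Backtrack

variable {φ₁ : Sp n → ℝ} {φ₂ : Sp n → EReal} {μ Λ γ L L' : ℝ} {y : ℝ → Sp n} {x : Sp n} {m : ℕ}

lemma accepted (hb : Backtrack φ₁ φ₂ γ y L L' x m) :
    IsProx φ₂ (1 / L') (y L' - (1 / L') • gradient φ₁ (y L')) x ∧ Descent φ₁ (y L') x L' := by
  induction hb with
  | accept hx hd => exact ⟨hx, hd⟩
  | reject _ _ _ ih => exact ih

lemma le_const (hb : Backtrack φ₁ φ₂ γ y L L' x m) (hγ : 1 < γ) (hL : 0 < L) : L ≤ L' := by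
  induction hb with
  | accept => exact le_rfl
  | reject _ _ _ ih => exact (le_mul_of_one_le_left hL.le hγ.le).trans (ih (by positivity))

lemma const_le_max (hb : Backtrack φ₁ φ₂ γ y L L' x m) (hφ : StronglyConvexSmooth φ₁ μ Λ)
    (hγ : 0 ≤ γ) : L' ≤ max L (γ * Λ) := by
  induction hb with
  | accept => exact le_max_left _ _
  | reject _ hd _ ih =>
    have hlt := not_le.1 fun hle => hd (Descent.of_le hφ hle _ _)
    exact ih.trans (max_le (le_max_of_le_right (by gcongr)) (le_max_right _ _))

lemma const_mul_eq (hb : Backtrack φ₁ φ₂ γ y L L' x m) : L' * γ = L * γ ^ m := by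
  induction hb with
  | accept => rw [pow_one]
  | reject _ _ _ ih => rw [ih]; ring

lemma count_le (hb : Backtrack φ₁ φ₂ γ y L L' x m) (hγ : 1 < γ) (hL : 0 < L) {κ : ℝ}
    (hκ : L' ≤ κ * L) : (m : ℝ) ≤ 1 + Real.log κ / Real.log γ := by
  have hκ₀ : 0 < κ := pos_of_mul_pos_left (hL.trans_le ((hb.le_const hγ hL).trans hκ)) hL.le
  have hpow : γ ^ m ≤ κ * γ := by
    refine le_of_mul_le_mul_left ?_ hL
    rw [← hb.const_mul_eq]
    nlinarith
  have hlog := Real.log_le_log (by positivity) hpow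
  rw [Real.log_pow, Real.log_mul hκ₀.ne' (by positivity)] at hlog
  rw [← sub_le_iff_le_add', le_div_iff₀ (Real.log_pos hγ)]
  linarith

end Backtrack

lemma StronglyConvexSmooth.exists_backtrack {φ₁ : Sp n → ℝ} {φ₂ : Sp n → EReal} {μ Λ γ L : ℝ}
    (hφ : StronglyConvexSmooth φ₁ μ Λ) (hφ₂ : ProperConvexLsc φ₂) (hγ : 1 < γ) (y : ℝ → Sp n)
    (hL : 0 < L) : ∃ L' x m, Backtrack φ₁ φ₂ γ y L L' x m := by
  obtain ⟨j, hj⟩ := pow_unbounded_of_one_lt (Λ / L) hγ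
  rw [div_lt_iff₀ hL] at hj
  induction j generalizing L with
  | zero =>
    obtain ⟨x, hx⟩ := hφ₂.exists_isProx (one_div_pos.2 hL) (y L - (1 / L) • gradient φ₁ (y L))
    exact ⟨L, x, 1, .accept hx (Descent.of_le hφ (by simpa using hj.le) _ _)⟩
  | succ j ih =>
    obtain ⟨x, hx⟩ := hφ₂.exists_isProx (one_div_pos.2 hL) (y L - (1 / L) • gradient φ₁ (y L))
    by_cases hd : Descent φ₁ (y L) x L
    · exact ⟨L, x, 1, .accept hx hd⟩
    · obtain ⟨L', x', m, hb⟩ := ih (L := γ * L) (by positivity) (by rwa [← mul_assoc, ← pow_succ])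
      exact ⟨L', x', m + 1, .reject hx hd hb⟩

/-! ### Stationarity -/

section Stationarity

variable {φ₁ : Sp n → ℝ} {φ₂ : Sp n → EReal} {μ Λ L tol δ : ℝ} {x y u v : Sp n}

lemma mem_edom_of_mem_subdiff (hφ₂ : ProperConvexLsc φ₂)
    (hv : v ∈ subdiff (fun u => (φ₁ u : EReal) + φ₂ u) x) : x ∈ edom φ₂ := by
  intro htop
  obtain ⟨u, hu⟩ := hφ₂.nonempty_dom
  have hxu := hv u
  simp only at hxu
  rw [htop, EReal.coe_add_top, EReal.top_add_coe, ← hφ₂.coe_toReal hu, ← EReal.coe_add,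
    top_le_iff] at hxu
  exact EReal.coe_ne_top _ hxu

lemma objective_add_inner_le_of_mem_subdiff (hφ₂ : ProperConvexLsc φ₂)
    (hv : v ∈ subdiff (fun u => (φ₁ u : EReal) + φ₂ u) x) (hu : u ∈ edom φ₂) :
    objective φ₁ φ₂ x + inner ℝ v (u - x) ≤ objective φ₁ φ₂ u := by
  have hxu := hv u
  simp only at hxu
  rwa [← hφ₂.coe_toReal hu, ← hφ₂.coe_toReal (mem_edom_of_mem_subdiff hφ₂ hv), ← EReal.coe_add,
    ← EReal.coe_add, ← EReal.coe_add, EReal.coe_le_coe_iff] at hxu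

lemma objective_add_inner_add_sq_le_of_mem_subdiff (hφ : StronglyConvexSmooth φ₁ μ Λ)
    (hφ₂ : ProperConvexLsc φ₂) (hv : v ∈ subdiff (fun u => (φ₁ u : EReal) + φ₂ u) x)
    (hu : u ∈ edom φ₂) :
    objective φ₁ φ₂ x + inner ℝ v (u - x) + μ / 2 * ‖u - x‖ ^ 2 ≤ objective φ₁ φ₂ u := by
  have hmin : IsMinOn (fun u => (φ₂ u).toReal + (φ₁ u - inner ℝ v (u - x))) (edom φ₂) x := by
    refine isMinOn_iff.2 fun u hu => ?_
    have hle := objective_add_inner_le_of_mem_subdiff hφ₂ hv hu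
    unfold objective at hle
    rw [sub_self, inner_zero_right]
    linarith
  have hfirst := sub_inner_le_of_isMinOn_add (a := gradient φ₁ x - v) (K := Λ / 2)
    hφ₂.convexOn_toReal (mem_edom_of_mem_subdiff hφ₂ hv) hmin (fun u => by
      rw [sub_self, inner_zero_right, inner_sub_left]
      linarith [hφ.upper x u]) hu
  rw [inner_sub_left] at hfirst
  unfold objective
  linarith [hφ.lower x u]

lemma smul_sub_add_gradient_sub_mem_subdiff (hφ : StronglyConvexSmooth φ₁ μ Λ) (hμ : 0 ≤ μ)
    (hφ₂ : ProperConvexLsc φ₂) (hL : 0 < L)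
    (hx : IsProx φ₂ (1 / L) (y - (1 / L) • gradient φ₁ y) x) :
    L • (y - x) + (gradient φ₁ x - gradient φ₁ y) ∈
      subdiff (fun u => (φ₁ u : EReal) + φ₂ u) x := by
  intro u
  by_cases hu : u ∈ edom φ₂
  · have hsub := hx.toReal_add_inner_sub_inner_le hφ₂ hL hu
    have hlower := hφ.lower x u
    have hsq : 0 ≤ μ / 2 * ‖u - x‖ ^ 2 := by positivity
    simp only
    rw [← hφ₂.coe_toReal hu, ← hφ₂.coe_toReal (hx.mem_edom hφ₂), ← EReal.coe_add,
      ← EReal.coe_add, ← EReal.coe_add, EReal.coe_le_coe_iff, inner_add_left, inner_sub_left,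
      real_inner_smul_left]
    linarith
  · simp only [not_not.1 hu, EReal.coe_add_top, le_top]

lemma NearStationary.of_mem_subdiff (hv : v ∈ subdiff (fun u => (φ₁ u : EReal) + φ₂ u) x)
    (htol : ‖v‖ ≤ tol) : NearStationary φ₁ φ₂ tol x := by
  refine (Metric.infEDist_le_edist_of_mem hv).trans ?_
  rw [edist_dist, dist_zero_left]
  exact ENNReal.ofReal_le_ofReal htol

lemma NearStationary.exists_mem_subdiff (hx : NearStationary φ₁ φ₂ tol x) (htol : 0 ≤ tol)
    (hδ : 0 < δ) : ∃ v ∈ subdiff (fun u => (φ₁ u : EReal) + φ₂ u) x, ‖v‖ < tol + δ := by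
  have hpos : 0 < tol + δ := by positivity
  obtain ⟨v, hv, hlt⟩ := Metric.infEDist_lt_iff.1
    (hx.trans_lt ((ENNReal.ofReal_lt_ofReal_iff hpos).2 (lt_add_of_pos_right _ hδ)))
  rw [edist_dist, dist_zero_left] at hlt
  exact ⟨v, hv, (ENNReal.ofReal_lt_ofReal_iff hpos).1 hlt⟩

lemma NearStationary.mem_edom (hx : NearStationary φ₁ φ₂ tol x) (hφ₂ : ProperConvexLsc φ₂)
    (htol : 0 ≤ tol) : x ∈ edom φ₂ := by
  obtain ⟨v, hv, -⟩ := hx.exists_mem_subdiff htol one_pos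
  exact mem_edom_of_mem_subdiff hφ₂ hv

lemma NearStationary.objective_add_sq_le (hx : NearStationary φ₁ φ₂ tol x)
    (hφ : StronglyConvexSmooth φ₁ μ Λ) (hφ₂ : ProperConvexLsc φ₂) (htol : 0 ≤ tol)
    (hu : u ∈ edom φ₂) :
    objective φ₁ φ₂ x + μ / 2 * ‖u - x‖ ^ 2 ≤ objective φ₁ φ₂ u + tol * ‖u - x‖ := by
  refine le_of_forall_pos_le_add fun η hη => ?_
  obtain ⟨v, hv, hvn⟩ := hx.exists_mem_subdiff htol (δ := η / (‖u - x‖ + 1)) (by positivity)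
  have hstrong := objective_add_inner_add_sq_le_of_mem_subdiff hφ hφ₂ hv hu
  have hinner : -(‖v‖ * ‖u - x‖) ≤ inner ℝ v (u - x) := (abs_le.1 (abs_real_inner_le_norm _ _)).1
  have hnorm : ‖v‖ * ‖u - x‖ ≤ (tol + η / (‖u - x‖ + 1)) * ‖u - x‖ := by gcongr
  have herror : η / (‖u - x‖ + 1) * ‖u - x‖ ≤ η := by
    rw [div_mul_eq_mul_div, div_le_iff₀ (by positivity)]
    nlinarith [norm_nonneg (u - x)]
  linarith

end Stationarity

lemma APGLoop.nearStationary {φ₁ : Sp n → ℝ} {φ₂ : Sp n → EReal} {γ₁ γ₂ Lmin μ tol L αp : ℝ}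
    {x xp out : Sp n} {N : ℕ} (hl : APGLoop φ₁ φ₂ γ₁ γ₂ Lmin μ tol x xp L αp out N) :
    NearStationary φ₁ φ₂ tol out := by
  induction hl with
  | halt _ _ ht => exact ht
  | next _ _ _ _ ih => exact ih

lemma APG.nearStationary {φ₁ : Sp n → ℝ} {φ₂ : Sp n → EReal} {Lmin μ γ₁ γ₂ tol : ℝ}
    {y out : Sp n} {N : ℕ} (hr : APG φ₁ φ₂ Lmin μ γ₁ γ₂ y tol out N) :
    NearStationary φ₁ φ₂ tol out := by
  obtain ⟨_, _, _, _, -, hl, -⟩ := hr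
  exact hl.nearStationary

/-! ### Convergence of the accelerated proximal gradient method -/

/-- The number of queries of one pass of the accelerated proximal gradient method, which makes two
backtracking steps whose constants vary by the factor `κ` at most. -/
def passQueries (γ₁ κ : ℝ) : ℝ := 8 * (1 + Real.log κ / Real.log γ₁) + 1

lemma passQueries_pos {γ₁ κ : ℝ} (hγ₁ : 1 < γ₁) (hκ : 1 ≤ κ) : 0 < passQueries γ₁ κ := by
  have := Real.log_pos hγ₁
  have := Real.log_nonneg hκ
  unfold passQueries
  positivity

lemma passQueries_mono {γ₁ κ κ' : ℝ} (hγ₁ : 1 < γ₁) (hκ : 0 < κ) (h : κ ≤ κ') :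
    passQueries γ₁ κ ≤ passQueries γ₁ κ' := by
  have := Real.log_pos hγ₁
  unfold passQueries
  gcongr

/-- Standing assumptions on the data of the accelerated proximal gradient method: all accepted
constants lie in `[Lmin, Lbar]`, and `lb` is a lower bound of the objective, improved by the
quadratic centered at `w`. -/
structure APGData (φ₁ : Sp n → ℝ) (φ₂ : Sp n → EReal) (γ₁ γ₂ Lmin μ Λ Lbar lb : ℝ) (w : Sp n) :
    Prop where
  smooth : StronglyConvexSmooth φ₁ μ Λ
  pcl : ProperConvexLsc φ₂
  one_lt : 1 < γ₁
  one_le : 1 ≤ γ₂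
  μ_pos : 0 < μ
  μ_le : μ ≤ Lmin
  Lmin_le : Lmin ≤ Lbar
  Λ_nonneg : 0 ≤ Λ
  Λ_le : γ₁ * Λ ≤ Lbar
  low : ∀ x ∈ edom φ₂, lb + μ / 2 * ‖x - w‖ ^ 2 ≤ objective φ₁ φ₂ x

namespace APGData

variable {φ₁ : Sp n → ℝ} {φ₂ : Sp n → EReal} {γ₁ γ₂ Lmin μ Λ Lbar lb tol θ L αp Lt Lh : ℝ}
  {w u x₀ x xp xt xh : Sp n} {m m' : ℕ}

/-- The invariant of the main loop: since the point `x₀` was reached, the energy with respect to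
every point of the domain has been contracted by the factor `θ`. -/
structure Inv (φ₁ : Sp n → ℝ) (φ₂ : Sp n → EReal) (Lmin Lbar μ : ℝ) (x₀ : Sp n) (θ : ℝ)
    (x xp : Sp n) (L αp : ℝ) : Prop where
  mem : x ∈ edom φ₂
  α_pos : 0 < αp
  L_ge : Lmin ≤ L
  L_le : L ≤ Lbar
  θ_nonneg : 0 ≤ θ
  energy_le : ∀ u ∈ edom φ₂,
    energy φ₁ φ₂ μ u x (momentumPoint x xp αp) ≤ θ * energy φ₁ φ₂ μ u x₀ x₀

lemma Inv.objective_sub_le (hI : Inv φ₁ φ₂ Lmin Lbar μ x₀ θ x xp L αp) (hμ : 0 ≤ μ)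
    (hu : u ∈ edom φ₂) :
    objective φ₁ φ₂ x - objective φ₁ φ₂ u ≤ θ * energy φ₁ φ₂ μ u x₀ x₀ := by
  have hsq : 0 ≤ μ / 2 * ‖momentumPoint x xp αp - u‖ ^ 2 := by positivity
  have henergy := hI.energy_le u hu
  unfold energy at henergy ⊢
  linarith

lemma Inv.objective_le (hI : Inv φ₁ φ₂ Lmin Lbar μ x₀ θ x xp L αp) (hμ : 0 ≤ μ)
    (hx₀ : x₀ ∈ edom φ₂) : objective φ₁ φ₂ x ≤ objective φ₁ φ₂ x₀ := by
  simpa [energy] using hI.objective_sub_le hμ hx₀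

variable (H : APGData φ₁ φ₂ γ₁ γ₂ Lmin μ Λ Lbar lb w)
include H

lemma Lmin_pos : 0 < Lmin := H.μ_pos.trans_le H.μ_le

lemma Lbar_pos : 0 < Lbar := H.Lmin_pos.trans_le H.Lmin_le

lemma Λ_le_Lbar : Λ ≤ Lbar := (le_mul_of_one_le_left H.Λ_nonneg H.one_lt.le).trans H.Λ_le

lemma sqrt_le_one (hLt : Lmin ≤ Lt) : √(μ / Lt) ≤ 1 :=
  Real.sqrt_le_one.2 ((div_le_one (H.Lmin_pos.trans_le hLt)).2 (H.μ_le.trans hLt))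

lemma backtrack_const_mem {y : ℝ → Sp n} (hb : Backtrack φ₁ φ₂ γ₁ y L Lt xt m)
    (hL : L ∈ Set.Icc Lmin Lbar) : Lt ∈ Set.Icc Lmin Lbar :=
  ⟨hL.1.trans (hb.le_const H.one_lt (H.Lmin_pos.trans_le hL.1)),
    (hb.const_le_max H.smooth (zero_le_one.trans H.one_lt.le)).trans (max_le hL.2 H.Λ_le)⟩

lemma backtrack_count_le {y : ℝ → Sp n} (hb : Backtrack φ₁ φ₂ γ₁ y L Lt xt m)
    (hL : L ∈ Set.Icc Lmin Lbar) : (m : ℝ) ≤ 1 + Real.log (Lbar / Lmin) / Real.log γ₁ := by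
  refine hb.count_le H.one_lt (H.Lmin_pos.trans_le hL.1)
    ((H.backtrack_const_mem hb hL).2.trans ?_)
  rw [div_mul_eq_mul_div, le_div_iff₀ H.Lmin_pos]
  exact mul_le_mul_of_nonneg_left hL.1 H.Lbar_pos.le

lemma exists_pass (hI : Inv φ₁ φ₂ Lmin Lbar μ x₀ θ x xp L αp) :
    ∃ Lt xt m Lh xh m', Backtrack φ₁ φ₂ γ₁ (extrapolate μ x xp αp) L Lt xt m ∧
      Backtrack φ₁ φ₂ γ₁ (fun _ => xt) Lt Lh xh m' := by
  obtain ⟨Lt, xt, m, hb⟩ := H.smooth.exists_backtrack H.pcl H.one_lt (extrapolate μ x xp αp)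
    (H.Lmin_pos.trans_le hI.L_ge)
  obtain ⟨Lh, xh, m', hb'⟩ := H.smooth.exists_backtrack H.pcl H.one_lt (fun _ => xt)
    (H.Lmin_pos.trans_le (H.backtrack_const_mem hb ⟨hI.L_ge, hI.L_le⟩).1)
  exact ⟨Lt, xt, m, Lh, xh, m', hb, hb'⟩

lemma pass_queries_le (hI : Inv φ₁ φ₂ Lmin Lbar μ x₀ θ x xp L αp)
    (hb : Backtrack φ₁ φ₂ γ₁ (extrapolate μ x xp αp) L Lt xt m)
    (hb' : Backtrack φ₁ φ₂ γ₁ (fun _ => xt) Lt Lh xh m') :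
    ((4 * m + 4 * m' + 1 : ℕ) : ℝ) ≤ passQueries γ₁ (Lbar / Lmin) := by
  have hL : L ∈ Set.Icc Lmin Lbar := ⟨hI.L_ge, hI.L_le⟩
  have hm := H.backtrack_count_le hb hL
  have hm' := H.backtrack_count_le hb' (H.backtrack_const_mem hb hL)
  unfold passQueries
  push_cast
  linarith

lemma restart_mem (hLt : Lt ∈ Set.Icc Lmin Lbar) : max Lmin (Lt / γ₂) ∈ Set.Icc Lmin Lbar :=
  ⟨le_max_left _ _, max_le H.Lmin_le
    ((div_le_self (H.Lmin_pos.trans_le hLt.1).le H.one_le).trans hLt.2)⟩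

lemma inv_start (hx₀ : x₀ ∈ edom φ₂) (hLt : Lt ∈ Set.Icc Lmin Lbar) :
    Inv φ₁ φ₂ Lmin Lbar μ x₀ 1 x₀ x₀ (max Lmin (Lt / γ₂)) 1 :=
  ⟨hx₀, one_pos, (H.restart_mem hLt).1, (H.restart_mem hLt).2, zero_le_one,
    fun u _ => by simp [momentumPoint]⟩

lemma inv_step (hI : Inv φ₁ φ₂ Lmin Lbar μ x₀ θ x xp L αp)
    (hb : Backtrack φ₁ φ₂ γ₁ (extrapolate μ x xp αp) L Lt xt m) :
    Inv φ₁ φ₂ Lmin Lbar μ x₀ ((1 - √(μ / Lt)) * θ) xt x (max Lmin (Lt / γ₂)) √(μ / Lt) := by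
  have hLt := H.backtrack_const_mem hb ⟨hI.L_ge, hI.L_le⟩
  have hq : 0 ≤ 1 - √(μ / Lt) := sub_nonneg.2 (H.sqrt_le_one hLt.1)
  obtain ⟨hprox, hdesc⟩ := hb.accepted
  refine ⟨hprox.mem_edom H.pcl, Real.sqrt_pos.2 (div_pos H.μ_pos (H.Lmin_pos.trans_le hLt.1)),
    (H.restart_mem hLt).1, (H.restart_mem hLt).2, mul_nonneg hq hI.θ_nonneg, fun u hu => ?_⟩
  rw [mul_assoc]
  exact (energy_accelerated_step_le H.smooth H.pcl H.μ_pos (H.μ_le.trans hLt.1) hI.α_pos hI.mem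
    hprox hdesc hu).trans (mul_le_mul_of_nonneg_left (hI.energy_le u hu) hq)

lemma lb_le (hu : u ∈ edom φ₂) : lb ≤ objective φ₁ φ₂ u := by
  have hsq : 0 ≤ μ / 2 * ‖u - w‖ ^ 2 := mul_nonneg (half_pos H.μ_pos).le (sq_nonneg _)
  linarith [H.low u hu]

lemma energy_start_le (hx₀ : x₀ ∈ edom φ₂) (hu : u ∈ edom φ₂)
    (hle : objective φ₁ φ₂ u ≤ objective φ₁ φ₂ x₀) :
    energy φ₁ φ₂ μ u x₀ x₀ ≤ 4 * (objective φ₁ φ₂ x₀ - lb) := by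
  have hpar : ‖x₀ - u‖ ^ 2 ≤ 2 * ‖x₀ - w‖ ^ 2 + 2 * ‖u - w‖ ^ 2 := by
    have := parallelogram_law_with_norm ℝ (x₀ - w) (u - w)
    rw [sub_sub_sub_cancel_right] at this
    nlinarith [sq_nonneg ‖x₀ - w + (u - w)‖]
  have hdist := mul_le_mul_of_nonneg_left hpar (half_pos H.μ_pos).le
  unfold energy
  linarith [H.low x₀ hx₀, H.low u hu]

lemma norm_residual_le (hLh : 0 ≤ Lh) (hle : Lh ≤ Lbar) (x xh : Sp n) :
    ‖Lh • (x - xh) + (gradient φ₁ xh - gradient φ₁ x)‖ ≤ 2 * Lbar * ‖x - xh‖ := by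
  have hlip := H.smooth.lip xh x
  rw [norm_sub_rev xh x] at hlip
  calc ‖Lh • (x - xh) + (gradient φ₁ xh - gradient φ₁ x)‖ ≤ Lh * ‖x - xh‖ + Λ * ‖x - xh‖ := by
        rw [← Real.norm_of_nonneg hLh, ← norm_smul, Real.norm_of_nonneg hLh]
        exact norm_add_le_of_le le_rfl hlip
    _ ≤ Lbar * ‖x - xh‖ + Lbar * ‖x - xh‖ := by
        have := H.Λ_le_Lbar
        gcongr
    _ = _ := by ring

lemma nearStationary (hx₀ : x₀ ∈ edom φ₂) (htol : 0 ≤ tol)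
    (hI : Inv φ₁ φ₂ Lmin Lbar μ x₀ θ x xp L αp) (hLt : Lt ∈ Set.Icc Lmin Lbar)
    (hb : Backtrack φ₁ φ₂ γ₁ (fun _ => x) Lt Lh xh m)
    (hθ : θ * (32 * (objective φ₁ φ₂ x₀ - lb) * Lbar ^ 2 / Lmin) ≤ tol ^ 2) :
    NearStationary φ₁ φ₂ tol xh := by
  have hLh := H.backtrack_const_mem hb hLt
  have hmin := H.Lmin_pos
  have hpos : 0 < Lh := hmin.trans_le hLh.1
  obtain ⟨hprox, hdesc⟩ := hb.accepted
  have hxh := hprox.mem_edom H.pcl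
  have hstep := prox_step_le H.smooth H.pcl hpos hprox hdesc hI.mem
  rw [sub_self, norm_zero] at hstep
  have hdecrease : objective φ₁ φ₂ xh ≤ objective φ₁ φ₂ x₀ := by
    have : 0 ≤ Lh / 2 * ‖x - xh‖ ^ 2 := by positivity
    have : 0 ≤ μ / 2 * (0 : ℝ) ^ 2 := by simp
    linarith [hI.objective_le H.μ_pos.le hx₀]
  have hgap : Lh / 2 * ‖x - xh‖ ^ 2 ≤ θ * (4 * (objective φ₁ φ₂ x₀ - lb)) := by
    have := hI.objective_sub_le H.μ_pos.le hxh
    linarith [mul_le_mul_of_nonneg_left (H.energy_start_le hx₀ hxh hdecrease) hI.θ_nonneg]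
  refine .of_mem_subdiff
    (smul_sub_add_gradient_sub_mem_subdiff H.smooth H.μ_pos.le H.pcl hpos hprox)
    ((H.norm_residual_le hpos.le hLh.2 x xh).trans (abs_le_of_sq_le_sq' ?_ htol).2)
  calc (2 * Lbar * ‖x - xh‖) ^ 2 = 8 * Lbar ^ 2 / Lmin * (Lmin / 2 * ‖x - xh‖ ^ 2) := by
        field_simp
        ring
    _ ≤ 8 * Lbar ^ 2 / Lmin * (Lh / 2 * ‖x - xh‖ ^ 2) := by gcongr; exact hLh.1
    _ ≤ 8 * Lbar ^ 2 / Lmin * (θ * (4 * (objective φ₁ φ₂ x₀ - lb))) := by gcongr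
    _ = θ * (32 * (objective φ₁ φ₂ x₀ - lb) * Lbar ^ 2 / Lmin) := by ring
    _ ≤ _ := hθ

lemma contraction_step {B τ : ℝ} (hB : 0 ≤ B) {j : ℕ}
    (hI : Inv φ₁ φ₂ Lmin Lbar μ x₀ θ x xp L αp) (hLt : Lt ∈ Set.Icc Lmin Lbar)
    (hθ : θ * (1 - √(μ / Lbar)) ^ (j + 1) * B ≤ τ) :
    (1 - √(μ / Lt)) * θ * (1 - √(μ / Lbar)) ^ j * B ≤ τ := by
  refine le_trans ?_ hθ
  have hθ₀ := hI.θ_nonneg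
  have hq : 0 ≤ 1 - √(μ / Lbar) := sub_nonneg.2 (H.sqrt_le_one H.Lmin_le)
  have hle : 1 - √(μ / Lt) ≤ 1 - √(μ / Lbar) := by
    have := H.μ_pos
    have := H.Lmin_pos.trans_le hLt.1
    have := hLt.2
    gcongr
  rw [mul_comm _ θ, pow_succ', ← mul_assoc]
  gcongr

/-- Every pass contracts the energy by `1 - √(μ / Lbar)` at least, and the stopping test succeeds
as soon as the energy is of the order `tol²`. -/
lemma loop (hx₀ : x₀ ∈ edom φ₂) (htol : 0 ≤ tol) (j : ℕ)
    (hI : Inv φ₁ φ₂ Lmin Lbar μ x₀ θ x xp L αp)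
    (hθ : θ * (1 - √(μ / Lbar)) ^ (j + 1) *
      (32 * (objective φ₁ φ₂ x₀ - lb) * Lbar ^ 2 / Lmin) ≤ tol ^ 2) :
    (∃ out N, APGLoop φ₁ φ₂ γ₁ γ₂ Lmin μ tol x xp L αp out N) ∧
    ∀ out N, APGLoop φ₁ φ₂ γ₁ γ₂ Lmin μ tol x xp L αp out N →
      (N : ℝ) ≤ (j + 1) * passQueries γ₁ (Lbar / Lmin) := by
  have hB : 0 ≤ 32 * (objective φ₁ φ₂ x₀ - lb) * Lbar ^ 2 / Lmin := by
    have := H.Lmin_pos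
    have := sub_nonneg.2 (H.lb_le hx₀)
    positivity
  have hpass := passQueries_pos H.one_lt ((one_le_div H.Lmin_pos).2 H.Lmin_le)
  induction j generalizing θ L αp x xp with
  | zero =>
    have hnear : ∀ {Lt Lh xt xh m m'},
        Backtrack φ₁ φ₂ γ₁ (extrapolate μ x xp αp) L Lt xt m →
        Backtrack φ₁ φ₂ γ₁ (fun _ => xt) Lt Lh xh m' → NearStationary φ₁ φ₂ tol xh :=
      fun hb hb' => by
        have hLt := H.backtrack_const_mem hb ⟨hI.L_ge, hI.L_le⟩
        exact H.nearStationary hx₀ htol (H.inv_step hI hb) hLt hb'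
          (by simpa only [pow_zero, mul_one] using H.contraction_step hB hI hLt hθ)
    obtain ⟨_, _, _, _, _, _, hb, hb'⟩ := H.exists_pass hI
    refine ⟨⟨_, _, .halt hb hb' (hnear hb hb')⟩, fun out N hr => ?_⟩
    cases hr with
    | halt hb hb' _ => simpa using H.pass_queries_le hI hb hb'
    | next hb hb' ht _ => exact absurd (hnear hb hb') ht
  | succ j ih =>
    have hrest : ∀ {Lt xt m}, Backtrack φ₁ φ₂ γ₁ (extrapolate μ x xp αp) L Lt xt m → _ :=
      fun hb => ih (H.inv_step hI hb)
        (H.contraction_step hB hI (H.backtrack_const_mem hb ⟨hI.L_ge, hI.L_le⟩) hθ)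
    constructor
    · obtain ⟨_, _, _, _, xh, _, hb, hb'⟩ := H.exists_pass hI
      by_cases ht : NearStationary φ₁ φ₂ tol xh
      · exact ⟨_, _, .halt hb hb' ht⟩
      · obtain ⟨out, N, hr⟩ := (hrest hb).1
        exact ⟨_, _, .next hb hb' ht hr⟩
    · intro out N hr
      cases hr with
      | halt hb hb' _ =>
        have := H.pass_queries_le hI hb hb'
        have : 0 ≤ ((j : ℝ) + 1) * passQueries γ₁ (Lbar / Lmin) := by positivity
        push_cast at *
        linarith
      | next hb hb' _ hrec =>
        have := H.pass_queries_le hI hb hb'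
        have := (hrest hb).2 _ _ hrec
        push_cast at *
        linarith

lemma objective_start_le {y₀ : Sp n} (hb : Backtrack φ₁ φ₂ γ₁ (fun _ => y₀) Lmin L x₀ m)
    (hu : u ∈ edom φ₂) :
    objective φ₁ φ₂ x₀ ≤ objective φ₁ φ₂ u + Lbar / 2 * ‖u - y₀‖ ^ 2 := by
  have hL := H.backtrack_const_mem hb ⟨le_rfl, H.Lmin_le⟩
  have hpos : 0 < L := H.Lmin_pos.trans_le hL.1
  obtain ⟨hprox, hdesc⟩ := hb.accepted
  have hstep := prox_step_le H.smooth H.pcl hpos hprox hdesc hu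
  have : 0 ≤ L / 2 * ‖u - x₀‖ ^ 2 := by positivity
  have : 0 ≤ μ / 2 * ‖u - y₀‖ ^ 2 := mul_nonneg (half_pos H.μ_pos).le (sq_nonneg _)
  have : L / 2 * ‖u - y₀‖ ^ 2 ≤ Lbar / 2 * ‖u - y₀‖ ^ 2 := by gcongr; exact hL.2
  linarith

lemma run {y₀ : Sp n} (hu : u ∈ edom φ₂) (htol : 0 ≤ tol) (j : ℕ)
    (hj : (1 - √(μ / Lbar)) ^ (j + 1) *
      (32 * (objective φ₁ φ₂ u - lb + Lbar / 2 * ‖u - y₀‖ ^ 2) * Lbar ^ 2 / Lmin) ≤ tol ^ 2) :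
    (∃ out N, APG φ₁ φ₂ Lmin μ γ₁ γ₂ y₀ tol out N) ∧
    ∀ out N, APG φ₁ φ₂ Lmin μ γ₁ γ₂ y₀ tol out N →
      (N : ℝ) ≤ (j + 2) * passQueries γ₁ (Lbar / Lmin) := by
  have hstart : Lmin ∈ Set.Icc Lmin Lbar := ⟨le_rfl, H.Lmin_le⟩
  have hloop : ∀ {L x₀ m}, Backtrack φ₁ φ₂ γ₁ (fun _ => y₀) Lmin L x₀ m → _ := fun hb => by
    have hx₀ := hb.accepted.1.mem_edom H.pcl
    refine H.loop hx₀ htol j (H.inv_start hx₀ (H.backtrack_const_mem hb hstart)) (le_trans ?_ hj)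
    have := H.Lmin_pos
    have := sub_nonneg.2 (H.sqrt_le_one H.Lmin_le)
    rw [one_mul]
    gcongr
    linarith [H.objective_start_le hb hu]
  constructor
  · obtain ⟨L, x₀, m, hb⟩ := H.smooth.exists_backtrack H.pcl H.one_lt (fun _ => y₀) H.Lmin_pos
    obtain ⟨out, N, hr⟩ := (hloop hb).1
    exact ⟨out, _, L, x₀, m, N, hb, hr, rfl⟩
  · rintro out N ⟨L, x₀, m, M, hb, hr, rfl⟩
    have hM := (hloop hb).2 _ _ hr
    have hm := H.backtrack_count_le hb hstart
    have : (0 : ℝ) ≤ m := Nat.cast_nonneg m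
    have hpass : 4 * (m : ℝ) ≤ passQueries γ₁ (Lbar / Lmin) := by
      unfold passQueries
      linarith
    push_cast
    linarith

end APGData

/-! ### Level sets -/

section LevelSets

variable {ψ ψ' : Sp n → EReal}

lemma isClosed_lev (hψ : LowerSemicontinuous ψ) (r : ℝ) : IsClosed (lev ψ r) :=
  hψ.isClosed_preimage _

lemma isCompact_lev (hψ : LowerSemicontinuous ψ) {r : ℝ} (hb : Bornology.IsBounded (lev ψ r)) :
    IsCompact (lev ψ r) :=
  Metric.isCompact_of_isClosed_isBounded (isClosed_lev hψ r) hb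

lemma mem_lev_of_forall_pos {x : Sp n} {r : ℝ} (h : ∀ d : ℝ, 0 < d → d ≤ 1 → x ∈ lev ψ (r + d)) :
    x ∈ lev ψ r := by
  refine EReal.le_of_forall_lt_iff_le.1 fun t ht => ?_
  have hrt : r < t := by exact_mod_cast ht
  exact lev_mono ψ (by linarith [min_le_left (t - r) 1])
    (h (min (t - r) 1) (lt_min (sub_pos.2 hrt) one_pos) (min_le_right _ _))

lemma exists_le_of_isBounded_lev (hψ : LowerSemicontinuous ψ) (hbot : ∀ x, ψ x ≠ ⊥) {r : ℝ}
    (hne : (lev ψ r).Nonempty) (hb : Bornology.IsBounded (lev ψ r)) :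
    ∃ m : ℝ, ∀ x, (m : EReal) ≤ ψ x := by
  obtain ⟨p, hp, hmin⟩ := LowerSemicontinuousOn.exists_isMinOn hne (isCompact_lev hψ hb)
    (hψ.lowerSemicontinuousOn _)
  refine ⟨(ψ p).toReal, fun x => ?_⟩
  rw [EReal.coe_toReal (mem_edom_of_le hp) (hbot p)]
  by_cases hx : x ∈ lev ψ r
  · exact hmin hx
  · exact (show ψ p ≤ (r : EReal) from hp).trans (not_le.1 hx).le

lemma ProperConvexLsc.isBounded_lev (hψ : ProperConvexLsc ψ) {p : Sp n} {r₀ : ℝ}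
    (hp : ψ p < (r₀ : EReal)) (hb : Bornology.IsBounded (lev ψ r₀)) (r : ℝ) :
    Bornology.IsBounded (lev ψ r) := by
  obtain ⟨R, hR0, hR⟩ := hb.subset_closedBall_lt 0 p
  have hpdom : p ∈ edom ψ := mem_edom_of_le hp.le
  set m := (ψ p).toReal
  have hm : m < r₀ := by
    rw [← hψ.coe_toReal hpdom] at hp
    exact_mod_cast hp
  refine (Metric.isBounded_closedBall (x := p) (r := max (R + 1)
    ((R + 1) * (r - m) / (r₀ - m)))).subset fun x hx => ?_
  rw [mem_closedBall_iff_norm, le_max_iff]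
  refine or_iff_not_imp_left.2 fun hfar => ?_
  rw [not_le] at hfar
  have hpos : 0 < ‖x - p‖ := by linarith
  -- The point of the segment `[p, x]` at distance `R + 1` from `p` lies outside `lev ψ r₀`.
  set s := (R + 1) / ‖x - p‖
  have hs0 : 0 < s := by positivity
  have hs1 : s ≤ 1 := (div_le_one hpos).2 hfar.le
  have hsx : s * ‖x - p‖ = R + 1 := div_mul_cancel₀ _ hpos.ne'
  have hdom := hψ.convexOn_toReal.1 hpdom (mem_edom_of_le hx) (sub_nonneg.2 hs1) hs0.le (by ring)
  have hconv : (ψ ((1 - s) • p + s • x)).toReal ≤ (1 - s) * m + s * (ψ x).toReal :=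
    hψ.convexOn_toReal.2 hpdom (mem_edom_of_le hx) (sub_nonneg.2 hs1) hs0.le (by ring)
  have hout : r₀ < (ψ ((1 - s) • p + s • x)).toReal := by
    by_contra! hle
    have hin := hR (hψ.le_of_toReal_le hdom hle)
    rw [mem_closedBall_iff_norm, show (1 - s) • p + s • x - p = s • (x - p) by module, norm_smul,
      Real.norm_of_nonneg hs0.le, hsx] at hin
    linarith
  have hxr : s * (ψ x).toReal ≤ s * r := by gcongr; exact hψ.toReal_le hx
  rw [le_div_iff₀ (by linarith)]
  calc ‖x - p‖ * (r₀ - m) ≤ ‖x - p‖ * (s * (r - m)) := by gcongr; linarith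
    _ = (R + 1) * (r - m) := by rw [← hsx]; ring

lemma exists_pos_forall_mem_lev_near (hψ : LowerSemicontinuous ψ) (hψ' : LowerSemicontinuous ψ')
    (r r' : ℝ) (hb : Bornology.IsBounded (lev ψ (r + 1))) {η : ℝ} (hη : 0 < η) :
    ∃ δ : ℝ, 0 < δ ∧ ∀ x ∈ lev ψ (r + δ), x ∈ lev ψ' (r' + δ) →
      ∃ s ∈ lev ψ r, s ∈ lev ψ' r' ∧ ‖s - x‖ < η := by
  -- The sets of approximate solutions are compact and decrease to the set of exact solutions.
  let V : Set.Ioc (0 : ℝ) 1 → Set (Sp n) := fun d => lev ψ (r + d) ∩ lev ψ' (r' + d)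
  have hVmono : Monotone V := fun d d' (hd : (d : ℝ) ≤ d') =>
    Set.inter_subset_inter (lev_mono ψ (by gcongr)) (lev_mono ψ' (by gcongr))
  have hVclosed : ∀ d, IsClosed (V d) := fun d => (isClosed_lev hψ _).inter (isClosed_lev hψ' _)
  have hVcompact : ∀ d, IsCompact (V d) := fun d => Metric.isCompact_of_isClosed_isBounded
    (hVclosed d) (hb.subset (Set.inter_subset_left.trans (lev_mono ψ (by linarith [d.2.2]))))
  have hVinter : ⋂ d, V d ⊆ lev ψ r ∩ lev ψ' r' := fun x hx => by
    have hmem := Set.mem_iInter.1 hx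
    exact ⟨mem_lev_of_forall_pos fun d hd hd1 => (hmem ⟨d, hd, hd1⟩).1,
      mem_lev_of_forall_pos fun d hd hd1 => (hmem ⟨d, hd, hd1⟩).2⟩
  have : Nonempty (Set.Ioc (0 : ℝ) 1) := ⟨⟨1, one_pos, le_rfl⟩⟩
  obtain ⟨d, hd⟩ := exists_subset_nhds_of_isCompact' hVmono.directed_ge hVcompact hVclosed
    (U := Metric.thickening η (lev ψ r ∩ lev ψ' r'))
    fun x hx => Metric.isOpen_thickening.mem_nhds (Metric.self_subset_thickening hη _ (hVinter hx))
  refine ⟨d, d.2.1, fun x hx hx' => ?_⟩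
  obtain ⟨s, hs, hsx⟩ := Metric.mem_thickening_iff.1 (hd ⟨hx, hx'⟩)
  exact ⟨s, hs.1, hs.2, by rwa [← dist_eq_norm, dist_comm]⟩

lemma bddAbove_norm_image {E F : Type*} [PseudoMetricSpace E] [ProperSpace E]
    [SeminormedAddCommGroup F] {G : E → F} (hG : Continuous G) {s : Set E}
    (hs : Bornology.IsBounded s) : BddAbove ((fun x => ‖G x‖) '' s) :=
  (hs.isCompact_closure.bddAbove_image hG.norm.continuousOn).mono (Set.image_mono subset_closure)

end LevelSets

namespace Problem

variable {P : Problem n}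

variable (P) in
/-- The convex composite structure of the problem: `f` and `g` are sums of a smooth convex and a
proper closed convex function, `f₂` is Lipschitz on its domain, and `f^*, g^* > -∞`. -/
structure ConvexComposite : Prop where
  f₁_convex : ConvexOn ℝ Set.univ P.f₁
  f₁_contDiff : ContDiff ℝ 1 P.f₁
  f₁_lip : LipschitzWith P.Lf₁ (gradient P.f₁)
  g₁_convex : ConvexOn ℝ Set.univ P.g₁
  g₁_contDiff : ContDiff ℝ 1 P.g₁
  g₁_lip : LipschitzWith P.Lg₁ (gradient P.g₁)
  f₂_pcl : ProperConvexLsc P.f₂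
  g₂_pcl : ProperConvexLsc P.g₂
  f₂_lip : LipschitzOnWith P.lf₂ (fun x => (P.f₂ x).toReal) (edom P.f₂)
  fStar_ne_bot : P.fStar ≠ ⊥
  gStar_ne_bot : P.gStar ≠ ⊥

lemma Basic.convexComposite (hP : P.Basic) : P.ConvexComposite := { hP with }

namespace ConvexComposite

variable (hP : P.ConvexComposite)
include hP

lemma f_pcl : ProperConvexLsc P.f :=
  (ProperConvexLsc.coe_real hP.f₁_convex hP.f₁_contDiff.continuous).add hP.f₂_pcl <|
    hP.f₂_pcl.nonempty_dom.mono fun _ hx => ⟨EReal.coe_ne_top _, hx⟩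

lemma g_pcl : ProperConvexLsc P.g :=
  (ProperConvexLsc.coe_real hP.g₁_convex hP.g₁_contDiff.continuous).add hP.g₂_pcl <|
    hP.g₂_pcl.nonempty_dom.mono fun _ hx => ⟨EReal.coe_ne_top _, hx⟩

lemma mem_edom_f {x : Sp n} : x ∈ edom P.f ↔ x ∈ edom P.f₂ :=
  (EReal.add_ne_top_iff_ne_top₂ (EReal.coe_ne_bot _) (hP.f₂_pcl.ne_bot x)).trans
    (and_iff_right (EReal.coe_ne_top _))

lemma mem_edom_g {x : Sp n} : x ∈ edom P.g ↔ x ∈ edom P.g₂ :=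
  (EReal.add_ne_top_iff_ne_top₂ (EReal.coe_ne_bot _) (hP.g₂_pcl.ne_bot x)).trans
    (and_iff_right (EReal.coe_ne_top _))

lemma toReal_f {x : Sp n} (hx : x ∈ edom P.f) : (P.f x).toReal = P.f₁ x + (P.f₂ x).toReal :=
  EReal.toReal_add (EReal.coe_ne_top _) (EReal.coe_ne_bot _) (hP.mem_edom_f.1 hx)
    (hP.f₂_pcl.ne_bot x)

lemma toReal_g {x : Sp n} (hx : x ∈ edom P.g) : (P.g x).toReal = P.g₁ x + (P.g₂ x).toReal :=
  EReal.toReal_add (EReal.coe_ne_top _) (EReal.coe_ne_bot _) (hP.mem_edom_g.1 hx)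
    (hP.g₂_pcl.ne_bot x)

lemma coe_fStar (hX : P.X.Nonempty) : ((P.fStar.toReal : ℝ) : EReal) = P.fStar := by
  obtain ⟨x, hx⟩ := hX
  exact EReal.coe_toReal (ne_top_of_le_ne_top hx.1 (iInf₂_le x hx)) hP.fStar_ne_bot

lemma coe_gStar (hX : P.X.Nonempty) : ((P.gStar.toReal : ℝ) : EReal) = P.gStar := by
  obtain ⟨x, hx⟩ := hX
  exact EReal.coe_toReal (ne_top_of_le_ne_top hx.2 (iInf₂_le x hx)) hP.gStar_ne_bot

lemma fStar_le {x : Sp n} (hx : x ∈ P.X) : P.fStar.toReal ≤ (P.f x).toReal :=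
  EReal.toReal_le_toReal (iInf₂_le x hx) hP.fStar_ne_bot hx.1

lemma gStar_le {x : Sp n} (hx : x ∈ P.X) : P.gStar.toReal ≤ (P.g x).toReal :=
  EReal.toReal_le_toReal (iInf₂_le x hx) hP.gStar_ne_bot hx.2

lemma exists_abs_f_le {s : Set (Sp n)} (hs : Bornology.IsBounded s) :
    ∃ U : ℝ, ∀ x ∈ s, x ∈ edom P.f → |(P.f x).toReal| ≤ U := by
  obtain ⟨w, hw⟩ := hP.f₂_pcl.nonempty_dom
  obtain ⟨K, hK⟩ := bddAbove_norm_image hP.f₁_contDiff.continuous hs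
  obtain ⟨R, hR⟩ := hs.subset_closedBall w
  refine ⟨K + (|(P.f₂ w).toReal| + P.lf₂ * R), fun x hx hxf => ?_⟩
  have hf₁ : |P.f₁ x| ≤ K := hK ⟨x, hx, rfl⟩
  have hf₂ : |(P.f₂ x).toReal - (P.f₂ w).toReal| ≤ P.lf₂ * R :=
    (hP.f₂_lip.dist_le_mul x (hP.mem_edom_f.1 hxf) w hw).trans (by gcongr; exact hR hx)
  calc |(P.f x).toReal| ≤ |P.f₁ x| + |(P.f₂ x).toReal| := by
        rw [hP.toReal_f hxf]; exact abs_add_le _ _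
    _ ≤ |P.f₁ x| + (|(P.f₂ w).toReal| + |(P.f₂ x).toReal - (P.f₂ w).toReal|) := by
        gcongr
        simpa using abs_add_le (P.f₂ w).toReal ((P.f₂ x).toReal - (P.f₂ w).toReal)
    _ ≤ K + (|(P.f₂ w).toReal| + P.lf₂ * R) := by gcongr

lemma f_sub_le {s : Set (Sp n)} (hs : Bornology.IsBounded s) {x y : Sp n} (hx : x ∈ s)
    (hxf : x ∈ edom P.f) (hyf : y ∈ edom P.f) :
    (P.f x).toReal - (P.f y).toReal ≤
      (sSup ((fun x => ‖gradient P.f₁ x‖) '' s) + P.lf₂) * ‖x - y‖ := by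
  have hsupport := add_inner_gradient_le_of_convexOn hP.f₁_convex
    (hP.f₁_contDiff.differentiable one_ne_zero) x y
  have hgrad : ‖gradient P.f₁ x‖ ≤ sSup ((fun x => ‖gradient P.f₁ x‖) '' s) :=
    le_csSup (bddAbove_norm_image hP.f₁_lip.continuous hs) ⟨x, hx, rfl⟩
  have hinner : inner ℝ (gradient P.f₁ x) (x - y) ≤
      sSup ((fun x => ‖gradient P.f₁ x‖) '' s) * ‖x - y‖ :=
    (real_inner_le_norm _ _).trans (by gcongr)
  have hf₂ := (le_abs_self _).trans
    (hP.f₂_lip.dist_le_mul x (hP.mem_edom_f.1 hxf) y (hP.mem_edom_f.1 hyf))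
  rw [dist_eq_norm] at hf₂
  rw [← neg_sub x y, inner_neg_right] at hsupport
  rw [hP.toReal_f hxf, hP.toReal_f hyf]
  linarith

omit hP in
lemma gStar_le_gBar (c : ℝ) : P.gStar ≤ P.gBar c := by
  refine le_iInf₂ fun y hy => ?_
  have hyf : y ∈ edom P.f := mem_edom_of_le (EReal.sub_nonpos.1 hy)
  by_cases hyg : y ∈ edom P.g
  · exact iInf₂_le y ⟨hyf, hyg⟩
  · rw [show P.g y = ⊤ from not_not.1 hyg]
    exact le_top

omit hP in
lemma gBar_le {c : ℝ} {x : Sp n} (hx : P.f x ≤ (c : EReal)) : P.gBar c ≤ P.g x :=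
  iInf₂_le x (EReal.sub_nonpos.2 hx)

lemma coe_gBar {c : ℝ} {x : Sp n} (hx : x ∈ edom P.g) (hxc : P.f x ≤ (c : EReal)) :
    (((P.gBar c).toReal : ℝ) : EReal) = P.gBar c :=
  EReal.coe_toReal (ne_top_of_le_ne_top hx (gBar_le hxc))
    (ne_bot_of_le_ne_bot hP.gStar_ne_bot (gStar_le_gBar c))

lemma exists_solution (hb : ∀ r, Bornology.IsBounded (lev P.g r)) {c : ℝ} {x : Sp n}
    (hx : x ∈ edom P.g) (hxc : P.f x ≤ (c : EReal)) :
    ∃ s ∈ lev P.g (P.gBar c).toReal, s ∈ lev P.f c := by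
  obtain ⟨δ, hδ, hnear⟩ := exists_pos_forall_mem_lev_near hP.g_pcl.lsc hP.f_pcl.lsc
    (P.gBar c).toReal c (hb _) one_pos
  have hlt : P.gBar c < (((P.gBar c).toReal + δ : ℝ) : EReal) := by
    rw [← hP.coe_gBar hx hxc, EReal.toReal_coe]
    exact_mod_cast lt_add_of_pos_right _ hδ
  simp only [gBar, iInf_lt_iff] at hlt
  obtain ⟨y, hy, hyg⟩ := hlt
  obtain ⟨s, hs, hs', -⟩ :=
    hnear y hyg.le (lev_mono P.f (le_add_of_nonneg_right hδ.le) (EReal.sub_nonpos.1 hy))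
  exact ⟨s, hs, hs'⟩

end ConvexComposite

end Problem

/-! ### Nearly optimal points of the Lagrangian -/

namespace Setup

/-- The assumptions on the data under which the quantities of `Setup` satisfy their basic
relations. -/
structure Regular (S : Setup n) (Γ : ℝ) : Prop where
  composite : S.P.ConvexComposite
  adm : S.Admissible Γ
  one_lt : 1 < S.γ₁
  one_le : 1 ≤ S.γ₂
  Δ₁_pos : 0 < S.Δ₁
  ε_pos : 0 < S.ε
  ε_le : S.ε ≤ 1 / 2
  ε_le_Lmin : S.ε ≤ S.Lmin

/-- The assumptions on the data in the regime of small accuracies, in which all results of the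
inner method stay in the level set `{g ≤ D_{L_z}}`. -/
structure Standing (S : Setup n) (Γ : ℝ) : Prop extends S.Regular Γ where
  small : (2 * S.Dz + 1 / S.Δ₁ ^ 2) * S.ε ≤ 1 / 4

section Definitions

variable (S : Setup n)

/-- The regularized Lagrangian `g + (ε / 2) ‖· - x⁰‖² + z f`, as a real function. It is meant for
arguments in `dom g` and, unless `z = 0`, in `X`. -/
def lagrangian (z : ℝ) (x : Sp n) : ℝ :=
  (S.P.g x).toReal + S.ε / 2 * ‖x - S.x0‖ ^ 2 + z * (S.P.f x).toReal

/-- The smooth part of the regularized Lagrangian. -/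
def smoothPart (z : ℝ) (x : Sp n) : ℝ :=
  S.P.g₁ x + S.ε / 2 * ‖x - S.x0‖ ^ 2 + z * S.P.f₁ x

/-- The nonsmooth part of the regularized Lagrangian. -/
def nonsmoothPart (z : ℝ) (x : Sp n) : EReal := S.P.g₂ x + (z : EReal) * S.P.f₂ x

/-- `x` nearly minimizes the regularized Lagrangian with multiplier `z`. The term
`(ε / 2) ‖u - x‖²` records the quadratic growth that comes with strong convexity. -/
structure Near (z : ℝ) (x : Sp n) : Prop where
  mem : x ∈ edom S.P.g
  mem_X : 0 < z → x ∈ S.P.X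
  le : ∀ u ∈ S.P.X,
    S.lagrangian z x + S.ε / 2 * ‖u - x‖ ^ 2 ≤ S.lagrangian z u + S.ε₁ * ‖u - x‖

lemma Dg_nonneg : 0 ≤ S.Dg := Metric.diam_nonneg

lemma Bf_nonneg : 0 ≤ S.Bf :=
  add_nonneg (Real.sSup_nonneg (by rintro _ ⟨x, -, rfl⟩; exact norm_nonneg _)) S.P.lf₂.2

lemma Bf_le_D : (1 + S.Dg * (1 + S.Dg)) * S.Bf ≤ S.D := by
  have := S.Dg_nonneg
  exact mul_le_mul_of_nonneg_left (le_max_left _ _) (by positivity)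

lemma nonsmoothPart_zero : S.nonsmoothPart 0 = S.P.g₂ := by
  funext x
  simp [nonsmoothPart]

end Definitions

namespace Regular

variable {S : Setup n} {Γ z : ℝ} {x y : Sp n} (H : S.Regular Γ)
include H

lemma f_x0_lt : S.P.f S.x0 < ((S.c - S.Δ₁ : ℝ) : EReal) := by
  have hreg := H.adm.regular
  rw [Problem.fc] at hreg
  by_cases htop : S.P.f S.x0 = ⊤
  · rw [htop, EReal.top_sub_coe] at hreg
    exact absurd hreg not_top_lt
  · rw [← H.composite.f_pcl.coe_toReal htop, ← EReal.coe_sub, EReal.coe_lt_coe_iff] at hreg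
    rw [← H.composite.f_pcl.coe_toReal htop, EReal.coe_lt_coe_iff]
    linarith

lemma x0_mem : S.x0 ∈ S.P.X := ⟨ne_top_of_lt H.f_x0_lt, mem_edom_of_le H.adm.x0_lev⟩

lemma X_nonempty : S.P.X.Nonempty := ⟨_, H.x0_mem⟩

lemma toReal_f_x0_lt : (S.P.f S.x0).toReal < S.c - S.Δ₁ := by
  have := H.f_x0_lt
  rwa [← H.composite.f_pcl.coe_toReal H.x0_mem.1, EReal.coe_lt_coe_iff] at this

lemma f_x0_le_c : S.P.f S.x0 ≤ (S.c : EReal) :=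
  H.f_x0_lt.le.trans (by exact_mod_cast sub_le_self _ H.Δ₁_pos.le)

lemma toReal_f_x0_le : (S.P.f S.x0).toReal ≤ S.P.fStar.toReal + S.ε := by
  have := H.adm.x0_opt
  rwa [← H.composite.f_pcl.coe_toReal H.x0_mem.1, ← H.composite.coe_fStar H.X_nonempty,
    ← EReal.coe_add, EReal.coe_le_coe_iff] at this

lemma toReal_g_x0_le : (S.P.g S.x0).toReal ≤ Γ := H.composite.g_pcl.toReal_le H.adm.x0_lev

lemma g_xg_le : S.P.g S.xg ≤ ((S.P.gStar.toReal + S.ε : ℝ) : EReal) := by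
  rw [EReal.coe_add, H.composite.coe_gStar H.X_nonempty]
  exact H.adm.xg_opt

lemma xg_mem : S.xg ∈ S.P.X := ⟨H.adm.xg_dom, mem_edom_of_le H.g_xg_le⟩

lemma toReal_g_xg_le : (S.P.g S.xg).toReal ≤ S.P.gStar.toReal + S.ε :=
  H.composite.g_pcl.toReal_le H.g_xg_le

lemma Dz_mul : S.Dz * S.Δ₁ = (S.P.g S.x0).toReal - (S.P.g S.xg).toReal + 1 :=
  div_mul_cancel₀ _ H.Δ₁_pos.ne'

lemma half_le_Dz_mul : 1 / 2 ≤ S.Dz * S.Δ₁ := by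
  rw [H.Dz_mul]
  linarith [H.composite.gStar_le H.x0_mem, H.toReal_g_xg_le, H.ε_le]

lemma Dz_pos : 0 < S.Dz :=
  pos_of_mul_pos_left (one_half_pos.trans_le H.half_le_Dz_mul) H.Δ₁_pos.le

lemma one_le_Lphi : 1 ≤ S.Lphi := by
  have := H.Dz_pos
  exact le_add_of_nonneg_left (by positivity)

lemma toReal_f_x0_add_Δ₁_le : (S.P.f S.x0).toReal + S.Δ₁ ≤ S.u₀ := by
  linarith [H.toReal_f_x0_lt, H.adm.c_le]

lemma toReal_g_x0_add_one_le_D₀ : (S.P.g S.x0).toReal + 1 ≤ S.D₀ := by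
  have hu₀ : S.P.fStar.toReal + S.Δ₁ ≤ |S.u₀| := by
    linarith [H.composite.fStar_le H.x0_mem, H.toReal_f_x0_add_Δ₁_le, le_abs_self S.u₀]
  have hDz_mul := mul_le_mul_of_nonneg_left hu₀ H.Dz_pos.le
  rw [D₀]
  linarith [H.half_le_Dz_mul, le_max_right 0 (-2 * S.Dz * S.P.fStar.toReal)]

lemma D₀_le_DL : S.D₀ ≤ S.DL := by
  have := H.one_lt
  have := H.one_le_Lphi
  exact le_add_of_nonneg_right (by positivity)

lemma mem_lev_DL (hx : x ∈ edom S.P.g) (h : (S.P.g x).toReal ≤ (S.P.g S.x0).toReal + 1) :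
    x ∈ lev S.P.g S.DL :=
  H.composite.g_pcl.le_of_toReal_le hx (h.trans (H.toReal_g_x0_add_one_le_D₀.trans H.D₀_le_DL))

lemma x0_mem_lev : S.x0 ∈ lev S.P.g S.DL :=
  H.mem_lev_DL H.x0_mem.2 (le_add_of_nonneg_right zero_le_one)

lemma xg_mem_lev : S.xg ∈ lev S.P.g S.DL :=
  H.mem_lev_DL H.xg_mem.2 (by
    linarith [H.toReal_g_xg_le, H.composite.gStar_le H.x0_mem, H.ε_le])

lemma norm_sub_le_Dg (hx : x ∈ lev S.P.g S.DL) (hy : y ∈ lev S.P.g S.DL) : ‖x - y‖ ≤ S.Dg := by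
  rw [← dist_eq_norm]
  exact Metric.dist_le_diam_of_mem H.adm.bdd hx hy

lemma f_sub_le (hx : x ∈ lev S.P.g S.DL) (hxf : x ∈ edom S.P.f) (hyf : y ∈ edom S.P.f) :
    (S.P.f x).toReal - (S.P.f y).toReal ≤ S.Bf * ‖x - y‖ :=
  H.composite.f_sub_le H.adm.bdd hx hxf hyf

lemma Δ₁_le_mul : S.Δ₁ ≤ S.Bf * S.Dg :=
  calc S.Δ₁ ≤ S.u₀ - (S.P.f S.x0).toReal := le_sub_iff_add_le'.2 H.toReal_f_x0_add_Δ₁_le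
    _ ≤ S.Bf * ‖S.xg - S.x0‖ := H.f_sub_le H.xg_mem_lev H.xg_mem.1 H.x0_mem.1
    _ ≤ S.Bf * S.Dg :=
      mul_le_mul_of_nonneg_left (H.norm_sub_le_Dg H.xg_mem_lev H.x0_mem_lev) S.Bf_nonneg

lemma Δ₁_le_D : S.Δ₁ ≤ S.D := by
  have := S.Dg_nonneg
  have := S.Bf_nonneg
  have : 0 ≤ (1 + S.Dg * S.Dg) * S.Bf := by positivity
  linarith [H.Δ₁_le_mul, S.Bf_le_D]

lemma D_pos : 0 < S.D := H.Δ₁_pos.trans_le H.Δ₁_le_D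

lemma ε₁_pos : 0 < S.ε₁ := div_pos (pow_pos H.ε_pos 2) H.D_pos

lemma ε₄_pos : 0 < S.ε₄ := H.ε₁_pos

lemma ε₁_le : S.ε₁ ≤ S.ε ^ 2 / S.Δ₁ :=
  div_le_div_of_nonneg_left (sq_nonneg _) H.Δ₁_pos H.Δ₁_le_D

lemma ε₄_le : S.ε₄ ≤ S.ε ^ 2 / S.Δ₁ := H.ε₁_le

lemma ε₂_nonneg : 0 ≤ S.ε₂ :=
  div_nonneg (mul_nonneg S.Bf_nonneg H.ε_pos.le) H.D_pos.le

lemma ε₂_le : S.ε₂ ≤ S.ε := by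
  have := S.Bf_nonneg
  have := S.Dg_nonneg
  have hBf : S.Bf ≤ S.D := by
    have : 0 ≤ S.Dg * (1 + S.Dg) * S.Bf := by positivity
    linarith [S.Bf_le_D]
  rw [ε₂, div_le_iff₀ H.D_pos, mul_comm]
  exact mul_le_mul_of_nonneg_left hBf H.ε_pos.le

lemma ε₃_mul_le : S.ε₃ * (1 + S.Dg * (1 + S.Dg)) ≤ S.ε := by
  have := S.Dg_nonneg
  have hD : (1 + S.Dg * (1 + S.Dg)) * (2 * S.Dz * S.Bf + 2 * S.Dz * S.Bf ^ 2) ≤ S.D :=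
    mul_le_mul_of_nonneg_left (le_max_right _ _) (by positivity)
  rw [ε₃, div_mul_eq_mul_div, div_le_iff₀ H.D_pos]
  linarith [mul_le_mul_of_nonneg_left hD H.ε_pos.le]

lemma ε₃_nonneg : 0 ≤ S.ε₃ := by
  have := H.ε_pos
  have := H.D_pos
  have := S.Bf_nonneg
  have := H.Dz_pos
  rw [ε₃]
  positivity

lemma nonsmoothPart_pcl (hz : 0 ≤ z) : ProperConvexLsc (S.nonsmoothPart z) := by
  rcases hz.eq_or_lt with rfl | hz
  · rw [nonsmoothPart_zero]
    exact H.composite.g₂_pcl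
  · refine H.composite.g₂_pcl.add (H.composite.f₂_pcl.coe_mul hz) ⟨S.x0, ?_, ?_⟩
    · exact H.composite.mem_edom_g.1 H.x0_mem.2
    · rw [H.composite.f₂_pcl.edom_coe_mul hz]
      exact H.composite.mem_edom_f.1 H.x0_mem.1

lemma edom_nonsmoothPart (hz : 0 < z) : edom (S.nonsmoothPart z) = S.P.X := by
  have hadd := H.composite.g₂_pcl.edom_add (H.composite.f₂_pcl.coe_mul hz)
  rw [H.composite.f₂_pcl.edom_coe_mul hz] at hadd
  refine hadd.trans (Set.ext fun x => ?_)
  rw [Set.mem_inter_iff, ← H.composite.mem_edom_f, ← H.composite.mem_edom_g, and_comm]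
  rfl

lemma edom_nonsmoothPart_zero : edom (S.nonsmoothPart 0) = edom S.P.g := by
  ext x
  rw [nonsmoothPart_zero, H.composite.mem_edom_g]

lemma X_subset_edom_nonsmoothPart (hz : 0 ≤ z) : S.P.X ⊆ edom (S.nonsmoothPart z) := by
  rcases hz.eq_or_lt with rfl | hz
  · rw [H.edom_nonsmoothPart_zero]
    exact Set.inter_subset_right
  · rw [H.edom_nonsmoothPart hz]

lemma mem_of_mem_edom_nonsmoothPart (hz : 0 ≤ z) (hx : x ∈ edom (S.nonsmoothPart z)) :
    x ∈ edom S.P.g ∧ (0 < z → x ∈ S.P.X) := by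
  rcases hz.eq_or_lt with rfl | hz
  · rw [H.edom_nonsmoothPart_zero] at hx
    exact ⟨hx, fun h => absurd h (lt_irrefl _)⟩
  · rw [H.edom_nonsmoothPart hz] at hx
    exact ⟨hx.2, fun _ => hx⟩

lemma objective_eq_lagrangian (hz : 0 ≤ z) (hx : x ∈ edom (S.nonsmoothPart z)) :
    objective (S.smoothPart z) (S.nonsmoothPart z) x = S.lagrangian z x := by
  rw [objective, smoothPart, lagrangian]
  rcases hz.eq_or_lt with rfl | hz
  · rw [H.edom_nonsmoothPart_zero] at hx
    rw [nonsmoothPart_zero, H.composite.toReal_g hx]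
    ring
  · rw [H.edom_nonsmoothPart hz] at hx
    have hzf₂ := H.composite.f₂_pcl.coe_mul hz
    have hxzf₂ : x ∈ edom fun x => (z : EReal) * S.P.f₂ x := by
      rw [H.composite.f₂_pcl.edom_coe_mul hz]
      exact H.composite.mem_edom_f.1 hx.1
    rw [nonsmoothPart, EReal.toReal_add (H.composite.mem_edom_g.1 hx.2)
      (H.composite.g₂_pcl.ne_bot x) hxzf₂ (hzf₂.ne_bot x), EReal.toReal_mul,
      EReal.toReal_coe, H.composite.toReal_g hx.2, H.composite.toReal_f hx.1]
    ring

lemma smoothPart_smooth (hz : 0 ≤ z) (hz' : z ≤ 2 * S.Dz) :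
    StronglyConvexSmooth (S.smoothPart z) S.ε S.Lphi := by
  have hg₁ := StronglyConvexSmooth.of_convexOn H.composite.g₁_convex
    (H.composite.g₁_contDiff.differentiable one_ne_zero) H.composite.g₁_lip
  have hf₁ := StronglyConvexSmooth.of_convexOn H.composite.f₁_convex
    (H.composite.f₁_contDiff.differentiable one_ne_zero) H.composite.f₁_lip
  have hsum := (hg₁.add (.half_sq_dist S.x0 H.ε_pos.le)).add (hf₁.const_mul hz)
  rw [zero_add, mul_zero, add_zero] at hsum
  have hLf₁ : z * (S.P.Lf₁ : ℝ) ≤ 2 * S.Dz * S.P.Lf₁ := by gcongr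
  refine hsum.mono ?_
  rw [Lphi]
  linarith [H.ε_le]

lemma near_of_call (hz : 0 ≤ z) (hz' : z ≤ 2 * S.Dz) {N : ℕ} (h : S.Call z y x N) :
    S.Near z x := by
  have hφ₂ := H.nonsmoothPart_pcl hz
  have hstat : NearStationary (S.smoothPart z) (S.nonsmoothPart z) S.ε₁ x := h.nearStationary
  have hx := hstat.mem_edom hφ₂ H.ε₁_pos.le
  obtain ⟨hmem, hmem_X⟩ := H.mem_of_mem_edom_nonsmoothPart hz hx
  refine ⟨hmem, hmem_X, fun u hu => ?_⟩
  have hu' := H.X_subset_edom_nonsmoothPart hz hu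
  rw [← H.objective_eq_lagrangian hz hx, ← H.objective_eq_lagrangian hz hu']
  exact hstat.objective_add_sq_le (H.smoothPart_smooth hz hz') hφ₂ H.ε₁_pos.le hu'

lemma le_lagrangian {m : ℝ} (hm : ∀ x, (m : EReal) ≤ S.P.g x) (hz : 0 ≤ z) (hz' : z ≤ 2 * S.Dz)
    (hx : x ∈ edom S.P.g) (hxX : 0 < z → x ∈ S.P.X) :
    m - 2 * S.Dz * |S.P.fStar.toReal| + S.ε / 2 * ‖x - S.x0‖ ^ 2 ≤ S.lagrangian z x := by
  have hgx : m ≤ (S.P.g x).toReal := by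
    rw [← EReal.coe_le_coe_iff, H.composite.g_pcl.coe_toReal hx]
    exact hm x
  have hfx : -(2 * S.Dz * |S.P.fStar.toReal|) ≤ z * (S.P.f x).toReal :=
    calc -(2 * S.Dz * |S.P.fStar.toReal|) ≤ -(z * |S.P.fStar.toReal|) := by gcongr
      _ = z * -|S.P.fStar.toReal| := (mul_neg _ _).symm
      _ ≤ z * (S.P.f x).toReal := by
        rcases hz.eq_or_lt with rfl | hz0
        · simp
        · exact mul_le_mul_of_nonneg_left
            ((neg_abs_le _).trans (H.composite.fStar_le (hxX hz0))) hz
  rw [lagrangian]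
  linarith

lemma lagrangian_x0_le (hz : 0 ≤ z) (hz' : z ≤ 2 * S.Dz) :
    S.lagrangian z S.x0 ≤ Γ + 2 * S.Dz * (|S.P.fStar.toReal| + 1) := by
  have hf : (S.P.f S.x0).toReal ≤ |S.P.fStar.toReal| + 1 := by
    linarith [H.toReal_f_x0_le, le_abs_self S.P.fStar.toReal, H.ε_le]
  have hzf : z * (S.P.f S.x0).toReal ≤ 2 * S.Dz * (|S.P.fStar.toReal| + 1) :=
    calc z * (S.P.f S.x0).toReal ≤ z * (|S.P.fStar.toReal| + 1) := by gcongr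
      _ ≤ 2 * S.Dz * (|S.P.fStar.toReal| + 1) := by gcongr
  rw [lagrangian, sub_self, norm_zero]
  linarith [H.toReal_g_x0_le]

lemma apgData {m Lbar : ℝ} (hm : ∀ x, (m : EReal) ≤ S.P.g x) (hz : 0 ≤ z) (hz' : z ≤ 2 * S.Dz)
    (hLmin : S.Lmin ≤ Lbar) (hLphi : S.γ₁ * S.Lphi ≤ Lbar) :
    APGData (S.smoothPart z) (S.nonsmoothPart z) S.γ₁ S.γ₂ S.Lmin S.ε S.Lphi Lbar
      (m - 2 * S.Dz * |S.P.fStar.toReal|) S.x0 where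
  smooth := H.smoothPart_smooth hz hz'
  pcl := H.nonsmoothPart_pcl hz
  one_lt := H.one_lt
  one_le := H.one_le
  μ_pos := H.ε_pos
  μ_le := H.ε_le_Lmin
  Lmin_le := hLmin
  Λ_nonneg := zero_le_one.trans H.one_le_Lphi
  Λ_le := hLphi
  low x hx := by
    obtain ⟨hxg, hxX⟩ := H.mem_of_mem_edom_nonsmoothPart hz hx
    rw [H.objective_eq_lagrangian hz hx]
    exact H.le_lagrangian hm hz hz' hxg hxX

lemma call {m Lbar : ℝ} (hm : ∀ x, (m : EReal) ≤ S.P.g x) (hz : 0 ≤ z) (hz' : z ≤ 2 * S.Dz)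
    (hLmin : S.Lmin ≤ Lbar) (hLphi : S.γ₁ * S.Lphi ≤ Lbar) (hy : y ∈ lev S.P.g S.DL) (j : ℕ)
    (hj : (1 - √(S.ε / Lbar)) ^ (j + 1) *
      (32 * (Γ - m + 4 * S.Dz * (|S.P.fStar.toReal| + 1) + Lbar / 2 * S.Dg ^ 2) *
        Lbar ^ 2 / S.Lmin) ≤ S.ε₁ ^ 2) :
    (∃ x N, S.Call z y x N) ∧ ∀ x N, S.Call z y x N →
      (N : ℝ) ≤ (j + 2) * passQueries S.γ₁ (Lbar / S.Lmin) := by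
  have hLmin0 : 0 < S.Lmin := H.ε_pos.trans_le H.ε_le_Lmin
  have hLbar : 0 < Lbar := hLmin0.trans_le hLmin
  have hx0 := H.X_subset_edom_nonsmoothPart hz H.x0_mem
  refine (H.apgData hm hz hz' hLmin hLphi).run hx0 H.ε₁_pos.le j (le_trans ?_ hj)
  have hθ : 0 ≤ 1 - √(S.ε / Lbar) :=
    sub_nonneg.2 (Real.sqrt_le_one.2 ((div_le_one hLbar).2 (H.ε_le_Lmin.trans hLmin)))
  have hdist : Lbar / 2 * ‖S.x0 - y‖ ^ 2 ≤ Lbar / 2 * S.Dg ^ 2 := by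
    have := H.norm_sub_le_Dg H.x0_mem_lev hy
    gcongr
  have hlag := H.lagrangian_x0_le hz hz'
  rw [H.objective_eq_lagrangian hz hx0]
  have := H.Dz_pos
  gcongr
  linarith

lemma nearFeasible_iff : S.NearFeasible x ↔ x ∈ edom S.P.f ∧ (S.P.f x).toReal - S.c ≤ S.ε₂ := by
  rw [NearFeasible, max_le_iff, and_iff_left (by exact_mod_cast H.ε₂_nonneg), Problem.fc]
  by_cases hx : x ∈ edom S.P.f
  · rw [and_iff_right hx, ← H.composite.f_pcl.coe_toReal hx, ← EReal.coe_sub,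
      EReal.coe_le_coe_iff, EReal.toReal_coe]
  · rw [show S.P.f x = ⊤ from not_not.1 hx, EReal.top_sub_coe]
    exact iff_of_false (EReal.coe_lt_top _).not_ge fun h => hx h.1

lemma nearCompl_iff (hx : x ∈ edom S.P.f) :
    S.NearCompl z x ↔ -S.ε₃ ≤ z * ((S.P.f x).toReal - S.c) ∧
      z * ((S.P.f x).toReal - S.c) ≤ S.ε₃ := by
  rw [NearCompl, Problem.fc, ← H.composite.f_pcl.coe_toReal hx, ← EReal.coe_sub, ← EReal.coe_mul,
    EReal.coe_le_coe_iff, EReal.coe_le_coe_iff, EReal.toReal_coe]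

lemma ε₁_mul_sub_le {r : ℝ} (hr : 0 ≤ r) : S.ε₁ * r - S.ε * r ^ 2 ≤ 1 / S.Δ₁ ^ 2 * S.ε := by
  have := H.ε_pos
  have hε₁ : S.ε₁ ≤ S.ε * (1 / S.Δ₁) :=
    calc S.ε₁ ≤ S.ε ^ 2 / S.Δ₁ := H.ε₁_le
      _ = S.ε * (S.ε / S.Δ₁) := by ring
      _ ≤ S.ε * (1 / S.Δ₁) := by
        have := H.Δ₁_pos
        gcongr
        linarith [H.ε_le]
  have hsq : 1 / S.Δ₁ * r - r ^ 2 ≤ (1 / S.Δ₁) ^ 2 := by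
    nlinarith [sq_nonneg (1 / S.Δ₁ - r), sq_nonneg r, sq_nonneg (1 / S.Δ₁)]
  calc S.ε₁ * r - S.ε * r ^ 2 ≤ S.ε * (1 / S.Δ₁) * r - S.ε * r ^ 2 := by gcongr
    _ = S.ε * (1 / S.Δ₁ * r - r ^ 2) := by ring
    _ ≤ S.ε * (1 / S.Δ₁) ^ 2 := by gcongr
    _ = 1 / S.Δ₁ ^ 2 * S.ε := by rw [one_div_pow, mul_comm]

lemma near_le (h : S.Near z x) :
    (S.P.g x).toReal + z * (S.P.f x).toReal ≤
      (S.P.g S.x0).toReal + z * (S.P.f S.x0).toReal + 1 / S.Δ₁ ^ 2 * S.ε := by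
  have hle := h.le S.x0 H.x0_mem
  rw [lagrangian, lagrangian, norm_sub_rev x S.x0, sub_self, norm_zero] at hle
  linarith [H.ε₁_mul_sub_le (norm_nonneg (S.x0 - x))]

lemma coe_toReal_gBar : (((S.P.gBar S.c).toReal : ℝ) : EReal) = S.P.gBar S.c :=
  H.composite.coe_gBar H.x0_mem.2 H.f_x0_le_c

lemma toReal_gBar_le : (S.P.gBar S.c).toReal ≤ (S.P.g S.x0).toReal := by
  rw [← EReal.coe_le_coe_iff, H.coe_toReal_gBar, H.composite.g_pcl.coe_toReal H.x0_mem.2]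
  exact Problem.ConvexComposite.gBar_le H.f_x0_le_c

lemma solution_mem_lev {s : Sp n} (hs : s ∈ lev S.P.g (S.P.gBar S.c).toReal) :
    s ∈ lev S.P.g S.DL :=
  H.mem_lev_DL (mem_edom_of_le hs)
    ((H.composite.g_pcl.toReal_le hs).trans (by linarith [H.toReal_gBar_le]))

lemma g_le_of_near {τ : ℝ} {s : Sp n} (hz : 0 ≤ z) (hx : S.Near z x)
    (hτ : -(z * ((S.P.f x).toReal - S.c)) ≤ τ)
    (hs : s ∈ lev S.P.g (S.P.gBar S.c).toReal) (hs' : s ∈ lev S.P.f S.c) :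
    (S.P.g x).toReal ≤ (S.P.gBar S.c).toReal + τ +
      S.ε / 2 * (‖s - S.x0‖ ^ 2 - ‖x - S.x0‖ ^ 2) + S.ε ^ 2 / S.Δ₁ * ‖s - x‖ := by
  have := H.ε_pos
  have hle := hx.le s ⟨mem_edom_of_le hs', mem_edom_of_le hs⟩
  rw [lagrangian, lagrangian] at hle
  have hgs := H.composite.g_pcl.toReal_le hs
  have hfs : z * (S.P.f s).toReal ≤ z * S.c :=
    mul_le_mul_of_nonneg_left (H.composite.f_pcl.toReal_le hs') hz
  have hε₁ : S.ε₁ * ‖s - x‖ ≤ S.ε ^ 2 / S.Δ₁ * ‖s - x‖ :=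
    mul_le_mul_of_nonneg_right H.ε₁_le (norm_nonneg _)
  have hsx : 0 ≤ S.ε / 2 * ‖s - x‖ ^ 2 := by positivity
  linarith

end Regular

namespace Standing

variable {S : Setup n} {Γ z τ : ℝ} {x s : Sp n} (H : S.Standing Γ)
include H

lemma near_mem_lev (hz : 0 ≤ z) (hz' : z ≤ 2 * S.Dz) (h : S.Near z x) : x ∈ lev S.P.g S.DL := by
  have := H.ε_pos
  have hf : z * ((S.P.f S.x0).toReal - (S.P.f x).toReal) ≤ 2 * S.Dz * S.ε := by
    rcases hz.eq_or_lt with rfl | hz0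
    · have := H.Dz_pos
      rw [zero_mul]
      positivity
    · have hfx := H.composite.fStar_le (h.mem_X hz0)
      calc z * ((S.P.f S.x0).toReal - (S.P.f x).toReal) ≤ z * S.ε := by
            gcongr
            linarith [H.toReal_f_x0_le]
        _ ≤ 2 * S.Dz * S.ε := by gcongr
  refine H.mem_lev_DL h.mem ?_
  linarith [H.near_le h, H.small]

lemma nearFeasible_of_Dz_lt (hz : S.Dz < z) (h : S.Near z x) : S.NearFeasible x := by
  have hDz := H.Dz_pos
  have hε := H.ε_pos
  have hΔ₁ := H.Δ₁_pos
  have hz0 : 0 < z := hDz.trans hz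
  have hX := h.mem_X hz0
  have hfx0 : z * (S.P.f S.x0).toReal ≤ z * (S.c - S.Δ₁) := by
    have := H.toReal_f_x0_lt
    gcongr
  have hΔ₁z : S.Dz * S.Δ₁ ≤ z * S.Δ₁ := by gcongr
  have hDzε : 0 ≤ 2 * S.Dz * S.ε := by positivity
  have hfx : z * ((S.P.f x).toReal - S.c) ≤ 0 := by
    linarith [H.near_le h, H.small, H.composite.gStar_le hX, H.toReal_g_xg_le, H.Dz_mul, H.ε_le]
  exact H.nearFeasible_iff.2 ⟨hX.1, (nonpos_of_mul_nonpos_right hfx hz0).trans H.ε₂_nonneg⟩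

lemma norm_sub_le_of_short {a b : ℝ} {xa xb : Sp n} (ha : 0 < a) (hab : a ≤ b)
    (hb : b ≤ 2 * S.Dz) (hlen : b - a ≤ S.ε₄) (hxa : S.Near a xa) (hxb : S.Near b xb) :
    ‖xa - xb‖ ≤ (S.Bf + 2) * S.ε / S.D := by
  have hXa := hxa.mem_X ha
  have hXb := hxb.mem_X (ha.trans_le hab)
  have hB := S.Bf_nonneg
  set r := ‖xa - xb‖ with hr
  have hf : (b - a) * ((S.P.f xa).toReal - (S.P.f xb).toReal) ≤ S.ε₄ * (S.Bf * r) :=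
    calc (b - a) * ((S.P.f xa).toReal - (S.P.f xb).toReal) ≤ (b - a) * (S.Bf * r) :=
          mul_le_mul_of_nonneg_left
            (H.f_sub_le (H.near_mem_lev ha.le (hab.trans hb) hxa) hXa.1 hXb.1) (sub_nonneg.2 hab)
      _ ≤ S.ε₄ * (S.Bf * r) := by gcongr
  -- Adding the two near-optimality inequalities makes `g` and the prox terms cancel.
  have hsum : S.ε * r ^ 2 ≤ S.ε₄ * (S.Bf * r) + 2 * S.ε₁ * r := by
    have hle := add_le_add (hxa.le xb hXb) (hxb.le xa hXa)
    simp only [lagrangian, norm_sub_rev xb xa, ← hr] at hle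
    linarith
  rcases (norm_nonneg (xa - xb)).eq_or_lt with h0 | h0
  · have := H.D_pos
    have := H.ε_pos
    rw [hr, ← h0]
    positivity
  · refine le_of_mul_le_mul_left ?_ (mul_pos H.ε_pos h0)
    calc S.ε * r * r = S.ε * r ^ 2 := by ring
      _ ≤ S.ε₄ * (S.Bf * r) + 2 * S.ε₁ * r := hsum
      _ = S.ε * r * ((S.Bf + 2) * S.ε / S.D) := by rw [ε₄, ε₁]; ring

lemma neg_mul_le_of_short {a b : ℝ} {xa xb : Sp n} (ha : 0 < a) (hab : a ≤ b) (hb : b ≤ 2 * S.Dz)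
    (hlen : b - a ≤ S.ε₄) (hxa : S.Near a xa) (hxb : S.Near b xb) (hfa : ¬ S.NearFeasible xa) :
    -(b * ((S.P.f xb).toReal - S.c)) ≤ S.ε₃ := by
  have hXa := hxa.mem_X ha
  have hXb := hxb.mem_X (ha.trans_le hab)
  have hb0 : 0 ≤ b := ha.le.trans hab
  have hBf := S.Bf_nonneg
  have hε := H.ε_pos
  have hD := H.D_pos
  have hfxa : S.ε₂ < (S.P.f xa).toReal - S.c :=
    lt_of_not_ge fun hle => hfa (H.nearFeasible_iff.2 ⟨hXa.1, hle⟩)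
  have hf : (S.P.f xa).toReal - (S.P.f xb).toReal ≤ S.Bf * ((S.Bf + 2) * S.ε / S.D) :=
    (H.f_sub_le (H.near_mem_lev ha.le (hab.trans hb) hxa) hXa.1 hXb.1).trans
      (mul_le_mul_of_nonneg_left (H.norm_sub_le_of_short ha hab hb hlen hxa hxb) hBf)
  have hfxb : -((S.P.f xb).toReal - S.c) ≤ (S.Bf + S.Bf ^ 2) * S.ε / S.D :=
    calc -((S.P.f xb).toReal - S.c) ≤ S.Bf * ((S.Bf + 2) * S.ε / S.D) - S.ε₂ := by linarith
      _ = (S.Bf + S.Bf ^ 2) * S.ε / S.D := by rw [ε₂]; ring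
  calc -(b * ((S.P.f xb).toReal - S.c)) = b * -((S.P.f xb).toReal - S.c) := by ring
    _ ≤ b * ((S.Bf + S.Bf ^ 2) * S.ε / S.D) := by gcongr
    _ ≤ 2 * S.Dz * ((S.Bf + S.Bf ^ 2) * S.ε / S.D) := by gcongr
    _ = S.ε₃ := by rw [ε₃]; ring

lemma g_le_gBar_add_mul_of_near (hz : 0 ≤ z) (hz' : z ≤ 2 * S.Dz) (hx : S.Near z x)
    (hτ : -(z * ((S.P.f x).toReal - S.c)) ≤ τ) (hτε : τ ≤ S.ε)
    (hs : s ∈ lev S.P.g (S.P.gBar S.c).toReal) (hs' : s ∈ lev S.P.f S.c) :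
    (S.P.g x).toReal ≤ (S.P.gBar S.c).toReal + (1 + S.Dg ^ 2 + S.Dg / S.Δ₁) * S.ε := by
  have := H.ε_pos
  have := H.Δ₁_pos
  have := S.Dg_nonneg
  have hsDL := H.solution_mem_lev hs
  have hsx0 : S.ε / 2 * (‖s - S.x0‖ ^ 2 - ‖x - S.x0‖ ^ 2) ≤ S.Dg ^ 2 * S.ε :=
    calc S.ε / 2 * (‖s - S.x0‖ ^ 2 - ‖x - S.x0‖ ^ 2) ≤ S.ε / 2 * ‖s - S.x0‖ ^ 2 := by
          gcongr
          exact sub_le_self _ (sq_nonneg _)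
      _ ≤ S.ε / 1 * S.Dg ^ 2 := by
          gcongr
          · exact one_le_two
          · exact H.norm_sub_le_Dg hsDL H.x0_mem_lev
      _ = S.Dg ^ 2 * S.ε := by ring
  have hsx : S.ε ^ 2 / S.Δ₁ * ‖s - x‖ ≤ S.Dg / S.Δ₁ * S.ε :=
    calc S.ε ^ 2 / S.Δ₁ * ‖s - x‖ ≤ S.ε ^ 2 / S.Δ₁ * S.Dg := by
          gcongr
          exact H.norm_sub_le_Dg hsDL (H.near_mem_lev hz hz' hx)
      _ = S.Dg / S.Δ₁ * S.ε * S.ε := by ring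
      _ ≤ S.Dg / S.Δ₁ * S.ε * 1 := by
          gcongr
          linarith [H.ε_le]
      _ = S.Dg / S.Δ₁ * S.ε := mul_one _
  linarith [H.g_le_of_near hz hx hτ hs hs']

lemma g_le_of_near_of_norm_sub_le {η : ℝ} (hz : 0 ≤ z) (hz' : z ≤ 2 * S.Dz) (hx : S.Near z x)
    (hτ : -(z * ((S.P.f x).toReal - S.c)) ≤ τ) (hs : s ∈ lev S.P.g (S.P.gBar S.c).toReal)
    (hs' : s ∈ lev S.P.f S.c) (hη : ‖s - x‖ ≤ η) :
    (S.P.g x).toReal ≤ (S.P.gBar S.c).toReal + τ + (η * S.Dg + S.ε / S.Δ₁ * S.Dg) * S.ε := by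
  have := H.ε_pos
  have := H.Δ₁_pos
  have hη0 : 0 ≤ η := (norm_nonneg _).trans hη
  have hxDL := H.near_mem_lev hz hz' hx
  have hsDL := H.solution_mem_lev hs
  have hdiff : ‖s - S.x0‖ - ‖x - S.x0‖ ≤ η := by
    have := norm_sub_norm_le (s - S.x0) (x - S.x0)
    rw [sub_sub_sub_cancel_right] at this
    exact this.trans hη
  have hsq : S.ε / 2 * (‖s - S.x0‖ ^ 2 - ‖x - S.x0‖ ^ 2) ≤ η * S.Dg * S.ε :=
    calc S.ε / 2 * (‖s - S.x0‖ ^ 2 - ‖x - S.x0‖ ^ 2)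
        = S.ε / 2 * ((‖s - S.x0‖ - ‖x - S.x0‖) * (‖s - S.x0‖ + ‖x - S.x0‖)) := by ring
      _ ≤ S.ε / 2 * (η * (S.Dg + S.Dg)) := by
          gcongr
          · exact H.norm_sub_le_Dg hsDL H.x0_mem_lev
          · exact H.norm_sub_le_Dg hxDL H.x0_mem_lev
      _ = η * S.Dg * S.ε := by ring
  have hsx : S.ε ^ 2 / S.Δ₁ * ‖s - x‖ ≤ S.ε / S.Δ₁ * S.Dg * S.ε :=
    calc S.ε ^ 2 / S.Δ₁ * ‖s - x‖ ≤ S.ε ^ 2 / S.Δ₁ * S.Dg := by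
          gcongr
          exact H.norm_sub_le_Dg hsDL hxDL
      _ = S.ε / S.Δ₁ * S.Dg * S.ε := by ring
  linarith [H.g_le_of_near hz hx hτ hs hs']

lemma isEpsOptimal {δ η : ℝ} (hz : 0 ≤ z) (hz' : z ≤ 2 * S.Dz) (hx : S.Near z x)
    (hf : S.NearFeasible x) (hτ : -(z * ((S.P.f x).toReal - S.c)) ≤ τ)
    (hb : ∀ r, Bornology.IsBounded (lev S.P.g r)) (hη : 0 ≤ η)
    (hτε : τ + (η * S.Dg + S.ε / S.Δ₁ * S.Dg) * S.ε ≤ S.ε)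
    (hδ : (1 + S.Dg ^ 2 + S.Dg / S.Δ₁) * S.ε ≤ δ)
    (hnear : ∀ x ∈ lev S.P.g ((S.P.gBar S.c).toReal + δ), x ∈ lev S.P.f (S.c + δ) →
      ∃ s ∈ lev S.P.g (S.P.gBar S.c).toReal, s ∈ lev S.P.f S.c ∧ ‖s - x‖ < η) :
    S.P.IsEpsOptimal S.c S.ε x := by
  have := H.ε_pos
  have := H.Δ₁_pos
  have := S.Dg_nonneg
  obtain ⟨hxf, hxc⟩ := H.nearFeasible_iff.1 hf
  have hτε' : τ ≤ S.ε := (le_add_of_nonneg_right (by positivity)).trans hτε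
  have hεδ : S.ε ≤ δ := (le_mul_of_one_le_left H.ε_pos.le (by
    rw [add_assoc]; exact le_add_of_nonneg_right (by positivity))).trans hδ
  -- A crude bound for `g x` suffices to find a solution close to `x`.
  obtain ⟨t, ht, ht'⟩ := H.composite.exists_solution hb H.x0_mem.2 H.f_x0_le_c
  have hcrude := H.g_le_gBar_add_mul_of_near hz hz' hx hτ hτε' ht ht'
  obtain ⟨s, hs, hs', hsx⟩ := hnear x
    (H.composite.g_pcl.le_of_toReal_le hx.mem (hcrude.trans (by gcongr)))
    (H.composite.f_pcl.le_of_toReal_le hxf (by linarith [H.ε₂_le]))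
  have hg := H.g_le_of_near_of_norm_sub_le hz hz' hx hτ hs hs' hsx.le
  constructor
  · rw [← H.coe_toReal_gBar, ← H.composite.g_pcl.coe_toReal hx.mem, ← EReal.coe_sub,
      EReal.coe_le_coe_iff]
    linarith
  · exact hf.trans (by exact_mod_cast H.ε₂_le)

end Standing

end Setup

/-! ### Interval search and bisection -/

namespace Setup

/-- The invariant of the state `[a, b]`, `xb` of the bisection: `xb` is nearly optimal for the
multiplier `b` and nearly feasible. The multiplier `a` is `0` or comes from a point that is not
nearly feasible, except that the interval search may return a single multiplier `a = b`. -/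
structure Bracket (S : Setup n) (a b : ℝ) (xb : Sp n) : Prop where
  nonneg : 0 ≤ a
  le : a ≤ b
  le_Dz : b ≤ 2 * S.Dz
  near : S.Near b xb
  feas : S.NearFeasible xb
  left : (a = b ∧ -(b * ((S.P.f xb).toReal - S.c)) ≤ S.ε₃) ∨ a = 0 ∨
    ∃ xa, S.Near a xa ∧ ¬ S.NearFeasible xa

/-- Every call of the inner method by the interval search or the bisection returns a point, and
does so after at most `M` oracle queries. -/
def CallBound (S : Setup n) (M : ℝ) : Prop :=
  ∀ (z : ℝ) (y : Sp n), 0 ≤ z → z ≤ 2 * S.Dz → y ∈ lev S.P.g S.DL →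
    (∃ x N, S.Call z y x N) ∧ ∀ x N, S.Call z y x N → (N : ℝ) ≤ M

/-- Nearly optimal, nearly feasible points with complementarity error at most `τ` are
`ε`-optimal: the condition on the accuracy under which the outer method may stop. -/
def OptBound (S : Setup n) (τ : ℝ) : Prop :=
  ∀ (z : ℝ) (x : Sp n), 0 ≤ z → z ≤ 2 * S.Dz → S.Near z x → S.NearFeasible x →
    -(z * ((S.P.f x).toReal - S.c)) ≤ τ → S.P.IsEpsOptimal S.c S.ε x

namespace Bracket

variable {S : Setup n} {a b : ℝ} {xb : Sp n} (hB : S.Bracket a b xb)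
include hB

lemma nonneg_right : 0 ≤ b := hB.nonneg.trans hB.le

lemma midpoint_nonneg : 0 ≤ (a + b) / 2 := by linarith [hB.nonneg, hB.le]

lemma midpoint_le_Dz : (a + b) / 2 ≤ 2 * S.Dz := by linarith [hB.le, hB.le_Dz]

end Bracket

namespace Standing

variable {S : Setup n} {Γ M τ a b : ℝ} {x xb y : Sp n} {N : ℕ} (H : S.Standing Γ)
include H

lemma bracket_raise (hB : S.Bracket a b xb) (hy : S.Call ((a + b) / 2) x y N)
    (hf : ¬ S.NearFeasible y) : S.Bracket ((a + b) / 2) b xb where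
  nonneg := hB.midpoint_nonneg
  le := by linarith [hB.le]
  le_Dz := hB.le_Dz
  near := hB.near
  feas := hB.feas
  left := .inr (.inr ⟨y, H.near_of_call hB.midpoint_nonneg hB.midpoint_le_Dz hy, hf⟩)

lemma bracket_lower (hB : S.Bracket a b xb) (h : S.ε₄ < b - a)
    (hy : S.Call ((a + b) / 2) x y N) (hf : S.NearFeasible y) :
    S.Bracket a ((a + b) / 2) y where
  nonneg := hB.nonneg
  le := by linarith [hB.le]
  le_Dz := hB.midpoint_le_Dz
  near := H.near_of_call hB.midpoint_nonneg hB.midpoint_le_Dz hy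
  feas := hf
  left := .inr (hB.left.resolve_left fun hab => by linarith [hab.1, H.ε₄_pos])

lemma mem_lev_of_call_midpoint (hB : S.Bracket a b xb) (hy : S.Call ((a + b) / 2) x y N) :
    y ∈ lev S.P.g S.DL :=
  H.near_mem_lev hB.midpoint_nonneg hB.midpoint_le_Dz
    (H.near_of_call hB.midpoint_nonneg hB.midpoint_le_Dz hy)

lemma neg_mul_le_of_bracket (hB : S.Bracket a b xb) (hlen : b - a ≤ S.ε₄) (h₃ : S.ε₃ ≤ τ)
    (h₄ : S.ε₄ * |S.c - S.P.fStar.toReal| ≤ τ) :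
    -(b * ((S.P.f xb).toReal - S.c)) ≤ τ := by
  have hzero : a = 0 → -(b * ((S.P.f xb).toReal - S.c)) ≤ τ := by
    rintro rfl
    rw [sub_zero] at hlen
    have hfxb := H.composite.fStar_le ⟨(H.nearFeasible_iff.1 hB.feas).1, hB.near.mem⟩
    calc -(b * ((S.P.f xb).toReal - S.c)) = b * (S.c - (S.P.f xb).toReal) := by ring
      _ ≤ b * |S.c - S.P.fStar.toReal| :=
        mul_le_mul_of_nonneg_left ((sub_le_sub_left hfxb _).trans (le_abs_self _)) hB.le
      _ ≤ S.ε₄ * |S.c - S.P.fStar.toReal| := by gcongr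
      _ ≤ τ := h₄
  rcases hB.left with ⟨-, h⟩ | ha | ⟨xa, hxa, hfa⟩
  · exact h.trans h₃
  · exact hzero ha
  · rcases hB.nonneg.eq_or_lt with ha | ha
    · exact hzero ha.symm
    · exact (H.neg_mul_le_of_short ha hB.le hB.le_Dz hlen hxa hB.near hfa).trans h₃

lemma exists_bisec (hcall : S.CallBound M) (k : ℕ) (hB : S.Bracket a b xb)
    (hx : x ∈ lev S.P.g S.DL) (hk : b - a ≤ 2 ^ k * S.ε₄) :
    ∃ out z N, S.Bisec a b xb x out z N := by
  induction k generalizing a b xb x with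
  | zero => exact ⟨_, _, _, .done (not_lt.2 (by rwa [pow_zero, one_mul] at hk))⟩
  | succ k ih =>
    by_cases h : S.ε₄ < b - a
    swap
    · exact ⟨_, _, _, .done h⟩
    rw [pow_succ] at hk
    obtain ⟨y, N, hy⟩ := (hcall _ x hB.midpoint_nonneg hB.midpoint_le_Dz hx).1
    have hyDL := H.mem_lev_of_call_midpoint hB hy
    by_cases hf : S.NearFeasible y
    · by_cases hc : S.NearCompl ((a + b) / 2) y
      · exact ⟨_, _, _, .hit h hy hf hc⟩
      · obtain ⟨out, z, N', hr⟩ := ih (H.bracket_lower hB h hy hf) hyDL (by linarith)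
        exact ⟨_, _, _, .lower h hy hf hc hr⟩
    · obtain ⟨out, z, N', hr⟩ := ih (H.bracket_raise hB hy hf) hyDL (by linarith)
      exact ⟨_, _, _, .raise h hy hf hr⟩

lemma isEpsOptimal_of_bisec {z : ℝ} {out : Sp n} (hopt : S.OptBound τ) (h₃ : S.ε₃ ≤ τ)
    (h₄ : S.ε₄ * |S.c - S.P.fStar.toReal| ≤ τ) (hB : S.Bracket a b xb)
    (hr : S.Bisec a b xb x out z N) : S.P.IsEpsOptimal S.c S.ε out := by
  induction hr with
  | done h =>
    exact hopt _ _ hB.nonneg_right hB.le_Dz hB.near hB.feas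
      (H.neg_mul_le_of_bracket hB (not_lt.1 h) h₃ h₄)
  | raise _ hy hf _ ih => exact ih (H.bracket_raise hB hy hf)
  | hit _ hy hf hc =>
    have hcompl := ((H.nearCompl_iff (H.nearFeasible_iff.1 hf).1).1 hc).1
    exact hopt _ _ hB.midpoint_nonneg hB.midpoint_le_Dz
      (H.near_of_call hB.midpoint_nonneg hB.midpoint_le_Dz hy) hf ((neg_le.1 hcompl).trans h₃)
  | lower h hy hf _ _ ih => exact ih (H.bracket_lower hB h hy hf)

lemma queries_bisec_le {z : ℝ} {out : Sp n} (hcall : S.CallBound M) (hM : 0 ≤ M) (k : ℕ)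
    (hB : S.Bracket a b xb) (hx : x ∈ lev S.P.g S.DL) (hk : b - a ≤ 2 ^ k * S.ε₄)
    (hr : S.Bisec a b xb x out z N) : (N : ℝ) ≤ k * (M + 2) := by
  have hpass {a b : ℝ} {xb x y : Sp n} {N : ℕ} (hB : S.Bracket a b xb)
      (hx : x ∈ lev S.P.g S.DL) (hy : S.Call ((a + b) / 2) x y N) : (N : ℝ) ≤ M :=
    (hcall _ x hB.midpoint_nonneg hB.midpoint_le_Dz hx).2 y N hy
  have hsucc {a b : ℝ} (h : S.ε₄ < b - a) {k : ℕ} (hk : b - a ≤ 2 ^ k * S.ε₄) :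
      ∃ l, k = l + 1 ∧ (b - a) / 2 ≤ 2 ^ l * S.ε₄ := by
    rcases k with _ | l
    · rw [pow_zero, one_mul] at hk
      exact absurd h hk.not_gt
    · rw [pow_succ] at hk
      exact ⟨l, rfl, by linarith⟩
  induction hr generalizing k with
  | done _ => rw [Nat.cast_zero]; positivity
  | raise h hy hf _ ih =>
    obtain ⟨l, rfl, hl⟩ := hsucc h hk
    have hrec := ih l (H.bracket_raise hB hy hf) (H.mem_lev_of_call_midpoint hB hy) (by linarith)
    push_cast
    linarith [hpass hB hx hy]
  | hit h hy _ _ =>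
    obtain ⟨l, rfl, -⟩ := hsucc h hk
    have : 0 ≤ (l : ℝ) * (M + 2) := by positivity
    push_cast
    linarith [hpass hB hx hy]
  | lower h hy hf _ _ ih =>
    obtain ⟨l, rfl, hl⟩ := hsucc h hk
    have hrec := ih l (H.bracket_lower hB h hy hf) (H.mem_lev_of_call_midpoint hB hy)
      (by linarith)
    push_cast
    linarith [hpass hB hx hy]

lemma exists_intVLoop (hcall : S.CallBound M) (hb : 0 < b) (hbD : b ≤ 2 * S.Dz)
    (hx : S.Near b x) : ∃ a' b' x', S.IntVLoop a b x a' b' x' := by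
  obtain ⟨j, hj⟩ := pow_unbounded_of_one_lt (S.Dz / b) (one_lt_two (α := ℝ))
  rw [div_lt_iff₀ hb] at hj
  induction j generalizing a b x with
  | zero => exact ⟨_, _, _, .exit fun h => h.2.not_gt (by rwa [pow_zero, one_mul] at hj)⟩
  | succ j ih =>
    by_cases h : ¬ S.NearFeasible x ∧ b ≤ S.Dz
    swap
    · exact ⟨_, _, _, .exit h⟩
    have h2b : 2 * b ≤ 2 * S.Dz := by linarith [h.2]
    obtain ⟨y, N, hy⟩ := (hcall (2 * b) x (by positivity) h2b (H.near_mem_lev hb.le hbD hx)).1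
    obtain ⟨a', b', x', hr⟩ := ih (a := b) (by positivity) h2b
      (H.near_of_call (by positivity) h2b hy) (by rw [pow_succ] at hj; linarith)
    exact ⟨_, _, _, .double h hy hr⟩

lemma bracket_of_intVLoop {a' b' : ℝ} {x' : Sp n} (ha : 0 ≤ a) (hab : a ≤ b)
    (hbD : b ≤ 2 * S.Dz) (hx : S.Near b x)
    (hleft : a = 0 ∨ ∃ xa, S.Near a xa ∧ ¬ S.NearFeasible xa)
    (hr : S.IntVLoop a b x a' b' x') : S.Bracket a' b' x' := by
  induction hr with
  | exit h =>
    refine ⟨ha, hab, hbD, hx, ?_, .inr hleft⟩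
    by_contra hf
    exact h ⟨hf, not_lt.1 fun hlt => hf (H.nearFeasible_of_Dz_lt hlt hx)⟩
  | double h hy _ ih =>
    have h2b := mul_le_mul_of_nonneg_left h.2 zero_le_two
    exact ih (ha.trans hab) (by linarith) h2b (H.near_of_call (by linarith) h2b hy)
      (.inr ⟨_, hx, h.1⟩)

lemma exists_intV {σ : ℝ} (hcall : S.CallBound M) (hσ : 0 < σ) (hσD : σ ≤ 2 * S.Dz)
    (hy : y ∈ lev S.P.g S.DL) : ∃ a b xb, S.IntV σ y a b xb := by
  have hD : 0 ≤ 2 * S.Dz := hσ.le.trans hσD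
  obtain ⟨x, N, hx⟩ := (hcall 0 y le_rfl hD hy).1
  by_cases hf : S.NearFeasible x
  · exact ⟨_, _, _, .zero hx hf⟩
  · obtain ⟨w, N', hw⟩ := (hcall σ x hσ.le hσD
      (H.near_mem_lev le_rfl hD (H.near_of_call le_rfl hD hx))).1
    obtain ⟨a, b, xb, hl⟩ := H.exists_intVLoop (a := 0) hcall hσ hσD (H.near_of_call hσ.le hσD hw)
    by_cases hc : S.NearCompl b xb
    · exact ⟨_, _, _, .point hx hf hw hl hc⟩
    · exact ⟨_, _, _, .interval hx hf hw hl hc⟩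

lemma bracket_of_intV {σ : ℝ} (hσ : 0 ≤ σ) (hσD : σ ≤ 2 * S.Dz) (hr : S.IntV σ y a b xb) :
    S.Bracket a b xb := by
  have hD : 0 ≤ 2 * S.Dz := hσ.trans hσD
  have hloop {w xb : Sp n} {a b : ℝ} {N : ℕ} {x : Sp n} (hw : S.Call σ x w N)
      (hl : S.IntVLoop 0 σ w a b xb) : S.Bracket a b xb :=
    H.bracket_of_intVLoop le_rfl hσ hσD (H.near_of_call hσ hσD hw) (.inl rfl) hl
  cases hr with
  | zero hx hf => exact ⟨le_rfl, le_rfl, hD, H.near_of_call le_rfl hD hx, hf, .inr (.inl rfl)⟩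
  | point _ _ hw hl hc =>
    have hB := hloop hw hl
    have hcompl := ((H.nearCompl_iff (H.nearFeasible_iff.1 hB.feas).1).1 hc).1
    exact ⟨hB.nonneg_right, le_rfl, hB.le_Dz, hB.near, hB.feas, .inl ⟨rfl, neg_le.1 hcompl⟩⟩
  | interval _ _ hw hl _ => exact hloop hw hl

end Standing

end Setup

/-! ### Complexity -/

lemma one_sub_pow_le_pow {ε q : ℝ} {j k : ℕ} (hε : 0 < ε) (hq : q ≤ 1)
    (h : j * -Real.log ε ≤ k * q) : (1 - q) ^ k ≤ ε ^ j :=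
  calc (1 - q) ^ k ≤ Real.exp (-q) ^ k :=
        pow_le_pow_left₀ (sub_nonneg.2 hq) (Real.one_sub_le_exp_neg q) k
    _ = Real.exp (k * -q) := (Real.exp_nat_mul _ _).symm
    _ ≤ Real.exp (j * Real.log ε) := Real.exp_le_exp.2 (by linarith)
    _ = ε ^ j := by rw [Real.exp_nat_mul, Real.exp_log hε]

lemma one_sub_sqrt_pow_le_pow {ε L : ℝ} {j k : ℕ} (hε : 0 < ε) (h : ε ≤ L)
    (hk : j * -Real.log ε * √(L / ε) ≤ k) : (1 - √(ε / L)) ^ k ≤ ε ^ j := by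
  have hL : 0 < L := hε.trans_le h
  refine one_sub_pow_le_pow hε (Real.sqrt_le_one.2 ((div_le_one hL).2 h)) ?_
  calc j * -Real.log ε = j * -Real.log ε * √(L / ε) * √(ε / L) := by
        rw [mul_assoc _ √(L / ε), ← inv_div ε L, Real.sqrt_inv, inv_mul_cancel₀ (by positivity),
          mul_one]
    _ ≤ k * √(ε / L) := by gcongr

lemma one_le_neg_log {ε : ℝ} (hε : 0 < ε) (h : ε ≤ 1 / 3) : 1 ≤ -Real.log ε := by
  rw [← Real.log_inv, Real.le_log_iff_exp_le (inv_pos.2 hε), le_inv_comm₀ (Real.exp_pos 1) hε]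
  refine h.trans ?_
  rw [one_div]
  exact inv_anti₀ (Real.exp_pos 1) Real.exp_one_lt_three.le

lemma eventually_mul_le (K : ℝ) {b : ℝ} (hb : 0 < b) : ∀ᶠ ε in 𝓝[>] (0 : ℝ), K * ε ≤ b := by
  have : Filter.Tendsto (fun ε => K * ε) (𝓝[>] 0) (𝓝 0) :=
    ((continuous_const_mul K).tendsto' 0 0 (mul_zero K)).mono_left nhdsWithin_le_nhds
  exact this.eventually_le_const hb

/-- The constant of the complexity bound, for `γ₁ ≤ r` and `r⁻¹ Lmin ≤ L_{φ₁} ≤ r Lmin`. -/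
def complexityConst (γ₁ r : ℝ) : ℝ := 7 * (8 * passQueries γ₁ (r ^ 2) + 2) * √r

lemma complexityConst_pos {γ₁ r : ℝ} (hγ₁ : 1 < γ₁) (hr : 1 ≤ r) : 0 < complexityConst γ₁ r := by
  have := passQueries_pos hγ₁ (one_le_pow₀ hr : 1 ≤ r ^ 2)
  unfold complexityConst
  positivity

lemma search_cost_le {ℓ T W k : ℝ} (hℓ : 1 ≤ ℓ) (hT : 1 ≤ T) (hW : 0 ≤ W) (hk : k ≤ 6 * ℓ + 1) :
    k * ((5 * ℓ * T + 3) * W + 2) ≤ 7 * ℓ * (ℓ * T * (8 * W + 2)) := by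
  have hℓT : 1 ≤ ℓ * T := one_le_mul_of_one_le_of_one_le hℓ hT
  have hpass : (5 * ℓ * T + 3) * W + 2 ≤ ℓ * T * (8 * W + 2) :=
    calc (5 * ℓ * T + 3) * W + 2 = 5 * (ℓ * T) * W + 1 * (3 * W + 2) := by ring
      _ ≤ 5 * (ℓ * T) * W + ℓ * T * (3 * W + 2) := by gcongr
      _ = ℓ * T * (8 * W + 2) := by ring
  calc k * ((5 * ℓ * T + 3) * W + 2) ≤ 7 * ℓ * ((5 * ℓ * T + 3) * W + 2) := by
        gcongr
        linarith
    _ ≤ 7 * ℓ * (ℓ * T * (8 * W + 2)) := by gcongr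

namespace Setup

/-- From all admissible starting points, the interval search halts and the bisection returns an
`ε`-optimal solution after at most `B` oracle queries. -/
def SolvedWithin (S : Setup n) (B : ℝ) : Prop :=
  ∀ (σ : ℝ) (y₀ y₁ : Sp n), 0 < σ → σ ≤ 2 * S.Dz → y₀ ∈ lev S.P.g S.DL → y₁ ∈ lev S.P.g S.DL →
    (∃ a b xb, S.IntV σ y₀ a b xb) ∧ ∀ a b xb, S.IntV σ y₀ a b xb →
      (∃ x z N, S.Bisec a b xb y₁ x z N) ∧ ∀ x z N, S.Bisec a b xb y₁ x z N →
        S.P.IsEpsOptimal S.c S.ε x ∧ (N : ℝ) ≤ B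

lemma SolvedWithin.mono {S : Setup n} {B B' : ℝ} (h : S.SolvedWithin B) (hB : B ≤ B') :
    S.SolvedWithin B' := by
  intro σ y₀ y₁ hσ hσD hy₀ hy₁
  obtain ⟨hex, hall⟩ := h σ y₀ y₁ hσ hσD hy₀ hy₁
  exact ⟨hex, fun a b xb hr => ⟨(hall a b xb hr).1, fun x z N hrun =>
    ((hall a b xb hr).2 x z N hrun).imp_right fun hN => hN.trans hB⟩⟩

namespace Regular

variable {S : Setup n} {Γ : ℝ} (H : S.Regular Γ)
include H

lemma le_Γ {m : ℝ} (hm : ∀ x, (m : EReal) ≤ S.P.g x) : m ≤ Γ := by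
  have hgx0 : m ≤ (S.P.g S.x0).toReal := by
    rw [← EReal.coe_le_coe_iff, H.composite.g_pcl.coe_toReal H.x0_mem.2]
    exact hm _
  exact hgx0.trans H.toReal_g_x0_le

lemma callBound {m r : ℝ} (hm : ∀ x, (m : EReal) ≤ S.P.g x) (hr : S.γ₁ ≤ r)
    (hρ : S.Lphi ≤ r * S.Lmin) (hρ' : S.Lmin ≤ r * S.Lphi)
    (hK : 32 * (Γ - m + 4 * S.Dz * (|S.P.fStar.toReal| + 1) + r * S.Lphi / 2 * S.Dg ^ 2) *
      (r * S.Lphi) ^ 2 / S.Lmin * S.D ^ 2 * S.ε ≤ 1) :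
    S.CallBound ((5 * -Real.log S.ε * √(r * S.Lphi / S.ε) + 3) * passQueries S.γ₁ (r ^ 2)) := by
  have hε := H.ε_pos
  have hD := H.D_pos
  have hLmin : 0 < S.Lmin := hε.trans_le H.ε_le_Lmin
  have hr1 : 1 ≤ r := H.one_lt.le.trans hr
  have hLbar : 0 < r * S.Lphi := hLmin.trans_le hρ'
  set K := 32 * (Γ - m + 4 * S.Dz * (|S.P.fStar.toReal| + 1) + r * S.Lphi / 2 * S.Dg ^ 2) *
    (r * S.Lphi) ^ 2 / S.Lmin
  have hK0 : 0 ≤ K := by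
    have := sub_nonneg.2 (H.le_Γ hm)
    have := H.Dz_pos
    positivity
  intro z y hz hz' hy
  set T := 5 * -Real.log S.ε * √(r * S.Lphi / S.ε)
  have hpow : (1 - √(S.ε / (r * S.Lphi))) ^ (⌈T⌉₊ + 1) ≤ S.ε ^ 5 :=
    one_sub_sqrt_pow_le_pow hε (H.ε_le_Lmin.trans hρ')
      ((Nat.le_ceil T).trans (by exact_mod_cast ⌈T⌉₊.le_succ))
  obtain ⟨hex, hle⟩ := H.call hm hz hz' hρ' (mul_le_mul_of_nonneg_right hr
    (zero_le_one.trans H.one_le_Lphi)) hy ⌈T⌉₊ <|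
    calc (1 - √(S.ε / (r * S.Lphi))) ^ (⌈T⌉₊ + 1) * K ≤ S.ε ^ 5 * K := by gcongr
      _ = S.ε ^ 4 / S.D ^ 2 * (K * S.D ^ 2 * S.ε) := by field_simp
      _ ≤ S.ε ^ 4 / S.D ^ 2 * 1 := by gcongr
      _ = S.ε₁ ^ 2 := by rw [ε₁, div_pow, mul_one]; ring
  refine ⟨hex, fun x N hx => (hle x N hx).trans ?_⟩
  have hratio : r * S.Lphi / S.Lmin ≤ r ^ 2 := by
    rw [div_le_iff₀ hLmin, sq, mul_assoc]
    gcongr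
  have hceil : (⌈T⌉₊ : ℝ) ≤ T + 1 := by
    refine (Nat.ceil_lt_add_one ?_).le
    have := Real.log_nonpos hε.le (H.ε_le.trans (by norm_num))
    exact mul_nonneg (by linarith) (Real.sqrt_nonneg _)
  calc (⌈T⌉₊ + 2) * passQueries S.γ₁ (r * S.Lphi / S.Lmin)
      ≤ (⌈T⌉₊ + 2) * passQueries S.γ₁ (r ^ 2) :=
        mul_le_mul_of_nonneg_left (passQueries_mono H.one_lt (by positivity) hratio)
          (by positivity)
    _ ≤ (T + 3) * passQueries S.γ₁ (r ^ 2) :=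
        mul_le_mul_of_nonneg_right (by linarith)
          (passQueries_pos H.one_lt (one_le_pow₀ hr1 : 1 ≤ r ^ 2)).le

lemma two_Dz_le_two_pow_mul {k : ℕ} (h : 2 * S.Dz * S.D * S.ε ≤ 1)
    (hk : 6 * -Real.log S.ε ≤ k) : 2 * S.Dz ≤ 2 ^ k * S.ε₄ := by
  have hε := H.ε_pos
  have hD := H.D_pos
  have hpow : (1 / 2 : ℝ) ^ k ≤ S.ε ^ 3 := by
    have := one_sub_pow_le_pow (q := 1 / 2) (j := 3) (k := k) hε (by norm_num)
      (by push_cast; linarith)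
    rwa [sub_half] at this
  have hinv : (S.ε ^ 3)⁻¹ ≤ 2 ^ k := by
    rw [one_div, inv_pow] at hpow
    exact inv_le_of_inv_le₀ (by positivity) hpow
  calc 2 * S.Dz = 2 * S.Dz * S.D * S.ε * ((S.ε ^ 3)⁻¹ * (S.ε ^ 2 / S.D)) := by field_simp
    _ ≤ 1 * ((S.ε ^ 3)⁻¹ * (S.ε ^ 2 / S.D)) := by gcongr
    _ ≤ 1 * (2 ^ k * (S.ε ^ 2 / S.D)) := by gcongr
    _ = 2 ^ k * S.ε₄ := one_mul _

lemma ε₃_le_div {d : ℝ} (hd : 0 ≤ d) (h : d ≤ S.Dg) : S.ε₃ ≤ S.ε / (1 + d) := by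
  rw [le_div_iff₀ (by positivity)]
  refine (mul_le_mul_of_nonneg_left ?_ H.ε₃_nonneg).trans H.ε₃_mul_le
  linarith [mul_self_nonneg S.Dg]

lemma ε₄_mul_le_div {t d : ℝ} (hd : 0 ≤ d) (ht : 0 ≤ t) (h : t * (1 + d) / S.Δ₁ * S.ε ≤ 1) :
    S.ε₄ * t ≤ S.ε / (1 + d) := by
  have hε := H.ε_pos
  rw [le_div_iff₀ (by positivity)]
  calc S.ε₄ * t * (1 + d) ≤ S.ε ^ 2 / S.Δ₁ * t * (1 + d) := by
        have := H.ε₄_le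
        gcongr
    _ = S.ε * (t * (1 + d) / S.Δ₁ * S.ε) := by ring
    _ ≤ S.ε * 1 := by gcongr
    _ = S.ε := mul_one _

end Regular

namespace Standing

variable {S : Setup n} {Γ M τ : ℝ} (H : S.Standing Γ)
include H

lemma solvedWithin {k : ℕ} (hcall : S.CallBound M) (hM : 0 ≤ M) (hopt : S.OptBound τ)
    (h₃ : S.ε₃ ≤ τ) (h₄ : S.ε₄ * |S.c - S.P.fStar.toReal| ≤ τ) (hk : 2 * S.Dz ≤ 2 ^ k * S.ε₄) :
    S.SolvedWithin (k * (M + 2)) := by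
  intro σ y₀ y₁ hσ hσD hy₀ hy₁
  refine ⟨H.exists_intV hcall hσ hσD hy₀, fun a b xb hr => ?_⟩
  have hB := H.bracket_of_intV hσ.le hσD hr
  have hlen : b - a ≤ 2 ^ k * S.ε₄ := by linarith [hB.nonneg, hB.le_Dz]
  exact ⟨H.exists_bisec hcall k hB hy₁ hlen, fun x z N hrun =>
    ⟨H.isEpsOptimal_of_bisec hopt h₃ h₄ hB hrun,
      H.queries_bisec_le hcall hM k hB hy₁ hlen hrun⟩⟩

lemma solvedWithin_complexityConst {m r : ℝ} (hm : ∀ x, (m : EReal) ≤ S.P.g x) (hr : S.γ₁ ≤ r)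
    (hρ : S.Lphi ≤ r * S.Lmin) (hρ' : S.Lmin ≤ r * S.Lphi) (hε : S.ε ≤ 1 / 3)
    (hK : 32 * (Γ - m + 4 * S.Dz * (|S.P.fStar.toReal| + 1) + r * S.Lphi / 2 * S.Dg ^ 2) *
      (r * S.Lphi) ^ 2 / S.Lmin * S.D ^ 2 * S.ε ≤ 1)
    (hD : 2 * S.Dz * S.D * S.ε ≤ 1) (hopt : S.OptBound τ) (h₃ : S.ε₃ ≤ τ)
    (h₄ : S.ε₄ * |S.c - S.P.fStar.toReal| ≤ τ) :
    S.SolvedWithin (complexityConst S.γ₁ r * √(S.Lphi / S.ε) * |Real.log S.ε| ^ 2) := by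
  have hε0 := H.ε_pos
  have hr1 : 1 ≤ r := H.one_lt.le.trans hr
  have hW := passQueries_pos H.one_lt (one_le_pow₀ hr1 : 1 ≤ r ^ 2)
  have hlog := one_le_neg_log hε0 hε
  have hT : 1 ≤ √(r * S.Lphi / S.ε) :=
    Real.one_le_sqrt.2 ((one_le_div hε0).2 (H.ε_le_Lmin.trans hρ'))
  have hcall := H.callBound hm hr hρ hρ' hK
  set k := ⌈6 * -Real.log S.ε⌉₊
  refine (H.solvedWithin hcall (by positivity) hopt h₃ h₄
    (H.two_Dz_le_two_pow_mul (k := k) hD (Nat.le_ceil _))).mono ?_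
  refine (search_cost_le hlog hT hW.le (Nat.ceil_lt_add_one (by positivity)).le).trans_eq ?_
  rw [complexityConst, sq_abs, mul_div_assoc, Real.sqrt_mul (zero_le_one.trans hr1)]
  ring

lemma optBound {d δ η : ℝ} (hb : ∀ r, Bornology.IsBounded (lev S.P.g r)) (hd : 0 ≤ d)
    (hη : 0 ≤ η) (hηd : η * S.Dg + S.ε / S.Δ₁ * S.Dg ≤ d / (1 + d))
    (hδ : (1 + S.Dg ^ 2 + S.Dg / S.Δ₁) * S.ε ≤ δ)
    (hnear : ∀ x ∈ lev S.P.g ((S.P.gBar S.c).toReal + δ), x ∈ lev S.P.f (S.c + δ) →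
      ∃ s ∈ lev S.P.g (S.P.gBar S.c).toReal, s ∈ lev S.P.f S.c ∧ ‖s - x‖ < η) :
    S.OptBound (S.ε / (1 + d)) := by
  intro z x hz hz' hx hf hc
  refine H.isEpsOptimal hz hz' hx hf hc hb hη ?_ hδ hnear
  calc S.ε / (1 + d) + (η * S.Dg + S.ε / S.Δ₁ * S.Dg) * S.ε
      ≤ S.ε / (1 + d) + d / (1 + d) * S.ε := by
        have := H.ε_pos
        gcongr
    _ = S.ε := by field_simp

end Standing

/-! ### Bounds that do not depend on the accuracy -/

/-- `K` bounds the constants `D_z, D_g, D, L_{φ₁}` of the setup, and `d` bounds `D_g` from below.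
In contrast to these constants, `K` and `d` can be chosen before the accuracy, `x⁰` and `x̃_g`. -/
structure BoundedBy (S : Setup n) (K d : ℝ) : Prop where
  Dz_le : S.Dz ≤ K
  Dg_le : S.Dg ≤ K
  D_le : S.D ≤ K
  Lphi_le : S.Lphi ≤ K
  le_Dg : d ≤ S.Dg

namespace Regular

variable {S : Setup n} {Γ r Z : ℝ} (H : S.Regular Γ)
include H

lemma isBounded_lev (r : ℝ) : Bornology.IsBounded (lev S.P.g r) := by
  refine H.composite.g_pcl.isBounded_lev (p := S.x0) (r₀ := S.D₀) ?_ H.adm.bdd₀ r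
  rw [← H.composite.g_pcl.coe_toReal H.x0_mem.2, EReal.coe_lt_coe_iff]
  linarith [H.toReal_g_x0_add_one_le_D₀]

lemma Dz_le : S.Dz ≤ (Γ - S.P.gStar.toReal + 1) / S.Δ₁ :=
  div_le_div_of_nonneg_right
    (by linarith [H.toReal_g_x0_le, H.composite.gStar_le H.xg_mem]) H.Δ₁_pos.le

lemma D₀_le {U : ℝ} (hZ : S.Dz ≤ Z)
    (hU : ∀ x ∈ lev S.P.g (S.P.gStar.toReal + 1), x ∈ edom S.P.f → |(S.P.f x).toReal| ≤ U) :
    S.D₀ ≤ Γ + 2 * Z * |S.P.fStar.toReal| + 2 * Z * U := by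
  have hDz := H.Dz_pos
  have hu₀ : |S.u₀| ≤ U := by
    refine hU _ (lev_mono S.P.g ?_ H.g_xg_le) H.xg_mem.1
    linarith [H.ε_le]
  have hmax : max 0 (-2 * S.Dz * S.P.fStar.toReal) ≤ 2 * Z * |S.P.fStar.toReal| :=
    max_le (by have := hDz.le.trans hZ; positivity) <|
      calc -2 * S.Dz * S.P.fStar.toReal = 2 * S.Dz * -S.P.fStar.toReal := by ring
        _ ≤ 2 * S.Dz * |S.P.fStar.toReal| := by
          gcongr
          exact neg_le_abs _
        _ ≤ 2 * Z * |S.P.fStar.toReal| := by gcongr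
  have hu₀' : 2 * S.Dz * |S.u₀| ≤ 2 * Z * U := by
    have := hDz.le.trans hZ
    gcongr
  exact add_le_add_three H.toReal_g_x0_le hmax hu₀'

lemma DL_le {L : ℝ} (hr : S.D₀ ≤ r) (hL : S.Lphi ≤ L) :
    S.DL ≤ r + S.γ₁ * L * Metric.diam (lev S.P.g r) ^ 2 := by
  have := H.one_lt
  have := (zero_le_one.trans H.one_le_Lphi).trans hL
  have hR₁ : S.R₁ ≤ Metric.diam (lev S.P.g r) :=
    Metric.diam_mono (lev_mono S.P.g hr) (H.isBounded_lev r)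
  have : 0 ≤ S.R₁ := Metric.diam_nonneg
  unfold DL
  gcongr

lemma Bf_le (hr : S.DL ≤ r) :
    S.Bf ≤ sSup ((fun x => ‖gradient S.P.f₁ x‖) '' lev S.P.g r) + S.P.lf₂ :=
  add_le_add_left (csSup_le_csSup
    (bddAbove_norm_image H.composite.f₁_lip.continuous (H.isBounded_lev r))
    (Set.Nonempty.image _ ⟨_, H.x0_mem_lev⟩) (Set.image_mono (lev_mono S.P.g hr))) _

lemma D_le {R B : ℝ} (hR : S.Dg ≤ R) (hB : S.Bf ≤ B) (hZ : S.Dz ≤ Z) :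
    S.D ≤ (1 + R * (1 + R)) * max B (2 * Z * B + 2 * Z * B ^ 2) := by
  have := S.Dg_nonneg.trans hR
  have := H.Dz_pos.le.trans hZ
  have := S.Dg_nonneg
  have := S.Bf_nonneg
  unfold D
  gcongr

lemma div_le_Dg {B : ℝ} (hB : S.Bf ≤ B) : S.Δ₁ / (B + 1) ≤ S.Dg := by
  have := S.Bf_nonneg.trans hB
  rw [div_le_iff₀ (by positivity), mul_comm]
  refine H.Δ₁_le_mul.trans (mul_le_mul_of_nonneg_right ?_ S.Dg_nonneg)
  linarith

end Regular

lemma exists_boundedBy {P : Problem n} (hP : P.ConvexComposite)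
    (hb : ∀ r, Bornology.IsBounded (lev P.g r)) (γ₁ Γ : ℝ) {Δ₁ : ℝ} (hΔ₁ : 0 < Δ₁) :
    ∃ K d : ℝ, 0 < K ∧ 0 < d ∧ ∀ S : Setup n, S.P = P → S.γ₁ = γ₁ → S.Δ₁ = Δ₁ →
      S.Regular Γ → S.BoundedBy K d := by
  obtain ⟨U, hU⟩ := hP.exists_abs_f_le (hb (P.gStar.toReal + 1))
  let Z := (Γ - P.gStar.toReal + 1) / Δ₁
  let L := P.Lg₁ + 2 * Z * P.Lf₁ + 1
  let r₀ := Γ + 2 * Z * |P.fStar.toReal| + 2 * Z * U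
  let r := r₀ + γ₁ * L * Metric.diam (lev P.g r₀) ^ 2
  let R := Metric.diam (lev P.g r)
  let B := sSup ((fun x => ‖gradient P.f₁ x‖) '' lev P.g r) + P.lf₂
  let D := (1 + R * (1 + R)) * max B (2 * Z * B + 2 * Z * B ^ 2)
  have hB : 0 ≤ B :=
    add_nonneg (Real.sSup_nonneg (by rintro _ ⟨x, -, rfl⟩; exact norm_nonneg _)) P.lf₂.2
  refine ⟨max 1 (max (max Z R) (max D L)), Δ₁ / (B + 1), lt_max_of_lt_left one_pos,
    by positivity, ?_⟩
  rintro S rfl rfl rfl H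
  have hZ : S.Dz ≤ Z := H.Dz_le
  have hL : S.Lphi ≤ L := by
    unfold Lphi L
    gcongr
  have hr : S.DL ≤ r := H.DL_le (H.D₀_le hZ hU) hL
  have hR : S.Dg ≤ R := Metric.diam_mono (lev_mono S.P.g hr) (hb r)
  have hBf : S.Bf ≤ B := H.Bf_le hr
  have hD : S.D ≤ D := H.D_le hR hBf hZ
  exact ⟨by simp [hZ], by simp [hR], by simp [hD], by simp [hL], H.div_le_Dg hBf⟩

/-! ### Small accuracies -/

lemma eventually_optBound {P : Problem n} (hP : P.ConvexComposite)
    (hb : ∀ r, Bornology.IsBounded (lev P.g r)) (c Γ : ℝ) {Δ₁ K d : ℝ} (hΔ₁ : 0 < Δ₁)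
    (hK : 0 < K) (hd : 0 < d) :
    ∀ᶠ ε in 𝓝[>] (0 : ℝ), ∀ S : Setup n, S.P = P → S.c = c → S.Δ₁ = Δ₁ → S.ε = ε →
      S.Standing Γ → S.BoundedBy K d → S.OptBound (ε / (1 + d)) := by
  have hκ : 0 < d / (1 + d) / 2 := by positivity
  obtain ⟨δ, hδ, hnear⟩ := exists_pos_forall_mem_lev_near hP.g_pcl.lsc hP.f_pcl.lsc
    (P.gBar c).toReal c (hb _) (div_pos hκ hK)
  filter_upwards [eventually_mul_le (1 + K ^ 2 + K / Δ₁) hδ, eventually_mul_le (K / Δ₁) hκ]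
    with ε hεδ hεκ
  rintro S rfl rfl rfl rfl H hS
  have := H.ε_pos
  have := S.Dg_nonneg
  have hDg := hS.Dg_le
  refine H.optBound hb hd.le (div_pos hκ hK).le ?_ (le_trans (by gcongr) hεδ) hnear
  calc d / (1 + d) / 2 / K * S.Dg + S.ε / S.Δ₁ * S.Dg
      ≤ d / (1 + d) / 2 / K * K + S.ε / S.Δ₁ * K := by gcongr
    _ = d / (1 + d) / 2 + K / S.Δ₁ * S.ε := by rw [div_mul_cancel₀ _ hK.ne']; ring
    _ ≤ d / (1 + d) := by linarith

lemma eventually_regular {P : Problem n} (hP : P.ConvexComposite) {γ₁ Lmin Δ₁ : ℝ}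
    (hγ₁ : 1 < γ₁) (hLmin : 0 < Lmin) (hΔ₁ : 0 < Δ₁) (Γ : ℝ) :
    ∀ᶠ ε in 𝓝[>] (0 : ℝ), ∀ S : Setup n, S.P = P → S.γ₁ = γ₁ → 1 ≤ S.γ₂ → S.Lmin = Lmin →
      S.Δ₁ = Δ₁ → S.ε = ε → S.Admissible Γ → S.Regular Γ := by
  filter_upwards [self_mem_nhdsWithin, eventually_mul_le 1 one_half_pos,
    eventually_mul_le 1 hLmin] with ε hε hε2 hεL
  rw [one_mul] at hε2 hεL
  rintro S rfl rfl hγ₂ rfl rfl rfl hA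
  exact ⟨hP, hA, hγ₁, hγ₂, hΔ₁, hε, hε2, hεL⟩

lemma eventually_solvedWithin {P : Problem n} (hP : P.ConvexComposite) {γ₁ Lmin Δ₁ : ℝ}
    (hγ₁ : 1 < γ₁) (hLmin : 0 < Lmin) (hΔ₁ : 0 < Δ₁) (ρ c Γ : ℝ) :
    ∀ᶠ ε in 𝓝[>] (0 : ℝ), ∀ S : Setup n, S.P = P → S.γ₁ = γ₁ → 1 ≤ S.γ₂ → S.Lmin = Lmin →
      S.c = c → S.Δ₁ = Δ₁ → S.ε = ε → S.Admissible Γ → S.Lphi ≤ ρ * Lmin → Lmin ≤ ρ * S.Lphi →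
      S.SolvedWithin (complexityConst γ₁ (max ρ γ₁) * √(S.Lphi / ε) * |Real.log ε| ^ 2) := by
  set r := max ρ γ₁
  have hρr : ρ ≤ r := le_max_left ρ γ₁
  have hr : γ₁ ≤ r := le_max_right ρ γ₁
  have hregular := eventually_regular hP hγ₁ hLmin hΔ₁ Γ
  by_cases hb : ∀ r, Bornology.IsBounded (lev P.g r)
  swap
  · filter_upwards [hregular] with ε hreg
    rintro S rfl rfl hγ₂ rfl rfl rfl rfl hA
    exact absurd (hreg S rfl rfl hγ₂ rfl rfl rfl hA).isBounded_lev hb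
  obtain ⟨K, d, hK, hd, hbound⟩ := exists_boundedBy hP hb γ₁ Γ hΔ₁
  obtain ⟨p, hp⟩ := hP.g_pcl.nonempty_dom
  obtain ⟨m, hm⟩ := exists_le_of_isBounded_lev (r := (P.g p).toReal) hP.g_pcl.lsc hP.g_pcl.ne_bot
    ⟨p, hP.g_pcl.le_of_toReal_le hp le_rfl⟩ (hb _)
  filter_upwards [hregular, eventually_optBound hP hb c Γ hΔ₁ hK hd,
    eventually_mul_le (2 * K + 1 / Δ₁ ^ 2) (b := 1 / 4) (by norm_num),
    eventually_mul_le 1 (b := 1 / 3) (by norm_num),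
    eventually_mul_le (32 * (Γ - m + 4 * K * (|P.fStar.toReal| + 1) + r * K / 2 * K ^ 2) *
      (r * K) ^ 2 / Lmin * K ^ 2) one_pos,
    eventually_mul_le (2 * K * K) one_pos,
    eventually_mul_le (|c - P.fStar.toReal| * (1 + d) / Δ₁) one_pos]
    with ε hreg hopt hsmall hε3 hεK hεD hεc
  rintro S rfl rfl hγ₂ rfl rfl rfl rfl hA hρ hρ'
  have H := hreg S rfl rfl hγ₂ rfl rfl rfl hA
  obtain ⟨hDz, hDg, hD, hL, hdDg⟩ := hbound S rfl rfl rfl H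
  have := H.ε_pos
  have := H.Dz_pos
  have := H.D_pos
  have := S.Dg_nonneg
  have hL0 := zero_le_one.trans H.one_le_Lphi
  have hr0 : 0 ≤ r := (zero_le_one.trans hγ₁.le).trans hr
  have := sub_nonneg.2 (H.le_Γ hm)
  have H' : S.Standing Γ := ⟨H, le_trans (by gcongr) hsmall⟩
  exact H'.solvedWithin_complexityConst hm hr
    (hρ.trans (mul_le_mul_of_nonneg_right hρr hLmin.le))
    (hρ'.trans (mul_le_mul_of_nonneg_right hρr hL0)) (by rwa [one_mul] at hε3)
    (le_trans (by gcongr) hεK) (le_trans (by gcongr) hεD)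
    (hopt S rfl rfl rfl rfl H' ⟨hDz, hDg, hD, hL, hdDg⟩)
    (H.ε₃_le_div hd.le hdDg) (H.ε₄_mul_le_div hd.le (abs_nonneg _) hεc)

end Setup

end SimpleBilevel

end

theorem corollary1_general (γ₁ γ₂ ρ : ℝ) (hγ₁ : 1 < γ₁) (hγ₂ : 1 ≤ γ₂) :
    ∃ C : ℝ, 0 < C ∧
    ∀ (n : ℕ) (P : Problem n), P.ConvexComposite →
    ∀ (Lmin c Δ₁ Γ : ℝ), 0 < Lmin → 0 < Δ₁ →
    ∃ εbar : ℝ, 0 < εbar ∧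
    ∀ (ε : ℝ) (x0 xg : Sp n), 0 < ε → ε ≤ εbar →
    ∀ S : Setup n,
      S = { P := P, γ₁ := γ₁, γ₂ := γ₂, Lmin := Lmin, c := c, Δ₁ := Δ₁, ε := ε,
            x0 := x0, xg := xg } →
      S.Admissible Γ →
      S.Lphi ≤ ρ * Lmin → Lmin ≤ ρ * S.Lphi →
      ∀ (σ : ℝ) (y₀ y₁ : Sp n), 0 < σ → σ ≤ 2 * S.Dz →
        y₀ ∈ lev P.g S.DL → y₁ ∈ lev P.g S.DL →
        (∃ (a b : ℝ) (xb : Sp n), S.IntV σ y₀ a b xb) ∧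
        ∀ (a b : ℝ) (xb : Sp n), S.IntV σ y₀ a b xb →
          (∃ (x : Sp n) (z : ℝ) (N : ℕ), S.Bisec a b xb y₁ x z N) ∧
          ∀ (x : Sp n) (z : ℝ) (N : ℕ), S.Bisec a b xb y₁ x z N →
            P.IsEpsOptimal c ε x ∧
            (N : ℝ) ≤ C * √((P.Lg₁ + 2 * S.Dz * P.Lf₁ + 1) / ε) * |Real.log ε| ^ 2 := by
  refine ⟨complexityConst γ₁ (max ρ γ₁),
    complexityConst_pos hγ₁ (hγ₁.le.trans (le_max_right ρ γ₁)),
    fun n P hP Lmin c Δ₁ Γ hLmin hΔ₁ => ?_⟩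
  obtain ⟨εbar, hεbar, h⟩ := mem_nhdsGT_iff_exists_Ioc_subset.1
    (Setup.eventually_solvedWithin hP hγ₁ hLmin hΔ₁ ρ c Γ)
  refine ⟨εbar, hεbar, ?_⟩
  rintro ε x0 xg hε hε' S rfl hA hρ hρ'
  exact h ⟨hε, hε'⟩ _ rfl rfl hγ₂ rfl rfl rfl rfl hA hρ hρ'

theorem corollary1 (γ₁ γ₂ ρ : ℝ) (hγ₁ : 1 < γ₁) (hγ₂ : 1 ≤ γ₂) :
    -- the constant of the complexity bound
    ∃ C : ℝ, 0 < C ∧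
    ∀ (n : ℕ) (P : Problem n), P.Basic →
    ∀ (Lmin c Δ₁ Γ : ℝ), 0 < Lmin → 0 < Δ₁ →
    -- for all sufficiently small accuracies
    ∃ εbar : ℝ, 0 < εbar ∧
    ∀ (ε : ℝ) (x0 xg : Sp n), 0 < ε → ε ≤ εbar →
    ∀ S : Setup n,
      S = { P := P, γ₁ := γ₁, γ₂ := γ₂, Lmin := Lmin, c := c, Δ₁ := Δ₁, ε := ε,
            x0 := x0, xg := xg } →
      S.Admissible Γ →
      S.Lphi ≤ ρ * Lmin → Lmin ≤ ρ * S.Lphi →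
      ∀ (σ : ℝ) (y₀ y₁ : Sp n), 0 < σ → σ ≤ 2 * S.Dz →
        y₀ ∈ lev P.g S.DL → y₁ ∈ lev P.g S.DL →
        -- the interval search returns an interval `[a, b]`, and for every such interval
        -- bisection started at `y₁` halts with an `ε`-optimal solution within the bound
        (∃ (a b : ℝ) (xb : Sp n), S.IntV σ y₀ a b xb) ∧
        ∀ (a b : ℝ) (xb : Sp n), S.IntV σ y₀ a b xb →
          (∃ (x : Sp n) (z : ℝ) (N : ℕ), S.Bisec a b xb y₁ x z N) ∧
          ∀ (x : Sp n) (z : ℝ) (N : ℕ), S.Bisec a b xb y₁ x z N →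
            P.IsEpsOptimal c ε x ∧
            (N : ℝ) ≤ C * √((P.Lg₁ + 2 * S.Dz * P.Lf₁ + 1) / ε) * |Real.log ε| ^ 2 := by
  obtain ⟨C, hC, h⟩ := corollary1_general γ₁ γ₂ ρ hγ₁ hγ₂
  exact ⟨C, hC, fun n P hP => h n P hP.convexComposite⟩
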